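/- **Setting.** A polyomino is a finite set $\tau\subset\mathbb{Z}^2$; its characteristic polynomial is $p(z,u)=\sum_{(i,j)\in\tau}z^iu^j$. Let $\mathbb{T}^2=\{(z,u)\in\mathbb{C}^2:|z|=|u|=1\}$. A root $(z,u)\in\mathbb{T}^2$ of $p$ is *simple* if $zp_z(z,u)/(u\,p_u(z,u))$ is not a real number (nor $\infty$). For $n\ge1$ the tiles on the torus $(\mathbb{Z}/n\mathbb{Z})^2$ with an additional dummy vertex $v_0$ are the translates of $\tau$ and the singletons, each singleton being completed by $|\tau|-1$ copies of $v_0$, so that all tiles have size $|\tau|$. Let every vertex $v$ of the torus have multiplicity $N_v=N$ and let $v_0$ have multiplicity $N_0$. Replace each vertex $v$ by $N_v$ vertices lying above it. A tiling is a partition of the resulting vertex set into lifts of tiles, where a lift of a tile consists of as many distinct vertices above $v$ as the multiplicity of $v$ in the tile, for each $v$. The total number $K$ of tiles is given by $|\tau|K=n^2N+N_0$. Translates of $\tau$ have weight $w>0$ and singletons weight $w_0>0$; the probability of a tiling is proportional to the product of the weights of its tiles. The weights are normalized to the critical gauge: at each vertex $v$ (including $v_0$) the sum of the weights of the tiles containing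 $v$, counted with multiplicity, is $N_v/K$. Let $X_{s,t}$ be the number of lifts of $\tau+(s,t)$ in a random tiling. For $\varepsilon>0$, the covariance for tilings of $\mathbb{Z}^2$ with $w_0/w=\varepsilon$ means the normalized limit $$C_\varepsilon(s,t)=\lim_{n\to\infty}\ \lim_{N\to\infty}\ \frac{\mathrm{Cov}(X_{0,0},X_{s,t})}{Kw_0},$$ the inner limit being along any sequence of multiplicities for which $N\to\infty$, the multiplicities are nonnegative integer combinations of tiles, the critical weights $w,w_0$ are positive, and $w_0/w\to\varepsilon$. **Theorem.** Suppose that $p$ has only finitely many roots $(z_1,u_1),\dots,(z_k,u_k)$ on $\mathbb{T}^2$, $k\ge1$, all of them simple. Then $C_\varepsilon(s,t)$ exists for all $\varepsilon>0$ and $(s,t)\in\mathbb{Z}^2$. Put $$|z_jp_z(z_j,u_j)x+u_jp_u(z_j,u_j)y|^2=a_jx^2+b_jxy+c_jy^2,\qquad D_j=a_jc_j-b_j^2/4 .$$ Then $D_j>0$, and the following hold. 1. For $(s,t)\ne(0,0)$ and $\varepsilon>0$ the integrals $$J_j(\varepsilon,s,t)=\int_{\mathbb{R}^2}\frac{e^{i(sx+ty)}\,dx\,dy}{\varepsilon+|z_jp_z(z_j,u_j)x+u_jp_u(z_j,u_j)y|^2}$$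 converge as improper integrals (limits as $L\to\infty$ of the integrals over $[-L,L]^2$), and they are Bessel-K functions: $$J_j(\varepsilon,s,t)=\frac{2\pi}{\sqrt{D_j}}\,K_0\!\left(\sqrt{\frac{\varepsilon\,(c_js^2-b_jst+a_jt^2)}{D_j}}\right),\qquad K_0(r)=\int_0^\infty e^{-r\cosh x}\,dx .$$ 2. For $(s,t)\neq(0,0)$, as $\varepsilon\to0$, $$\mathrm{Cov}(X_{0,0},X_{s,t})\ \sim\ Kw_0\sum_{j=1}^k\frac{z_j^su_j^t}{(2\pi)^2}J_j(\varepsilon,s,t),$$ each term of the sum being accurate up to a $1+o_\varepsilon(1)$ factor, in the following sense: writing $T_j=\frac{z_j^su_j^t}{(2\pi)^2}J_j(\varepsilon,s,t)$, for all $M,\eta>0$ there is $\varepsilon_0>0$ such that $$\Big|C_\varepsilon(s,t)-\sum_jT_j\Big|\le\eta\sum_j|T_j|$$ whenever $0<\varepsilon<\varepsilon_0$, $(s,t)\ne(0,0)$ and $\varepsilon(s^2+t^2)\le M$. In particular, for each fixed $(s,t)\ne(0,0)$ with $\sum_jz_j^su_j^t/\sqrt{D_j}\ne0$, one has $C_\varepsilon(s,t)=(1+o_\varepsilon(1))\sum_jT_j$.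 3. For $(s,t)=(0,0)$, where the integrals diverge, $$C_\varepsilon(0,0)=(1+o_\varepsilon(1))\sum_{j=1}^k\frac{1}{2\pi\sqrt{4a_jc_j-b_j^2}}\log\frac1\varepsilon .$$ -/

import Mathlib

open Filter Topology

noncomputable section

namespace MultinomialTiling

/-! ### The multinomial tiling model on a finite vertex set

A tile is identified with its multiset of vertices `t : V → ℕ` (`t v` is the multiplicity
of the vertex `v` in `t`). Edges of the graph play no role in which vertex sets are lifts of tiles. -/

section Model

variable {V : Type} [Fintype V] [DecidableEq V]

/-- The vertices of the `N`-fold blow-up: each vertex `v` is replaced by `N v` vertices. -/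
abbrev Blowup (N : V → ℕ) : Type := Σ v : V, Fin (N v)

/-- How many vertices of the block `b` lie above each vertex of the graph. -/
def profile {N : V → ℕ} (b : Finset (Blowup N)) : V → ℕ :=
  fun v => (b.filter (fun x => x.1 = v)).card

/-- `b` is a lift of the tile `t`: it consists of `t v` distinct vertices above `v`, for each `v`. -/
def IsLift {N : V → ℕ} (t : V → ℕ) (b : Finset (Blowup N)) : Prop := profile b = t

/-- Partitions of the set of all vertices of the blow-up into nonempty blocks. -/
abbrev Partitions (N : V → ℕ) : Type := Finpartition (Finset.univ : Finset (Blowup N))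

open Classical in
/-- The set of `N`-fold tilings: partitions of the vertices of the blow-up into blocks,
each of which is a lift of a tile of `T`. -/
def tilings (T : Finset (V → ℕ)) (N : V → ℕ) : Finset (Partitions N) :=
  Finset.univ.filter (fun m => ∀ b ∈ m.parts, ∃ t ∈ T, IsLift t b)

open Classical in
/-- `X_t`: the number of lifts of the tile `t` used in a tiling. -/
def tileCount {N : V → ℕ} (t : V → ℕ) (m : Partitions N) : ℕ :=
  (m.parts.filter (fun b => IsLift t b)).card

/-- The weight `∏_t w_t ^ X_t` of a tiling. -/
def weight (T : Finset (V → ℕ)) (w : (V → ℕ) → ℝ) {N : V → ℕ} (m : Partitions N) : ℝ :=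
  ∏ t ∈ T, w t ^ tileCount t m

/-- The partition function. -/
def partitionFn (T : Finset (V → ℕ)) (w : (V → ℕ) → ℝ) (N : V → ℕ) : ℝ :=
  ∑ m ∈ tilings T N, weight T w m

/-- Expectation with respect to the measure on `N`-fold tilings that gives a tiling a probability
proportional to its weight. -/
def expect (T : Finset (V → ℕ)) (w : (V → ℕ) → ℝ) (N : V → ℕ) (f : Partitions N → ℝ) : ℝ :=
  (∑ m ∈ tilings T N, weight T w m * f m) / partitionFn T w N

/-- The covariance `E[X_t X_t'] - E[X_t] E[X_t']` of two tile multiplicities. -/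
def tileCov (T : Finset (V → ℕ)) (w : (V → ℕ) → ℝ) (N : V → ℕ) (t t' : V → ℕ) : ℝ :=
  expect T w N (fun m => (tileCount t m : ℝ) * (tileCount t' m : ℝ))
    - expect T w N (fun m => (tileCount t m : ℝ)) * expect T w N (fun m => (tileCount t' m : ℝ))

/-- Feasible multiplicities: nonnegative integer combinations of the tiles. -/
def Feasible (T : Finset (V → ℕ)) (N : V → ℕ) : Prop :=
  ∃ k : (V → ℕ) → ℕ, ∀ v, N v = ∑ t ∈ T, k t * t v

/-- The weights `w` are in the critical gauge for multiplicities `N` and total number of tiles `K`: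
for each vertex `v` the weights of the tiles containing `v`, counted with multiplicity, add up
to `α_v = N_v / K`. -/
def IsCriticalGauge (T : Finset (V → ℕ)) (w : (V → ℕ) → ℝ) (N : V → ℕ) (K : ℕ) : Prop :=
  ∀ v, ∑ t ∈ T, w t * (t v : ℝ) = (N v : ℝ) / (K : ℝ)

end Model

/-! ### Translates of a polyomino together with singletons, on the torus `(ℤ/nℤ)²`

The vertex `none` is the dummy vertex. Each singleton tile is completed by `|τ| - 1` copies of the
dummy vertex, so that all tiles have the same size `|τ|`; the multiplicity of the dummy vertex then
controls the number of singletons. -/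

section Torus

variable (n : ℕ) [NeZero n] (τ : Finset (ℤ × ℤ))

/-- The vertices of the torus, with a dummy vertex adjoined. -/
abbrev TorusVertex (n : ℕ) : Type := Option (ZMod n × ZMod n)

/-- The translate `τ + a`, as a multiset of vertices of the torus. -/
def polyTile (a : ZMod n × ZMod n) : TorusVertex n → ℕ
  | none => 0
  | some x => (τ.filter (fun c => (a.1 + (c.1 : ZMod n), a.2 + (c.2 : ZMod n)) = x)).card

/-- The singleton at `a`, completed by `|τ| - 1` copies of the dummy vertex. -/
def singleTile (a : ZMod n × ZMod n) : TorusVertex n → ℕ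
  | none => τ.card - 1
  | some x => if x = a then 1 else 0

def polyTiles : Finset (TorusVertex n → ℕ) := Finset.univ.image (polyTile n τ)

def singleTiles : Finset (TorusVertex n → ℕ) := Finset.univ.image (singleTile n τ)

/-- All tiles. -/
def torusTiles : Finset (TorusVertex n → ℕ) := polyTiles n τ ∪ singleTiles n τ

/-- Weight `w` for each translate of the polyomino and `w₀` for each singleton. -/
def torusWeight (w w₀ : ℝ) (t : TorusVertex n → ℕ) : ℝ := if t ∈ polyTiles n τ then w else w₀

/-- Multiplicity `N` at each vertex of the torus and `N₀` at the dummy vertex. -/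
def torusMult (N N₀ : ℕ) : TorusVertex n → ℕ
  | none => N₀
  | some _ => N

/-- On the torus of side `n`: as the multiplicities tend to infinity, along any feasible
multiplicities whose critical weights `w`, `w₀` satisfy `w₀ / w → ε`, the covariance
`Cov(X_{(0,0)}, X_{(s,t)})` divided by `K w₀` tends to `c`. Here `K` is the total number of tiles. -/
def HasTorusCov (ε : ℝ) (s t : ℤ) (c : ℝ) : Prop :=
  ∀ (N N₀ K : ℕ → ℕ) (w w₀ : ℕ → ℝ),
    Tendsto N atTop atTop →
    (∀ k, Feasible (torusTiles n τ) (torusMult n (N k) (N₀ k))) →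
    (∀ k, τ.card * K k = ∑ v, torusMult n (N k) (N₀ k) v) →
    (∀ k, 0 < w k) → (∀ k, 0 < w₀ k) →
    (∀ k, IsCriticalGauge (torusTiles n τ) (torusWeight n τ (w k) (w₀ k))
      (torusMult n (N k) (N₀ k)) (K k)) →
    Tendsto (fun k => w₀ k / w k) atTop (𝓝 ε) →
    Tendsto (fun k =>
      tileCov (torusTiles n τ) (torusWeight n τ (w k) (w₀ k)) (torusMult n (N k) (N₀ k))
        (polyTile n τ (0, 0)) (polyTile n τ ((s : ZMod n), (t : ZMod n))) / ((K k : ℝ) * w₀ k))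
      atTop (𝓝 c)

end Torus

/-- For tilings of `ℤ²` (the limit of the tori of side `n + 1`, `n → ∞`) by translates of `τ` and
singletons with `w₀ / w = ε`, the normalized covariance `Cov(X_{(0,0)}, X_{(s,t)}) / (K w₀)`
is `c`. -/
def HasPlaneCov (τ : Finset (ℤ × ℤ)) (ε : ℝ) (s t : ℤ) (c : ℝ) : Prop :=
  ∃ cn : ℕ → ℝ, (∀ᶠ n in atTop, HasTorusCov (n + 1) τ ε s t (cn n)) ∧ Tendsto cn atTop (𝓝 c)

/-! ### The characteristic polynomial and its roots on the unit torus -/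

/-- The characteristic polynomial `p(z,u) = ∑_{(i,j) ∈ τ} z^i u^j` of a polyomino. -/
def charPoly (τ : Finset (ℤ × ℤ)) (z u : ℂ) : ℂ := ∑ c ∈ τ, z ^ c.1 * u ^ c.2

/-- `z p_z(z,u)` -/
def zDeriv (τ : Finset (ℤ × ℤ)) (z u : ℂ) : ℂ := z * deriv (fun z' => charPoly τ z' u) z

/-- `u p_u(z,u)` -/
def uDeriv (τ : Finset (ℤ × ℤ)) (z u : ℂ) : ℂ := u * deriv (fun u' => charPoly τ z u') u

/-- A root is simple if `z p_z / (u p_u)` is not real (nor infinite). -/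
def IsSimpleRoot (τ : Finset (ℤ × ℤ)) (z u : ℂ) : Prop :=
  charPoly τ z u = 0 ∧ uDeriv τ z u ≠ 0 ∧ ∀ r : ℝ, zDeriv τ z u / uDeriv τ z u ≠ (r : ℂ)

/-! The coefficients of the quadratic form `|z p_z x + u p_u y|² = a x² + b x y + c y²`. -/

def quadA (τ : Finset (ℤ × ℤ)) (q : ℂ × ℂ) : ℝ := ‖zDeriv τ q.1 q.2‖ ^ 2

def quadB (τ : Finset (ℤ × ℤ)) (q : ℂ × ℂ) : ℝ :=
  2 * (zDeriv τ q.1 q.2 * (starRingEnd ℂ) (uDeriv τ q.1 q.2)).re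

def quadC (τ : Finset (ℤ × ℤ)) (q : ℂ × ℂ) : ℝ := ‖uDeriv τ q.1 q.2‖ ^ 2

/-- `a c - b² / 4` -/
def quadDet (τ : Finset (ℤ × ℤ)) (q : ℂ × ℂ) : ℝ :=
  quadA τ q * quadC τ q - quadB τ q ^ 2 / 4

/-! ### The Fourier integrals -/

/-- The integrand `e^{i(sx+ty)} / (ε + |z p_z x + u p_u y|²)` at the root `q = (z,u)`. -/
def rootIntegrand (τ : Finset (ℤ × ℤ)) (q : ℂ × ℂ) (ε : ℝ) (s t : ℤ) (v : ℝ × ℝ) : ℂ :=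
  Complex.exp (Complex.I * ((s : ℂ) * (v.1 : ℂ) + (t : ℂ) * (v.2 : ℂ))) /
    ((ε + ‖zDeriv τ q.1 q.2 * (v.1 : ℂ) + uDeriv τ q.1 q.2 * (v.2 : ℂ)‖ ^ 2 : ℝ) : ℂ)

/-- `∫_{ℝ²} f = J` as an improper integral: the limit of the integrals over growing squares.
(The Fourier integrals above are not absolutely convergent.) -/
def HasImproperIntegral (f : ℝ × ℝ → ℂ) (J : ℂ) : Prop :=
  Tendsto (fun L : ℝ => ∫ v in Set.Icc (-L) L ×ˢ Set.Icc (-L) L, f v) atTop (𝓝 J)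

/-- The Bessel-K function `K₀(r) = ∫_0^∞ e^{-r cosh x} dx`, `r > 0`. -/
def besselK (r : ℝ) : ℝ := ∫ x in Set.Ioi (0 : ℝ), Real.exp (-(r * Real.cosh x))

/-- The contribution `z^s u^t / (2π)² · J` of the root `q = (z,u)`. -/
def rootTerm (q : ℂ × ℂ) (s t : ℤ) (J : ℂ) : ℂ :=
  q.1 ^ s * q.2 ^ t / (2 * (Real.pi : ℂ)) ^ 2 * J

end MultinomialTiling

end

open MultinomialTiling

/-!
The proof reduces the random tiling to conditioned Poisson variables, the Poisson variables to
Fourier analysis on the torus, and the limit `ε → 0` to the singularities of `1 / |p|²`.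

**Law of the tile counts.** The number of tilings with prescribed tile counts is multinomial
(`card_packings`, by double counting of pairs of a packing and one of its blocks). So the tile
counts are distributed as independent Poisson variables conditioned to cover each vertex as often
as its multiplicity (`sum_tilings`); in the critical gauge their means are `K w` and `K w₀`
(`expect_eq`).

**Covariances on a fixed torus.** Exchanging one set of tiles for another with the same cover maps
configurations to configurations, which gives an exact identity for products of `k_i / λ_i`
(`sum_exchange`). A pointwise Chernoff bound, together with a lower bound for the mass of one
lattice point near the mean, shows that the deviations are `O(K ^ (3/5))` in every moment
(`condExp_abs_pow_le`), so the identity may be linearized (`tendsto_condExp_linear`): the limiting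
covariances solve a linear system. The exchange used is that of a translate of `τ` and the
singletons in another translate against the other translate and the singletons in the first. The
system is invariant under translations and is diagonalized by characters: the normalized covariance
is `n⁻² ∑_{ξ ≠ 0} χ_ξ / (ε + |p(χ_ξ)|²)` (`hasTorusCov`).

**The plane.** These are Riemann sums, and tend to the Fourier coefficient `(2π)⁻² ∫ e^{i(sx+ty)} /
(ε + |p|²)` over a period square (`hasPlaneCov`). In particular the limit exists for every `ε > 0`.

**The integrals `J`.** Writing `1 / (ε + Q) = ∫_0^∞ e^{-l(ε+Q)} dl` and computing the Gaussian
Fourier integrals gives `J = π D^{-1/2} ∫_0^∞ e^{-εl - κ/(4l)} dl/l`, which is the heat kernel form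
of `K₀` (`integral_besselKernel_eq_besselK`). The improper integral converges because Gaussian
Fourier integrals over boxes are `O(l^{-1/2})` uniformly in the box, by one integration by parts
(`hasImproperIntegral_quadForm`).

**The limit `ε → 0`.** At a root simplicity makes the quadratic part `Q` of `|p|²` positive
definite, and `1 / (ε + |p|²)` differs from `e^{-(ε+Q)} / (ε + Q)` by `O(1/r)` at distance `r`,
which is integrable in the plane, uniformly in `ε`. So after subtraction of these functions at all
roots the remainder converges in `L¹` as `ε → 0` (`tendsto_integral_residual_sub`), and by the
Riemann–Lebesgue lemma its Fourier coefficients are bounded, and small for large `(s, t)` and small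
`ε` (`exists_planeCov_approx`). The subtracted functions contribute the part of `J` over `l > 1`,
whose distance from `J` is `O(1/(s²+t²))`. The error is thus small when `(s, t)` is large, where
`J` is bounded below by a constant as long as `ε (s² + t²)` is bounded; and it is bounded when
`(s, t)` ranges over a bounded set, where `J` grows like `log (1/ε)` (`planeCov_sub_sum_rootTerm_le`).
-/

set_option linter.unusedSectionVars false

noncomputable section

namespace MultinomialTiling

/-! ### Counting packings by lifts of tiles -/

section Counting

variable {V : Type} [Fintype V] [DecidableEq V] {N : V → ℕ} {I : Type} [Fintype I] [DecidableEq I]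

open Classical in
/-- The ways to cut a set `s` of vertices of the blow-up into disjoint lifts of the tiles `tile i`,
using `k i` lifts of `tile i` for each `i`. -/
def packings (tile : I → V → ℕ) (k : I → ℕ) (s : Finset (Blowup N)) :
    Finset (Finset (Finset (Blowup N))) :=
  Finset.univ.filter fun P => (P : Set (Finset (Blowup N))).PairwiseDisjoint id ∧
    P.biUnion id = s ∧ (∀ b ∈ P, ∃ i, IsLift (tile i) b) ∧
    ∀ i, (P.filter fun b => IsLift (tile i) b).card = k i

open Classical in
theorem mem_packings {tile : I → V → ℕ} {k : I → ℕ} {s : Finset (Blowup N)}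
    {P : Finset (Finset (Blowup N))} :
    P ∈ packings tile k s ↔ (P : Set (Finset (Blowup N))).PairwiseDisjoint id ∧
      P.biUnion id = s ∧ (∀ b ∈ P, ∃ i, IsLift (tile i) b) ∧
      ∀ i, (P.filter fun b => IsLift (tile i) b).card = k i := by
  simp [packings]

theorem profile_empty : profile (∅ : Finset (Blowup N)) = 0 := by
  ext v; simp [profile]

theorem profile_sdiff {s b : Finset (Blowup N)} (hb : b ⊆ s) (v : V) :
    profile (s \ b) v = profile s v - profile b v := by
  unfold profile
  rw [← Finset.card_sdiff_of_subset (Finset.filter_subset_filter _ hb)]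
  congr 1
  ext x
  simp only [Finset.mem_filter, Finset.mem_sdiff]
  tauto

open Classical in
/-- A set `s` contains `∏ v, (profile s v).choose (t v)` lifts of the tile `t`. -/
theorem card_lifts (s : Finset (Blowup N)) (t : V → ℕ) :
    (s.powerset.filter fun b => IsLift t b).card = ∏ v, (profile s v).choose (t v) := by
  have h : ∀ v, (profile s v).choose (t v)
      = ((s.filter fun x => x.1 = v).powersetCard (t v)).card := by
    intro v; rw [Finset.card_powersetCard]; rfl
  simp_rw [h]
  rw [← Fintype.card_piFinset]
  refine Finset.card_bij' (fun b _ v => b.filter fun x => x.1 = v)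
    (fun f _ => Finset.univ.biUnion f) ?_ ?_ ?_ ?_
  · intro b hb
    rw [Finset.mem_filter, Finset.mem_powerset] at hb
    rw [Fintype.mem_piFinset]
    intro v
    rw [Finset.mem_powersetCard]
    exact ⟨Finset.filter_subset_filter _ hb.1, congrFun hb.2 v⟩
  · intro f hf
    rw [Fintype.mem_piFinset] at hf
    have hf' := fun v => Finset.mem_powersetCard.1 (hf v)
    rw [Finset.mem_filter, Finset.mem_powerset]
    refine ⟨fun x hx => ?_, ?_⟩
    · obtain ⟨v, -, hv⟩ := Finset.mem_biUnion.1 hx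
      exact (Finset.mem_filter.1 ((hf' v).1 hv)).1
    · ext v
      rw [← (hf' v).2]
      unfold profile
      congr 1
      ext x
      simp only [Finset.mem_filter, Finset.mem_biUnion, Finset.mem_univ, true_and]
      constructor
      · rintro ⟨⟨w, hw⟩, rfl⟩
        have := (Finset.mem_filter.1 ((hf' w).1 hw)).2
        rwa [this]
      · intro hx
        exact ⟨⟨v, hx⟩, (Finset.mem_filter.1 ((hf' v).1 hx)).2⟩
  · intro b hb
    ext x
    simp
  · intro f hf
    rw [Fintype.mem_piFinset] at hf
    have hf' := fun v => Finset.mem_powersetCard.1 (hf v)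
    funext v
    ext x
    simp only [Finset.mem_filter, Finset.mem_biUnion, Finset.mem_univ, true_and]
    constructor
    · rintro ⟨⟨w, hw⟩, rfl⟩
      have := (Finset.mem_filter.1 ((hf' w).1 hw)).2
      rwa [this]
    · intro hx
      exact ⟨⟨v, hx⟩, (Finset.mem_filter.1 ((hf' v).1 hx)).2⟩

open Classical in
/-- The packings of `s` that use the block `b` are the packings of the complement of `b`. -/
theorem card_packings_with_block {tile : I → V → ℕ} (htile : ∀ i, tile i ≠ 0)
    (hinj : Function.Injective tile) {k : I → ℕ} {s b : Finset (Blowup N)} {i : I} (hk : 0 < k i)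
    (hbs : b ⊆ s) (hb : IsLift (tile i) b) :
    ((packings tile k s).filter fun P => b ∈ P).card
      = (packings tile (Function.update k i (k i - 1)) (s \ b)).card := by
  have hbne : b.Nonempty := by
    rw [Finset.nonempty_iff_ne_empty]
    rintro rfl
    exact htile i (hb.symm.trans profile_empty)
  have hlift : ∀ j, IsLift (tile j) b ↔ j = i := by
    intro j
    refine ⟨fun h => hinj (h.symm.trans hb), ?_⟩
    rintro rfl; exact hb
  refine Finset.card_bij' (fun P _ => P.erase b) (fun P _ => insert b P) ?_ ?_ ?_ ?_
  · intro P hP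
    rw [Finset.mem_filter, mem_packings] at hP
    obtain ⟨⟨h1, h2, h3, h4⟩, hbP⟩ := hP
    rw [mem_packings]
    refine ⟨h1.subset (by simp), ?_, fun c hc => h3 c (Finset.mem_of_mem_erase hc), ?_⟩
    · ext x
      simp only [Finset.mem_biUnion, Finset.mem_erase, id, Finset.mem_sdiff, ← h2]
      constructor
      · rintro ⟨c, ⟨hcb, hcP⟩, hxc⟩
        exact ⟨⟨c, hcP, hxc⟩, fun hxb => Finset.disjoint_left.1 (h1 hcP hbP hcb) hxc hxb⟩
      · rintro ⟨⟨c, hcP, hxc⟩, hxb⟩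
        exact ⟨c, ⟨fun h => hxb (h ▸ hxc), hcP⟩, hxc⟩
    · intro j
      rw [Finset.filter_erase]
      by_cases hj : j = i
      · subst hj
        rw [Finset.card_erase_of_mem (by simp [hbP, hb]), h4]; simp
      · rw [Finset.erase_eq_of_notMem (by simp [hlift, hj]), h4]; simp [hj]
  · intro P hP
    rw [mem_packings] at hP
    obtain ⟨h1, h2, h3, h4⟩ := hP
    have hdis : ∀ c ∈ P, Disjoint b c := by
      intro c hc
      have : c ⊆ s \ b := by rw [← h2]; exact Finset.subset_biUnion_of_mem id hc
      exact (Finset.disjoint_sdiff).mono_right this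
    have hbP : b ∉ P := fun h => by
      have := hdis b h
      rw [disjoint_self] at this
      exact hbne.ne_empty this
    rw [Finset.mem_filter, mem_packings]
    refine ⟨⟨?_, ?_, ?_, ?_⟩, Finset.mem_insert_self _ _⟩
    · rw [Finset.coe_insert]
      exact h1.insert fun c hc _ => hdis c hc
    · rw [Finset.biUnion_insert, h2]
      exact Finset.union_sdiff_of_subset hbs
    · intro c hc
      rcases Finset.mem_insert.1 hc with rfl | hc
      · exact ⟨i, hb⟩
      · exact h3 c hc
    · intro j
      rw [Finset.filter_insert]
      by_cases hj : j = i
      · subst hj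
        rw [if_pos hb, Finset.card_insert_of_notMem (by simp [hbP]), h4]
        simp; omega
      · rw [if_neg (by simp [hlift, hj]), h4]; simp [hj]
  · intro P hP
    exact Finset.insert_erase (Finset.mem_filter.1 hP).2
  · intro P hP
    rw [mem_packings] at hP
    obtain ⟨h1, h2, h3, h4⟩ := hP
    refine Finset.erase_insert fun h => ?_
    have : b ⊆ s \ b := by
      conv_rhs => rw [← h2]
      exact Finset.subset_biUnion_of_mem id h
    obtain ⟨x, hx⟩ := hbne
    exact (Finset.mem_sdiff.1 (this hx)).2 hx

open Classical in
/-- Multinomial count of the packings with prescribed numbers of tiles. -/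
theorem card_packings {tile : I → V → ℕ} (htile : ∀ i, tile i ≠ 0)
    (hinj : Function.Injective tile) (k : I → ℕ) (s : Finset (Blowup N))
    (hs : ∀ v, profile s v = ∑ i, k i * tile i v) :
    (packings tile k s).card * ∏ i, ((k i).factorial * (∏ v, (tile i v).factorial) ^ k i)
      = ∏ v, (profile s v).factorial := by
  induction hn : ∑ i, k i generalizing k s with
  | zero =>
    have hk : ∀ i, k i = 0 := by simpa using hn
    have hs0 : s = ∅ := by
      by_contra hne
      obtain ⟨x, hx⟩ := Finset.nonempty_iff_ne_empty.2 hne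
      have h0 : profile s x.1 = 0 := by simp [hs, hk]
      unfold profile at h0
      rw [Finset.card_eq_zero] at h0
      have : x ∈ s.filter fun y => y.1 = x.1 := by simp [hx]
      simp [h0] at this
    subst hs0
    have : packings tile k (∅ : Finset (Blowup N)) = {∅} := by
      ext P
      rw [mem_packings, Finset.mem_singleton]
      constructor
      · rintro ⟨-, h2, h3, -⟩
        by_contra hne
        obtain ⟨b, hb⟩ := Finset.nonempty_iff_ne_empty.2 hne
        obtain ⟨i, hi⟩ := h3 b hb
        have hb0 : b = ∅ := by
          rw [← Finset.subset_empty, ← h2]; exact Finset.subset_biUnion_of_mem id hb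
        subst hb0
        exact htile i (hi.symm.trans profile_empty)
      · rintro rfl
        simp [hk]
    simp [this, hk, profile_empty]
  | succ n ih =>
    obtain ⟨i, hi⟩ : ∃ i, 0 < k i := by
      by_contra h
      push Not at h
      simp [fun i => Nat.le_zero.1 (h i)] at hn
    set k' := Function.update k i (k i - 1) with hk'
    have hkk : ∀ j, k j = k' j + if j = i then 1 else 0 := by
      intro j
      by_cases hj : j = i
      · subst hj; simp [hk']; omega
      · simp [hk', hj]
    have hsum : ∑ j, k' j = n := by
      have : ∑ j, k j = ∑ j, k' j + 1 := by
        simp_rw [hkk, Finset.sum_add_distrib]; simp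
      omega
    have hprof : ∀ v, profile s v = ∑ j, k' j * tile j v + tile i v := by
      intro v
      rw [hs]
      simp_rw [hkk, add_mul, Finset.sum_add_distrib]
      simp
    have hdc := Finset.sum_card_bipartiteAbove_eq_sum_card_bipartiteBelow
      (s := packings tile k s) (t := s.powerset.filter fun b => IsLift (tile i) b)
      (r := fun P b => b ∈ P)
    have hleft : ∀ P ∈ packings tile k s,
        (Finset.bipartiteAbove (fun (P : Finset (Finset (Blowup N))) b => b ∈ P)
          (s.powerset.filter fun b => IsLift (tile i) b) P).card = k i := by
      intro P hP
      rw [mem_packings] at hP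
      rw [← hP.2.2.2 i]
      congr 1
      ext b
      simp only [Finset.mem_bipartiteAbove, Finset.mem_filter, Finset.mem_powerset]
      constructor
      · rintro ⟨⟨-, h⟩, h'⟩; exact ⟨h', h⟩
      · rintro ⟨h, h'⟩
        refine ⟨⟨?_, h'⟩, h⟩
        rw [← hP.2.1]; exact Finset.subset_biUnion_of_mem id h
    rw [Finset.sum_congr rfl hleft, Finset.sum_const, smul_eq_mul] at hdc
    set W := ∏ j, ((k' j).factorial * (∏ v, (tile j v).factorial) ^ k' j) with hW
    have hright : ∀ b ∈ s.powerset.filter fun b => IsLift (tile i) b,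
        (Finset.bipartiteBelow (fun (P : Finset (Finset (Blowup N))) b => b ∈ P)
          (packings tile k s) b).card * W = ∏ v, (profile s v - tile i v).factorial := by
      intro b hb
      rw [Finset.mem_filter, Finset.mem_powerset] at hb
      have h1 := card_packings_with_block htile hinj hi hb.1 hb.2
      have hpb : ∀ v, profile (s \ b) v = profile s v - tile i v := by
        intro v; rw [profile_sdiff hb.1, hb.2]
      have h2 := ih k' (s \ b) (by intro v; rw [hpb, hprof]; simp) hsum
      unfold Finset.bipartiteBelow
      rw [h1, h2]
      simp_rw [hpb]
    have hmul : (packings tile k s).card * k i * W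
        = (∏ v, (profile s v).choose (tile i v)) * ∏ v, (profile s v - tile i v).factorial := by
      rw [hdc, Finset.sum_mul, Finset.sum_congr rfl hright, Finset.sum_const, smul_eq_mul,
        card_lifts]
    have hprod : ∏ j, ((k j).factorial * (∏ v, (tile j v).factorial) ^ k j)
        = k i * (∏ v, (tile i v).factorial) * W := by
      have hfac : ∀ j, (k j).factorial * (∏ v, (tile j v).factorial) ^ k j
          = (if j = i then k i * (∏ v, (tile i v).factorial) else 1) *
            ((k' j).factorial * (∏ v, (tile j v).factorial) ^ k' j) := by
        intro j
        by_cases hj : j = i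
        · subst hj
          rw [if_pos rfl]
          have : k j = k' j + 1 := by simpa using hkk j
          rw [this, Nat.factorial_succ, pow_succ]; ring
        · have : k j = k' j := by simpa [hj] using hkk j
          rw [if_neg hj, one_mul, this]
      rw [Finset.prod_congr rfl fun j _ => hfac j, Finset.prod_mul_distrib]
      simp [hW]
    rw [hprod]
    calc _ = ((packings tile k s).card * k i * W) * ∏ v, (tile i v).factorial := by ring
      _ = ∏ v, ((profile s v).choose (tile i v) * (tile i v).factorial *
            (profile s v - tile i v).factorial) := by
          rw [hmul, Finset.prod_mul_distrib, Finset.prod_mul_distrib]; ring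
      _ = _ := by
          refine Finset.prod_congr rfl fun v _ => Nat.choose_mul_factorial_mul_factorial ?_
          rw [hprof]; omega

end Counting

/-! ### The law of the tile counts -/

section Law

variable {V : Type} [Fintype V] [DecidableEq V] {N : V → ℕ} {I : Type} [Fintype I] [DecidableEq I]

open Classical in
theorem profile_of_mem_packings {tile : I → V → ℕ} (hinj : Function.Injective tile) {k : I → ℕ}
    {s : Finset (Blowup N)} {P : Finset (Finset (Blowup N))} (hP : P ∈ packings tile k s) (v : V) :
    profile s v = ∑ i, k i * tile i v := by
  rw [mem_packings] at hP
  obtain ⟨h1, h2, h3, h4⟩ := hP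
  have e1 : profile s v = ∑ b ∈ P, profile b v := by
    unfold profile
    rw [← h2, Finset.filter_biUnion, Finset.card_biUnion]
    · rfl
    · intro a ha b hb hab
      exact (h1 ha hb hab).mono (Finset.filter_subset _ _) (Finset.filter_subset _ _)
  have e2 : ∀ b ∈ P, profile b v = ∑ i, if IsLift (tile i) b then tile i v else 0 := by
    intro b hb
    obtain ⟨i, hi⟩ := h3 b hb
    rw [Finset.sum_eq_single i, if_pos hi, hi]
    · intro j _ hj
      rw [if_neg]
      intro h
      exact hj (hinj (h.symm.trans hi))
    · simp
  rw [e1, Finset.sum_congr rfl e2, Finset.sum_comm]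
  refine Finset.sum_congr rfl fun i _ => ?_
  rw [← Finset.sum_filter, Finset.sum_const, h4, smul_eq_mul]

theorem profile_univ (v : V) : profile (Finset.univ : Finset (Blowup N)) v = N v := by
  unfold profile
  have : (Finset.univ : Finset (Blowup N)).filter (fun x => x.1 = v)
      = (Finset.univ : Finset (Fin (N v))).map ⟨fun j => (⟨v, j⟩ : Blowup N), fun a b h => by
        simpa using h⟩ := by
    ext ⟨w, j⟩
    simp only [Finset.mem_filter, Finset.mem_univ, true_and, Finset.mem_map]
    constructor
    · rintro rfl; exact ⟨j, rfl⟩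
    · rintro ⟨j', h⟩; exact (congrArg Sigma.fst h).symm
  rw [this, Finset.card_map, Finset.card_univ, Fintype.card_fin]

open Classical in
theorem parts_mem_packings_iff {tile : I → V → ℕ} {k : I → ℕ} (m : Partitions N) :
    m.parts ∈ packings tile k Finset.univ ↔
      m ∈ tilings (Finset.univ.image tile) N ∧ ∀ i, tileCount (tile i) m = k i := by
  rw [mem_packings]
  unfold tilings tileCount
  simp only [Finset.mem_filter, Finset.mem_univ, true_and, Finset.mem_image,
    exists_exists_eq_and]
  constructor
  · rintro ⟨-, -, h3, h4⟩; exact ⟨h3, h4⟩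
  · rintro ⟨h3, h4⟩; exact ⟨m.disjoint, m.biUnion_parts, h3, h4⟩

open Classical in
/-- A tiling is determined by its set of blocks. -/
theorem card_tilings_counts {tile : I → V → ℕ} (htile : ∀ i, tile i ≠ 0) (k : I → ℕ) :
    ((tilings (Finset.univ.image tile) N).filter fun m => (fun i => tileCount (tile i) m) = k).card
      = (packings tile k (Finset.univ : Finset (Blowup N))).card := by
  refine Finset.card_bij (fun m _ => m.parts) ?_ ?_ ?_
  · intro m hm
    rw [Finset.mem_filter] at hm
    rw [parts_mem_packings_iff]
    exact ⟨hm.1, fun i => congrFun hm.2 i⟩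
  · intro m _ m' _ h
    exact Finpartition.ext h
  · intro P hP
    have hP' := mem_packings.1 hP
    have hbot : ∅ ∉ P := fun h => by
      obtain ⟨i, hi⟩ := hP'.2.2.1 ∅ h
      exact htile i (hi.symm.trans profile_empty)
    let m : Partitions N :=
      { parts := P
        supIndep := Finset.supIndep_iff_pairwiseDisjoint.2 hP'.1
        sup_parts := by rw [Finset.sup_eq_biUnion, hP'.2.1]
        bot_notMem := hbot }
    refine ⟨m, ?_, rfl⟩
    have := (parts_mem_packings_iff (tile := tile) (k := k) m).1 hP
    rw [Finset.mem_filter]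
    exact ⟨this.1, funext this.2⟩

/-- The law of the tile counts is that of independent Poisson variables with means
`w t / ∏ v, (t v)!`, conditioned on covering each vertex `v` exactly `N v` times. -/
theorem sum_tilings {tile : I → V → ℕ} (htile : ∀ i, tile i ≠ 0)
    (hinj : Function.Injective tile) (w : (V → ℕ) → ℝ) (Ω : Finset (I → ℕ))
    (hΩ : ∀ k, k ∈ Ω ↔ ∀ v, ∑ i, k i * tile i v = N v) (F : (I → ℕ) → ℝ) :
    ∑ m ∈ tilings (Finset.univ.image tile) N,
        weight (Finset.univ.image tile) w m * F (fun i => tileCount (tile i) m)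
      = (∏ v, ((N v).factorial : ℝ)) * ∑ k ∈ Ω,
        (∏ i, (w (tile i) / ∏ v, ((tile i v).factorial : ℝ)) ^ k i / (k i).factorial) * F k := by
  classical
  have hmaps : ∀ m ∈ tilings (Finset.univ.image tile) N,
      (fun i => tileCount (tile i) m) ∈ Ω := by
    intro m hm
    have := (parts_mem_packings_iff (tile := tile) m).2 ⟨hm, fun i => rfl⟩
    rw [hΩ]
    intro v
    rw [← profile_of_mem_packings hinj this, profile_univ]
  rw [← Finset.sum_fiberwise_of_maps_to hmaps, Finset.mul_sum]
  refine Finset.sum_congr rfl fun k hk => ?_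
  have hterm : ∀ m ∈ (tilings (Finset.univ.image tile) N).filter
      (fun m => (fun i => tileCount (tile i) m) = k),
      weight (Finset.univ.image tile) w m * F (fun i => tileCount (tile i) m)
        = (∏ i, w (tile i) ^ k i) * F k := by
    intro m hm
    have hm' := (Finset.mem_filter.1 hm).2
    unfold weight
    rw [Finset.prod_image fun a _ b _ h => hinj h, hm']
    congr 1
    exact Finset.prod_congr rfl fun i _ => by rw [← congrFun hm' i]
  rw [Finset.sum_congr rfl hterm, Finset.sum_const, card_tilings_counts htile, nsmul_eq_mul]
  have hc := card_packings (N := N) htile hinj k Finset.univ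
    (fun v => by rw [profile_univ, ((hΩ k).1 hk v)])
  have hc' := congrArg (Nat.cast (R := ℝ)) hc
  push_cast at hc'
  simp_rw [profile_univ] at hc'
  rw [← hc', Finset.prod_mul_distrib]
  simp_rw [div_pow, Finset.prod_div_distrib]
  have h1 : ∏ i, ((k i).factorial : ℝ) ≠ 0 :=
    Finset.prod_ne_zero_iff.2 fun i _ => by positivity
  have h2 : ∏ i, (∏ v, ((tile i v).factorial : ℝ)) ^ k i ≠ 0 :=
    Finset.prod_ne_zero_iff.2 fun i _ => by positivity
  field_simp

end Law

/-! ### Poisson variables conditioned on a finite set of configurations -/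

section ConditionedPoisson

variable {I : Type} [Fintype I] [DecidableEq I]

/-- The unnormalized mass at `k` of independent Poisson variables with means `l`. -/
def poissonMass (l : I → ℝ) (k : I → ℕ) : ℝ := ∏ i, l i ^ k i / (k i).factorial

/-- Expectation for independent Poisson variables with means `l`, conditioned to lie in the finite
set `Ω`. -/
def condExp (l : I → ℝ) (Ω : Finset (I → ℕ)) (f : (I → ℕ) → ℝ) : ℝ :=
  (∑ k ∈ Ω, poissonMass l k * f k) / ∑ k ∈ Ω, poissonMass l k

theorem poissonMass_pos {l : I → ℝ} (hl : ∀ i, 0 < l i) (k : I → ℕ) : 0 < poissonMass l k :=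
  Finset.prod_pos fun i _ => div_pos (pow_pos (hl i) _) (by positivity)

theorem sum_poissonMass_pos {l : I → ℝ} (hl : ∀ i, 0 < l i) {Ω : Finset (I → ℕ)}
    (hΩ : Ω.Nonempty) : 0 < ∑ k ∈ Ω, poissonMass l k :=
  Finset.sum_pos (fun k _ => poissonMass_pos hl k) hΩ

theorem condExp_congr {l : I → ℝ} {Ω : Finset (I → ℕ)} {f g : (I → ℕ) → ℝ}
    (h : ∀ k ∈ Ω, f k = g k) : condExp l Ω f = condExp l Ω g := by
  unfold condExp
  rw [Finset.sum_congr rfl fun k hk => by rw [h k hk]]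

theorem condExp_add (l : I → ℝ) (Ω : Finset (I → ℕ)) (f g : (I → ℕ) → ℝ) :
    condExp l Ω (fun k => f k + g k) = condExp l Ω f + condExp l Ω g := by
  unfold condExp
  rw [← add_div, ← Finset.sum_add_distrib]
  simp_rw [mul_add]

theorem condExp_const_mul (l : I → ℝ) (Ω : Finset (I → ℕ)) (c : ℝ) (f : (I → ℕ) → ℝ) :
    condExp l Ω (fun k => c * f k) = c * condExp l Ω f := by
  unfold condExp
  rw [← mul_div_assoc, Finset.mul_sum]
  congr 1
  exact Finset.sum_congr rfl fun k _ => by ring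

theorem condExp_sub (l : I → ℝ) (Ω : Finset (I → ℕ)) (f g : (I → ℕ) → ℝ) :
    condExp l Ω (fun k => f k - g k) = condExp l Ω f - condExp l Ω g := by
  unfold condExp
  rw [← sub_div, ← Finset.sum_sub_distrib]
  simp_rw [mul_sub]

theorem condExp_sum (l : I → ℝ) (Ω : Finset (I → ℕ)) {ι : Type} (s : Finset ι)
    (f : ι → (I → ℕ) → ℝ) :
    condExp l Ω (fun k => ∑ i ∈ s, f i k) = ∑ i ∈ s, condExp l Ω (f i) := by
  unfold condExp
  rw [← Finset.sum_div, Finset.sum_comm]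
  simp_rw [Finset.mul_sum]

theorem condExp_const {l : I → ℝ} (hl : ∀ i, 0 < l i) {Ω : Finset (I → ℕ)} (hΩ : Ω.Nonempty)
    (c : ℝ) : condExp l Ω (fun _ => c) = c := by
  unfold condExp
  rw [← Finset.sum_mul]
  field_simp [(sum_poissonMass_pos hl hΩ).ne']

theorem abs_condExp_le {l : I → ℝ} (hl : ∀ i, 0 < l i) {Ω : Finset (I → ℕ)}
    {f g : (I → ℕ) → ℝ} (h : ∀ k ∈ Ω, |f k| ≤ g k) : |condExp l Ω f| ≤ condExp l Ω g := by
  unfold condExp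
  have hZ : 0 ≤ ∑ k ∈ Ω, poissonMass l k :=
    Finset.sum_nonneg fun k _ => (poissonMass_pos hl k).le
  rw [abs_div, abs_of_nonneg hZ]
  gcongr
  refine (Finset.abs_sum_le_sum_abs _ _).trans (Finset.sum_le_sum fun k hk => ?_)
  rw [abs_mul, abs_of_pos (poissonMass_pos hl k)]
  exact mul_le_mul_of_nonneg_left (h k hk) (poissonMass_pos hl k).le

/-! ### Exchange identity -/

/-- The indicator of a finset as a configuration. -/
def ind (D : Finset I) : I → ℕ := fun i => if i ∈ D then 1 else 0

theorem poissonMass_add_ind {l : I → ℝ} (hl : ∀ i, 0 < l i) (D : Finset I) (m : I → ℕ) :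
    poissonMass l (m + ind D) * ∏ i ∈ D, (((m + ind D) i : ℕ) : ℝ) / l i = poissonMass l m := by
  unfold poissonMass
  have : ∏ i ∈ D, (((m + ind D) i : ℕ) : ℝ) / l i
      = ∏ i, if i ∈ D then (((m + ind D) i : ℕ) : ℝ) / l i else 1 := by
    rw [Finset.prod_ite_mem, Finset.univ_inter]
  rw [this, ← Finset.prod_mul_distrib]
  refine Finset.prod_congr rfl fun i _ => ?_
  have h0 := (hl i).ne'
  by_cases hi : i ∈ D
  · have : (m + ind D) i = m i + 1 := by simp [ind, hi]
    rw [this, if_pos hi, Nat.factorial_succ, pow_succ]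
    have : ((m i).factorial : ℝ) ≠ 0 := by positivity
    push_cast
    have : (m i : ℝ) + 1 ≠ 0 := by positivity
    field_simp
  · have : (m + ind D) i = m i := by simp [ind, hi]
    rw [this, if_neg hi, mul_one]

/-- Exchange identity: if adding `D` and adding `U` lead to `Ω` from the same configurations, then
trading `D` for `U` preserves the conditioned Poisson law, up to the weights `∏ k i / l i`. -/
theorem sum_exchange {l : I → ℝ} (hl : ∀ i, 0 < l i) {Ω : Finset (I → ℕ)} {D U : Finset I}
    (hDU : ∀ m, m + ind D ∈ Ω ↔ m + ind U ∈ Ω) {f g : (I → ℕ) → ℝ}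
    (hfg : ∀ m, f (m + ind D) = g (m + ind U)) :
    ∑ k ∈ Ω, poissonMass l k * ((∏ i ∈ D, (k i : ℝ) / l i) * f k)
      = ∑ k ∈ Ω, poissonMass l k * ((∏ i ∈ U, (k i : ℝ) / l i) * g k) := by
  classical
  -- configurations without all of `E` contribute nothing, since a factor `k i` vanishes
  have restrict : ∀ (E : Finset I) (h : (I → ℕ) → ℝ),
      ∑ k ∈ Ω, poissonMass l k * ((∏ i ∈ E, (k i : ℝ) / l i) * h k)
        = ∑ k ∈ Ω.filter (fun k => ind E ≤ k),
          poissonMass l k * ((∏ i ∈ E, (k i : ℝ) / l i) * h k) := by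
    intro E h
    rw [Finset.sum_filter]
    refine Finset.sum_congr rfl fun k _ => ?_
    split_ifs with hk
    · rfl
    · rw [Pi.le_def] at hk
      push Not at hk
      obtain ⟨i, hi⟩ := hk
      have hiE : i ∈ E := by
        by_contra hiE
        simp [ind, hiE] at hi
      have hki : k i = 0 := by
        simp [ind, hiE] at hi; exact hi
      rw [Finset.prod_eq_zero hiE (by simp [hki])]
      simp
  rw [restrict D f, restrict U g]
  refine Finset.sum_bij' (fun k _ => k - ind D + ind U) (fun k _ => k - ind U + ind D) ?_ ?_ ?_ ?_ ?_
  · intro k hk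
    rw [Finset.mem_filter] at hk ⊢
    refine ⟨(hDU _).1 ?_, le_add_self⟩
    rw [tsub_add_cancel_of_le hk.2]; exact hk.1
  · intro k hk
    rw [Finset.mem_filter] at hk ⊢
    refine ⟨(hDU _).2 ?_, le_add_self⟩
    rw [tsub_add_cancel_of_le hk.2]; exact hk.1
  · intro k hk
    rw [Finset.mem_filter] at hk
    rw [add_tsub_cancel_right, tsub_add_cancel_of_le hk.2]
  · intro k hk
    rw [Finset.mem_filter] at hk
    rw [add_tsub_cancel_right, tsub_add_cancel_of_le hk.2]
  · intro k hk
    rw [Finset.mem_filter] at hk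
    obtain ⟨m, rfl⟩ : ∃ m, k = m + ind D := ⟨k - ind D, (tsub_add_cancel_of_le hk.2).symm⟩
    rw [add_tsub_cancel_right, ← mul_assoc, ← mul_assoc, poissonMass_add_ind hl,
      poissonMass_add_ind hl, hfg]

/-! ### Linearization of products -/

/-- First and second order expansion of a product of factors near `1`, with one constant for all
bounded arguments. -/
theorem exists_prod_one_add_bound (D : Finset I) (M : ℝ) (hM : 0 ≤ M) :
    ∃ C : ℝ, 0 ≤ C ∧ ∀ z : I → ℝ, (∀ i, |z i| ≤ M) →
      |∏ i ∈ D, (1 + z i) - 1| ≤ C * ∑ i ∈ D, |z i| ∧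
      |∏ i ∈ D, (1 + z i) - 1 - ∑ i ∈ D, z i| ≤ C * ∑ i ∈ D, z i ^ 2 := by
  induction D using Finset.induction_on with
  | empty => exact ⟨0, le_rfl, fun z _ => by simp⟩
  | insert a D ha ih =>
    obtain ⟨C, hC, h⟩ := ih
    refine ⟨1 + (1 + M) * C + C * (D.card + 1), by positivity, fun z hz => ?_⟩
    obtain ⟨h1, h2⟩ := h z hz
    rw [Finset.prod_insert ha, Finset.sum_insert ha, Finset.sum_insert ha, Finset.sum_insert ha]
    set P := ∏ i ∈ D, (1 + z i)
    set S1 := ∑ i ∈ D, |z i|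
    set S2 := ∑ i ∈ D, z i ^ 2
    have hS1 : 0 ≤ S1 := Finset.sum_nonneg fun i _ => abs_nonneg _
    have hS2 : 0 ≤ S2 := Finset.sum_nonneg fun i _ => sq_nonneg _
    have hcross : |z a| * S1 ≤ D.card * z a ^ 2 + S2 := by
      rw [Finset.mul_sum]
      calc ∑ i ∈ D, |z a| * |z i| ≤ ∑ i ∈ D, (z a ^ 2 + z i ^ 2) := by
            refine Finset.sum_le_sum fun i _ => ?_
            rw [← sq_abs (z a), ← sq_abs (z i)]
            nlinarith [sq_nonneg (|z a| - |z i|), sq_nonneg (|z a|), sq_nonneg (|z i|)]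
        _ = _ := by rw [Finset.sum_add_distrib, Finset.sum_const, nsmul_eq_mul]
    have hzP : |z a * (P - 1)| ≤ |z a| * (C * S1) := by
      rw [abs_mul]; exact mul_le_mul_of_nonneg_left h1 (abs_nonneg _)
    have hd : (0 : ℝ) ≤ D.card := Nat.cast_nonneg _
    constructor
    · have e : (1 + z a) * P - 1 = (P - 1) + z a + z a * (P - 1) := by ring
      rw [e]
      have hza : |z a| * (C * S1) ≤ M * (C * S1) :=
        mul_le_mul_of_nonneg_right (hz a) (by positivity)
      calc |(P - 1) + z a + z a * (P - 1)| ≤ |P - 1| + |z a| + |z a * (P - 1)| := by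
            refine (abs_add_le _ _).trans ?_
            gcongr
            exact abs_add_le _ _
        _ ≤ C * S1 + |z a| + M * (C * S1) := by linarith
        _ ≤ (1 + (1 + M) * C + C * (D.card + 1)) * (|z a| + S1) := by
            have := abs_nonneg (z a)
            have e1 : 0 ≤ ((1 + M) * C + C * (D.card + 1)) * |z a| := by positivity
            have e2 : 0 ≤ (1 + C * (D.card + 1)) * S1 := by positivity
            nlinarith
    · have e : (1 + z a) * P - 1 - (z a + ∑ i ∈ D, z i)
          = (P - 1 - ∑ i ∈ D, z i) + z a * (P - 1) := by ring
      rw [e]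
      calc _ ≤ |P - 1 - ∑ i ∈ D, z i| + |z a * (P - 1)| := abs_add_le _ _
        _ ≤ C * S2 + C * (D.card * z a ^ 2 + S2) := by
            have : |z a| * (C * S1) = C * (|z a| * S1) := by ring
            have := mul_le_mul_of_nonneg_left hcross hC
            linarith
        _ ≤ (1 + (1 + M) * C + C * (D.card + 1)) * (z a ^ 2 + S2) := by
            have e0 := sq_nonneg (z a)
            have e1 : 0 ≤ (1 + (1 + M) * C + C) * z a ^ 2 := by positivity
            have e2 : 0 ≤ (1 + M * C + C * D.card) * S2 := by positivity
            nlinarith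

/-! ### Concentration -/

/-- Chernoff bound at the scale `√K`. -/
theorem poisson_upper {l K : ℝ} (hl : 0 < l) (hK : 1 ≤ K) (hlK : l ≤ K) (k : ℕ) :
    Real.exp (-l) * (l ^ k / k.factorial) ≤ Real.exp 1 * Real.exp (-(|(k : ℝ) - l| / √K)) := by
  have hsK : 1 ≤ √K := by rw [Real.one_le_sqrt]; exact hK
  have hs0 : 0 < √K := by linarith
  have key : ∀ s : ℝ, |s| = 1 / √K →
      Real.exp (-l) * (l ^ k / k.factorial) ≤ Real.exp (1 - s * (k - l)) := by
    intro s hs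
    have hs1 : |s| ≤ 1 := by
      rw [hs, div_le_one hs0]; exact hsK
    have h1 := Real.abs_exp_sub_one_sub_id_le hs1
    have h2 : s ^ 2 = 1 / K := by
      rw [← sq_abs, hs, div_pow, Real.sq_sqrt (by linarith)]; simp
    have h3 : l * (Real.exp s - 1 - s) ≤ 1 := by
      calc l * (Real.exp s - 1 - s) ≤ l * (1 / K) := by
            gcongr; rw [← h2]; exact (le_abs_self _).trans h1
        _ ≤ 1 := by
            rw [mul_one_div, div_le_one (by linarith)]; exact hlK
    have h4 := Real.pow_div_factorial_le_exp (l * Real.exp s) (by positivity) k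
    have h5 : l ^ k / k.factorial
        = Real.exp (-(s * k)) * ((l * Real.exp s) ^ k / k.factorial) := by
      rw [mul_pow, ← Real.exp_nat_mul, mul_comm (k : ℝ) s, Real.exp_neg]
      have := (Real.exp_pos (s * k)).ne'
      field_simp
    rw [h5]
    calc _ ≤ Real.exp (-l) * (Real.exp (-(s * k)) * Real.exp (l * Real.exp s)) := by gcongr
      _ = Real.exp (-l + (-(s * k) + l * Real.exp s)) := by rw [Real.exp_add, Real.exp_add]
      _ ≤ _ := Real.exp_le_exp.2 (by nlinarith)
  rw [← Real.exp_add]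
  rcases le_total 0 ((k : ℝ) - l) with h | h
  · have := key (1 / √K) (abs_of_pos (by positivity))
    rw [abs_of_nonneg h]
    convert this using 2
    ring
  · have := key (-(1 / √K)) (by rw [abs_neg]; exact abs_of_pos (by positivity))
    rw [abs_of_nonpos h]
    convert this using 2
    ring

theorem factorial_le_exp {k : ℕ} (hk : 1 ≤ k) :
    (k.factorial : ℝ) ≤ Real.exp (1 + Real.log k + k * Real.log k - k) := by
  induction k, hk using Nat.le_induction with
  | base => simp
  | succ k hk ih =>
    have hk0 : (0 : ℝ) < k := by exact_mod_cast hk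
    have hk1 : (0 : ℝ) < (k : ℝ) + 1 := by positivity
    rw [Nat.factorial_succ]
    push_cast
    have h1 := Real.one_sub_inv_le_log_of_pos (x := ((k : ℝ) + 1) / k) (by positivity)
    rw [Real.log_div hk1.ne' hk0.ne'] at h1
    have h2 : 1 - (((k : ℝ) + 1) / k)⁻¹ = 1 / (k + 1) := by field_simp; ring
    rw [h2, div_le_iff₀ hk1] at h1
    calc ((k : ℝ) + 1) * k.factorial
        ≤ Real.exp (Real.log (k + 1)) * Real.exp (1 + Real.log k + k * Real.log k - k) := by
          rw [Real.exp_log hk1]; gcongr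
      _ = Real.exp (Real.log (k + 1) + (1 + Real.log k + k * Real.log k - k)) := by
          rw [Real.exp_add]
      _ ≤ _ := Real.exp_le_exp.2 (by nlinarith)

/-- Near its mean, a Poisson variable has mass at least of the order of the inverse mean. -/
theorem poisson_lower {l K B : ℝ} (hl : 0 < l) {k : ℕ} (hk : 1 ≤ k)
    (hkK : (k : ℝ) ≤ K) (hB : |(k : ℝ) - l| ≤ B) (hBl : B ^ 2 ≤ l) :
    (Real.exp 2 * K)⁻¹ ≤ Real.exp (-l) * (l ^ k / k.factorial) := by
  have hk0 : (0 : ℝ) < k := by exact_mod_cast hk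
  have h1 := factorial_le_exp hk
  have h2 : Real.log k - Real.log l ≤ k / l - 1 := by
    rw [← Real.log_div hk0.ne' hl.ne']
    exact Real.log_le_sub_one_of_pos (by positivity)
  have h3 : ((k : ℝ) - l) ^ 2 ≤ l := by
    refine le_trans ?_ hBl
    rw [← sq_abs]
    gcongr
  have h4 : l - k + k * (Real.log k - Real.log l) ≤ 1 := by
    calc l - k + k * (Real.log k - Real.log l) ≤ l - k + k * (k / l - 1) := by gcongr
      _ = ((k : ℝ) - l) ^ 2 / l := by field_simp; ring
      _ ≤ 1 := by rw [div_le_one hl]; exact h3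
  calc (Real.exp 2 * K)⁻¹ ≤ (Real.exp 2 * k)⁻¹ := by gcongr
    _ = Real.exp (-(2 + Real.log k)) := by rw [Real.exp_neg, Real.exp_add, Real.exp_log hk0]
    _ ≤ Real.exp (-l + (k * Real.log l - (1 + Real.log k + k * Real.log k - k))) :=
        Real.exp_le_exp.2 (by nlinarith)
    _ = Real.exp (-l) * (l ^ k / Real.exp (1 + Real.log k + k * Real.log k - k)) := by
        rw [Real.exp_add, Real.exp_sub, Real.exp_nat_mul, Real.exp_log hl]
    _ ≤ _ := by gcongr

/-- The contribution of large deviations to the moment bound `condExp_abs_pow_le`. -/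
def momentTail (d p : ℕ) (K : ℝ) : ℝ :=
  Real.exp (1 + 2 * d) * (2 * K) ^ (2 * d + p) * Real.exp (-(K ^ (1 / 10 : ℝ)))

theorem tendsto_momentTail (d p : ℕ) : Tendsto (momentTail d p) atTop (𝓝 0) := by
  have h := (Real.tendsto_pow_mul_exp_neg_atTop_nhds_zero (10 * (2 * d + p))).comp
    (tendsto_rpow_atTop (show (0 : ℝ) < 1 / 10 by norm_num))
  have h2 := h.const_mul (Real.exp (1 + 2 * d) * 2 ^ (2 * d + p))
  rw [mul_zero] at h2
  refine h2.congr' ?_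
  filter_upwards [eventually_ge_atTop 0] with K hK
  simp only [Function.comp, momentTail]
  have : (K ^ (1 / 10 : ℝ)) ^ (10 * (2 * d + p)) = K ^ (2 * d + p) := by
    rw [pow_mul, ← Real.rpow_natCast (K ^ (1 / 10 : ℝ)) 10, ← Real.rpow_mul hK]
    norm_num
  rw [this, mul_pow]
  ring

/-- Conditioning costs at most a power of `K`, so that fluctuations beyond `K ^ (3/5)` remain
negligible. -/
theorem condExp_abs_pow_le {l : I → ℝ} {Ω : Finset (I → ℕ)} {K : ℕ} {B : ℝ} (hl : ∀ i, 0 < l i)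
    (hK : 1 ≤ K) (hlK : ∀ i, l i ≤ K) (hΩK : ∀ k ∈ Ω, ∀ i, k i ≤ K) {k₀ : I → ℕ} (hk₀ : k₀ ∈ Ω)
    (hk₀1 : ∀ i, 1 ≤ k₀ i) (hB : ∀ i, |(k₀ i : ℝ) - l i| ≤ B) (hBl : ∀ i, B ^ 2 ≤ l i) (p : ℕ)
    (j : I) :
    condExp l Ω (fun k => |(k j : ℝ) - l j| ^ p)
      ≤ ((K : ℝ) ^ (3 / 5 : ℝ)) ^ p + momentTail (Fintype.card I) p K := by
  set d := Fintype.card I with hd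
  set r := (K : ℝ) ^ (3 / 5 : ℝ) with hr
  have hK1 : (1 : ℝ) ≤ K := by exact_mod_cast hK
  have hK0 : (0 : ℝ) < K := by linarith
  have hr0 : 0 < r := Real.rpow_pos_of_pos hK0 _
  have hdiff : ∀ k ∈ Ω, |(k j : ℝ) - l j| ≤ K := by
    intro k hk
    have h1 : (k j : ℝ) ≤ K := by exact_mod_cast hΩK k hk j
    have h2 : (0 : ℝ) ≤ k j := Nat.cast_nonneg _
    rw [abs_le]
    constructor <;> linarith [hl j, hlK j]
  set Z := ∑ k ∈ Ω, poissonMass l k with hZ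
  have hZ0 : 0 < Z := sum_poissonMass_pos hl ⟨k₀, hk₀⟩
  set E := Real.exp (-(∑ i, l i)) with hE
  have hE0 : 0 < E := Real.exp_pos _
  have hprod : ∀ k, E * poissonMass l k
      = ∏ i, (Real.exp (-l i) * (l i ^ k i / (k i).factorial)) := by
    intro k
    rw [Finset.prod_mul_distrib, ← Real.exp_sum, Finset.sum_neg_distrib]; rfl
  have hlow : ((Real.exp 2 * K)⁻¹) ^ d ≤ E * Z := by
    calc ((Real.exp 2 * K)⁻¹) ^ d = ∏ _i : I, (Real.exp 2 * (K : ℝ))⁻¹ := by simp [hd]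
      _ ≤ ∏ i, (Real.exp (-l i) * (l i ^ k₀ i / (k₀ i).factorial)) := by
          refine Finset.prod_le_prod (fun i _ => by positivity) fun i _ => ?_
          exact poisson_lower (hl i) (hk₀1 i) (by exact_mod_cast hΩK k₀ hk₀ i) (hB i) (hBl i)
      _ = E * poissonMass l k₀ := (hprod k₀).symm
      _ ≤ E * Z := by
          gcongr
          exact Finset.single_le_sum (f := poissonMass l)
            (fun k _ => (poissonMass_pos hl k).le) hk₀
  have hup : ∀ k, E * poissonMass l k
      ≤ Real.exp 1 * Real.exp (-(|(k j : ℝ) - l j| / √K)) := by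
    intro k
    rw [hprod, ← Finset.mul_prod_erase Finset.univ _ (Finset.mem_univ j)]
    have hle1 : ∏ i ∈ Finset.univ.erase j, (Real.exp (-l i) * (l i ^ k i / (k i).factorial)) ≤ 1 := by
      refine Finset.prod_le_one (fun i _ => ?_) fun i _ => ?_
      · have := hl i; positivity
      · rw [Real.exp_neg, inv_mul_le_iff₀ (Real.exp_pos _), mul_one]
        exact Real.pow_div_factorial_le_exp _ (hl i).le _
    have hj := poisson_upper (hl j) hK1 (hlK j) (k j)
    have := hl j
    calc _ ≤ (Real.exp (-l j) * (l j ^ k j / (k j).factorial)) * 1 := by gcongr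
      _ ≤ _ := by rw [mul_one]; exact hj
  have hcard : (Ω.card : ℝ) ≤ (2 * K) ^ d := by
    have : Ω ⊆ Fintype.piFinset fun _ : I => Finset.range (K + 1) := by
      intro k hk
      rw [Fintype.mem_piFinset]
      intro i
      rw [Finset.mem_range]
      have := hΩK k hk i
      omega
    have h1 := Finset.card_le_card this
    rw [Fintype.card_piFinset] at h1
    simp only [Finset.card_range, Finset.prod_const, Finset.card_univ] at h1
    calc (Ω.card : ℝ) ≤ ((K + 1 : ℕ) : ℝ) ^ d := by exact_mod_cast h1
      _ ≤ _ := by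
          gcongr
          push_cast; linarith
  set T := Real.exp 1 * Real.exp (-((K : ℝ) ^ (1 / 10 : ℝ))) with hT
  have hrK : r / √K = (K : ℝ) ^ (1 / 10 : ℝ) := by
    rw [Real.sqrt_eq_rpow, hr, ← Real.rpow_sub hK0]; norm_num
  have hpt : ∀ k ∈ Ω, (E * poissonMass l k) * |(k j : ℝ) - l j| ^ p
      ≤ (E * poissonMass l k) * r ^ p + T * (K : ℝ) ^ p := by
    intro k hk
    have hm := poissonMass_pos hl k
    rcases le_or_gt |(k j : ℝ) - l j| r with h | h
    · have : 0 ≤ T * (K : ℝ) ^ p := by positivity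
      have h2 : |(k j : ℝ) - l j| ^ p ≤ r ^ p := by gcongr
      nlinarith [mul_le_mul_of_nonneg_left h2 (mul_pos hE0 hm).le]
    · have h1 : (E * poissonMass l k) ≤ T := by
        refine (hup k).trans ?_
        rw [hT, ← hrK]
        gcongr
      have h2 : |(k j : ℝ) - l j| ^ p ≤ (K : ℝ) ^ p := by
        gcongr
        exact hdiff k hk
      calc _ ≤ T * (K : ℝ) ^ p := by gcongr
        _ ≤ _ := by
          have : 0 ≤ (E * poissonMass l k) * r ^ p := by positivity
          linarith
  have hsum := Finset.sum_le_sum hpt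
  rw [Finset.sum_add_distrib, ← Finset.sum_mul, ← Finset.mul_sum, Finset.sum_const,
    nsmul_eq_mul] at hsum
  unfold condExp
  rw [div_le_iff₀ hZ0]
  have hL0 : 0 < (Real.exp 2 * (K : ℝ)) ^ d := by positivity
  have hEZ1 : 1 ≤ E * Z * (Real.exp 2 * (K : ℝ)) ^ d := by
    rw [inv_pow, inv_le_iff_one_le_mul₀ hL0] at hlow
    linarith
  have htail : (Ω.card : ℝ) * (T * (K : ℝ) ^ p) ≤ E * Z * momentTail d p K := by
    calc (Ω.card : ℝ) * (T * (K : ℝ) ^ p)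
        ≤ ((2 * K) ^ d * (T * (K : ℝ) ^ p)) * 1 := by
          rw [mul_one]; gcongr
      _ ≤ ((2 * K) ^ d * (T * (K : ℝ) ^ p)) * (E * Z * (Real.exp 2 * (K : ℝ)) ^ d) := by gcongr
      _ ≤ E * Z * momentTail d p K := by
          unfold momentTail
          have e1 : Real.exp (1 + 2 * d) = Real.exp 1 * Real.exp 2 ^ d := by
            rw [Real.exp_add, ← Real.exp_nat_mul]; ring_nf
          have e2 : (K : ℝ) ^ (p + d) ≤ (2 * (K : ℝ)) ^ (p + d) := by
            gcongr; linarith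
          calc _ = E * Z * (Real.exp 1 * Real.exp 2 ^ d * ((2 * K) ^ d * (K : ℝ) ^ (p + d)) *
                Real.exp (-((K : ℝ) ^ (1 / 10 : ℝ)))) := by rw [hT]; ring
            _ ≤ E * Z * (Real.exp 1 * Real.exp 2 ^ d * ((2 * K) ^ d * (2 * (K : ℝ)) ^ (p + d)) *
                Real.exp (-((K : ℝ) ^ (1 / 10 : ℝ)))) := by gcongr
            _ = _ := by rw [e1]; ring
  have hs2 : E * ∑ k ∈ Ω, poissonMass l k * |(k j : ℝ) - l j| ^ p
      ≤ E * ((r ^ p + momentTail d p K) * Z) := by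
    calc _ = ∑ k ∈ Ω, (E * poissonMass l k) * |(k j : ℝ) - l j| ^ p := by
          rw [Finset.mul_sum]; exact Finset.sum_congr rfl fun k _ => by ring
      _ ≤ _ := by
          refine hsum.trans ?_
          rw [← hZ]
          nlinarith
  exact le_of_mul_le_mul_left hs2 hE0

end ConditionedPoisson

/-! ### Limiting covariances of conditioned Poisson variables -/

section Covariance

variable {I : Type} [Fintype I] [DecidableEq I]

/-- The means `l` are of order `K`, the configurations in `Ω` have entries at most `K`, and some
configuration in `Ω` is within `B` of the means. -/
structure NearCritical (c B : ℝ) (K : ℕ) (l : I → ℝ) (Ω : Finset (I → ℕ)) : Prop where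
  lower : ∀ i, c * K ≤ l i
  upper : ∀ i, l i ≤ K
  bound : ∀ k ∈ Ω, ∀ i, k i ≤ K
  near : ∃ k₀ ∈ Ω, ∀ i, |(k₀ i : ℝ) - l i| ≤ B

theorem NearCritical.eventually_moment {c B : ℝ} (hc : 0 < c) {K : ℕ → ℕ} {l : ℕ → I → ℝ}
    {Ω : ℕ → Finset (I → ℕ)} (hK : Tendsto K atTop atTop)
    (h : ∀ᶠ n in atTop, NearCritical c B (K n) (l n) (Ω n)) :
    ∀ᶠ n in atTop, 1 ≤ K n ∧ (∀ i, 0 < l n i) ∧ (Ω n).Nonempty ∧ ∀ (p : ℕ) (j : I),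
      condExp (l n) (Ω n) (fun k => |(k j : ℝ) - l n j| ^ p)
        ≤ ((K n : ℝ) ^ (3 / 5 : ℝ)) ^ p + momentTail (Fintype.card I) p (K n) := by
  have hKr : Tendsto (fun n => c * (K n : ℝ)) atTop atTop :=
    (tendsto_natCast_atTop_atTop.comp hK).const_mul_atTop hc
  filter_upwards [h, hK.eventually_ge_atTop 1, hKr.eventually_ge_atTop (B ^ 2 + |B| + 1)]
    with n hn hK1 hKB
  have hl : ∀ i, B ^ 2 + |B| + 1 ≤ l n i := fun i => hKB.trans (hn.lower i)
  have hl0 : ∀ i, 0 < l n i := fun i => by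
    have := hl i; have := sq_nonneg B; have := abs_nonneg B; linarith
  obtain ⟨k₀, hk₀, hB⟩ := hn.near
  refine ⟨hK1, hl0, ⟨k₀, hk₀⟩, fun p j => ?_⟩
  refine condExp_abs_pow_le hl0 hK1 hn.upper hn.bound hk₀ (fun i => ?_) hB (fun i => ?_) p j
  · have h1 := (abs_le.1 (hB i)).1
    have h2 := hl i
    have h3 := le_abs_self B
    have h4 := sq_nonneg B
    have : (1 : ℝ) ≤ k₀ i := by linarith
    exact_mod_cast this
  · have := hl i; have := abs_nonneg B; linarith

theorem tendsto_condExp_abs_pow {c B : ℝ} (hc : 0 < c) {K : ℕ → ℕ} {l : ℕ → I → ℝ}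
    {Ω : ℕ → Finset (I → ℕ)} (hK : Tendsto K atTop atTop)
    (h : ∀ᶠ n in atTop, NearCritical c B (K n) (l n) (Ω n)) (j : I) {p q : ℕ} (hq : 1 ≤ q)
    (hpq : 3 * p < 5 * q) :
    Tendsto (fun n => condExp (l n) (Ω n) (fun k => |(k j : ℝ) - l n j| ^ p) / (K n : ℝ) ^ q)
      atTop (𝓝 0) := by
  have hKr : Tendsto (fun n => (K n : ℝ)) atTop atTop := tendsto_natCast_atTop_atTop.comp hK
  have h1 : Tendsto (fun x : ℝ => ((x ^ (3 / 5 : ℝ)) ^ p + momentTail (Fintype.card I) p x) / x ^ q)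
      atTop (𝓝 0) := by
    have e1 : Tendsto (fun x : ℝ => x ^ (-((q : ℝ) - 3 / 5 * p))) atTop (𝓝 0) := by
      refine tendsto_rpow_neg_atTop ?_
      have : (3 * p : ℝ) < 5 * q := by exact_mod_cast hpq
      linarith
    have e2 : Tendsto (fun x : ℝ => momentTail (Fintype.card I) p x / x ^ q) atTop (𝓝 0) :=
      (tendsto_momentTail _ p).div_atTop (tendsto_pow_atTop (by omega))
    have e3 := e1.add e2
    rw [add_zero] at e3
    refine e3.congr' ?_
    filter_upwards [eventually_gt_atTop 0] with x hx
    rw [add_div, ← Real.rpow_natCast (x ^ (3 / 5 : ℝ)) p, ← Real.rpow_mul hx.le,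
      ← Real.rpow_natCast x q, ← Real.rpow_sub hx]
    congr 2
    ring
  refine tendsto_of_tendsto_of_tendsto_of_le_of_le' tendsto_const_nhds (h1.comp hKr) ?_ ?_
  · filter_upwards [NearCritical.eventually_moment hc hK h] with n hn
    refine div_nonneg ?_ (by positivity)
    refine (abs_nonneg _).trans (abs_condExp_le hn.2.1 (f := fun k => |(k j : ℝ) - l n j| ^ p) ?_)
    intro k _
    rw [abs_of_nonneg (by positivity)]
  · filter_upwards [NearCritical.eventually_moment hc hK h] with n hn
    simp only [Function.comp]
    gcongr
    exact hn.2.2.2 p j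

/-- The exchange identity linearized at the means: the covariances of independent Poisson variables
conditioned to a lattice asymptotically satisfy the linear equations that characterize those of the
conditioned Gaussian variables. -/
theorem tendsto_condExp_linear {c B : ℝ} (hc : 0 < c) {K : ℕ → ℕ} {l : ℕ → I → ℝ}
    {Ω : ℕ → Finset (I → ℕ)} (hK : Tendsto K atTop atTop)
    (h : ∀ᶠ n in atTop, NearCritical c B (K n) (l n) (Ω n)) {D U : Finset I}
    (hDU : ∀ᶠ n in atTop, ∀ m, m + ind D ∈ Ω n ↔ m + ind U ∈ Ω n) (j : I) :
    Tendsto (fun n => condExp (l n) (Ω n) (fun k =>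
        (∑ i ∈ U, ((k i : ℝ) - l n i) / l n i - ∑ i ∈ D, ((k i : ℝ) - l n i) / l n i)
          * ((k j : ℝ) - l n j)))
      atTop (𝓝 ((ind U j : ℝ) - (ind D j : ℝ))) := by
  obtain ⟨CU, hCU, hU⟩ := exists_prod_one_add_bound U (1 / c) (by positivity)
  obtain ⟨CD, hCD, hD⟩ := exists_prod_one_add_bound D (1 / c) (by positivity)
  have m1 := fun i => tendsto_condExp_abs_pow hc hK h i (p := 1) (q := 1) le_rfl (by norm_num)
  have m3 := fun i => tendsto_condExp_abs_pow hc hK h i (p := 3) (q := 2) (by norm_num) (by norm_num)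
  have herr : Tendsto (fun n =>
      2 * (CU * ∑ i ∈ U, (1 / c) *
        (condExp (l n) (Ω n) (fun k => |(k i : ℝ) - l n i| ^ 1) / (K n : ℝ) ^ 1))
      + (CU * ∑ i ∈ U, (1 / c ^ 2) *
          (condExp (l n) (Ω n) (fun k => |(k i : ℝ) - l n i| ^ 3) / (K n : ℝ) ^ 2
            + condExp (l n) (Ω n) (fun k => |(k j : ℝ) - l n j| ^ 3) / (K n : ℝ) ^ 2)
        + CD * ∑ i ∈ D, (1 / c ^ 2) *
          (condExp (l n) (Ω n) (fun k => |(k i : ℝ) - l n i| ^ 3) / (K n : ℝ) ^ 2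
            + condExp (l n) (Ω n) (fun k => |(k j : ℝ) - l n j| ^ 3) / (K n : ℝ) ^ 2)))
      atTop (𝓝 0) := by
    have z1 := (tendsto_finsetSum U fun i _ => (m1 i).const_mul (1 / c)).const_mul CU
    have z2 := (tendsto_finsetSum U fun i _ =>
      ((m3 i).add (m3 j)).const_mul (1 / c ^ 2)).const_mul CU
    have z3 := (tendsto_finsetSum D fun i _ =>
      ((m3 i).add (m3 j)).const_mul (1 / c ^ 2)).const_mul CD
    have := (z1.const_mul 2).add (z2.add z3)
    simpa using this
  rw [tendsto_iff_norm_sub_tendsto_zero]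
  refine squeeze_zero' (Eventually.of_forall fun _ => norm_nonneg _) ?_ herr
  filter_upwards [h, hDU, NearCritical.eventually_moment hc hK h] with n hn hDUn hmom
  obtain ⟨hK1, hl, hne, -⟩ := hmom
  have hK0 : (0 : ℝ) < K n := by exact_mod_cast hK1
  set E := condExp (l n) (Ω n) with hE
  set y : (I → ℕ) → I → ℝ := fun k i => (k i : ℝ) - l n i with hy
  set z : (I → ℕ) → I → ℝ := fun k i => ((k i : ℝ) - l n i) / l n i with hz
  have hzK : ∀ k i, |z k i| ≤ |y k i| / (c * K n) := by
    intro k i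
    simp only [hz, hy]
    rw [abs_div, abs_of_pos (hl i)]
    gcongr
    exact hn.lower i
  have hyK : ∀ k ∈ Ω n, ∀ i, |y k i| ≤ K n := by
    intro k hk i
    have h1 : (k i : ℝ) ≤ K n := by exact_mod_cast hn.bound k hk i
    have h2 : (0 : ℝ) ≤ k i := Nat.cast_nonneg _
    simp only [hy]
    rw [abs_le]
    constructor <;> linarith [hl i, hn.upper i]
  have hzc : ∀ k ∈ Ω n, ∀ i, |z k i| ≤ 1 / c := by
    intro k hk i
    refine (hzK k i).trans ?_
    rw [div_le_div_iff₀ (by positivity) hc]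
    have := hyK k hk i
    nlinarith
  have hA : ∀ (S : Finset I) k, ∏ i ∈ S, (k i : ℝ) / l n i = ∏ i ∈ S, (1 + z k i) := by
    intro S k
    refine Finset.prod_congr rfl fun i _ => ?_
    have := (hl i).ne'
    simp only [hz]; field_simp; ring
  -- the exchange identity for the `j`-th coordinate
  have hex : E (fun k => (∏ i ∈ D, (1 + z k i)) * y k j)
      = E (fun k => (∏ i ∈ U, (1 + z k i)) * (y k j - ((ind U j : ℝ) - (ind D j : ℝ)))) := by
    have := sum_exchange hl hDUn (f := fun k => y k j)
      (g := fun k => y k j - ((ind U j : ℝ) - (ind D j : ℝ))) (by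
        intro m; simp only [hy, Pi.add_apply]; push_cast; ring)
    simp only [hA] at this
    simp only [hE, condExp]
    rw [this]
  set δ : ℝ := (ind U j : ℝ) - (ind D j : ℝ) with hδ
  have hδ2 : |δ| ≤ 2 := by
    simp only [hδ, ind]
    split_ifs <;> norm_num
  have hlin : E (fun k => (∑ i ∈ U, z k i - ∑ i ∈ D, z k i) * y k j) - δ
      = δ * E (fun k => ∏ i ∈ U, (1 + z k i) - 1)
        - E (fun k => ((∏ i ∈ U, (1 + z k i) - 1 - ∑ i ∈ U, z k i)
          - (∏ i ∈ D, (1 + z k i) - 1 - ∑ i ∈ D, z k i)) * y k j) := by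
    have e1 : E (fun k => ((∏ i ∈ U, (1 + z k i) - 1 - ∑ i ∈ U, z k i)
          - (∏ i ∈ D, (1 + z k i) - 1 - ∑ i ∈ D, z k i)) * y k j)
        = (E (fun k => (∏ i ∈ U, (1 + z k i)) * y k j)
          - E (fun k => (∏ i ∈ D, (1 + z k i)) * y k j))
          - E (fun k => (∑ i ∈ U, z k i - ∑ i ∈ D, z k i) * y k j) := by
      simp only [hE]
      rw [← condExp_sub, ← condExp_sub]
      congr 1; funext k; ring
    have e2 : E (fun k => (∏ i ∈ U, (1 + z k i)) * (y k j - δ))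
        = E (fun k => (∏ i ∈ U, (1 + z k i)) * y k j)
          - δ * E (fun k => ∏ i ∈ U, (1 + z k i)) := by
      simp only [hE]
      rw [← condExp_const_mul, ← condExp_sub]
      congr 1; funext k; ring
    have e3 : E (fun k => ∏ i ∈ U, (1 + z k i) - 1) = E (fun k => ∏ i ∈ U, (1 + z k i)) - 1 := by
      simp only [hE]
      rw [condExp_sub, condExp_const hl hne]
    rw [e1, e3, hex, e2]; ring
  rw [Real.norm_eq_abs]
  change |E (fun k => (∑ i ∈ U, z k i - ∑ i ∈ D, z k i) * y k j) - δ| ≤ _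
  rw [hlin]
  have hfirst : |E (fun k => ∏ i ∈ U, (1 + z k i) - 1)|
      ≤ CU * ∑ i ∈ U, (1 / c) * (E (fun k => |y k i| ^ 1) / (K n : ℝ) ^ 1) := by
    have : CU * ∑ i ∈ U, (1 / c) * (E (fun k => |y k i| ^ 1) / (K n : ℝ) ^ 1)
        = E (fun k => CU * ∑ i ∈ U, (1 / (c * K n)) * |y k i| ^ 1) := by
      simp only [hE]
      rw [condExp_const_mul, condExp_sum]
      congr 1
      refine Finset.sum_congr rfl fun i _ => ?_
      rw [condExp_const_mul]
      field_simp
    rw [this]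
    refine abs_condExp_le hl fun k hk => ((hU (z k) (hzc k hk)).1).trans ?_
    gcongr with i hi
    rw [pow_one]
    refine (hzK k i).trans (le_of_eq (by ring))
  have hsecond : ∀ (S : Finset I) (C : ℝ), 0 ≤ C → (∀ k ∈ Ω n,
      |∏ i ∈ S, (1 + z k i) - 1 - ∑ i ∈ S, z k i| ≤ C * ∑ i ∈ S, z k i ^ 2) →
      |E (fun k => (∏ i ∈ S, (1 + z k i) - 1 - ∑ i ∈ S, z k i) * y k j)|
        ≤ C * ∑ i ∈ S, (1 / c ^ 2) * (E (fun k => |y k i| ^ 3) / (K n : ℝ) ^ 2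
          + E (fun k => |y k j| ^ 3) / (K n : ℝ) ^ 2) := by
    intro S C hC hS
    have : C * ∑ i ∈ S, (1 / c ^ 2) * (E (fun k => |y k i| ^ 3) / (K n : ℝ) ^ 2
          + E (fun k => |y k j| ^ 3) / (K n : ℝ) ^ 2)
        = E (fun k => C * ∑ i ∈ S, (1 / (c * K n) ^ 2) * (|y k i| ^ 3 + |y k j| ^ 3)) := by
      simp only [hE]
      rw [condExp_const_mul, condExp_sum]
      congr 1
      refine Finset.sum_congr rfl fun i _ => ?_
      rw [condExp_const_mul, condExp_add]
      field_simp
    rw [this]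
    refine abs_condExp_le hl fun k hk => ?_
    rw [abs_mul]
    calc _ ≤ (C * ∑ i ∈ S, z k i ^ 2) * |y k j| := by gcongr; exact hS k hk
      _ = C * ∑ i ∈ S, z k i ^ 2 * |y k j| := by rw [mul_assoc, Finset.sum_mul]
      _ ≤ _ := by
        refine mul_le_mul_of_nonneg_left (Finset.sum_le_sum fun i _ => ?_) hC
        have h1 : z k i ^ 2 ≤ 1 / (c * K n) ^ 2 * |y k i| ^ 2 := by
          rw [← sq_abs]
          calc |z k i| ^ 2 ≤ (|y k i| / (c * K n)) ^ 2 := by gcongr; exact hzK k i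
            _ = _ := by rw [div_pow]; ring
        have h2 : |y k i| ^ 2 * |y k j| ≤ |y k i| ^ 3 + |y k j| ^ 3 := by
          have a0 := abs_nonneg (y k i)
          have b0 := abs_nonneg (y k j)
          rcases le_total |y k i| |y k j| with h | h
          · have : |y k i| ^ 2 * |y k j| ≤ |y k j| ^ 2 * |y k j| := by gcongr
            have : 0 ≤ |y k i| ^ 3 := by positivity
            nlinarith
          · have : |y k i| ^ 2 * |y k j| ≤ |y k i| ^ 2 * |y k i| := by gcongr
            have : 0 ≤ |y k j| ^ 3 := by positivity
            nlinarith
        calc _ ≤ (1 / (c * K n) ^ 2 * |y k i| ^ 2) * |y k j| :=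
              mul_le_mul_of_nonneg_right h1 (abs_nonneg _)
          _ = 1 / (c * K n) ^ 2 * (|y k i| ^ 2 * |y k j|) := by ring
          _ ≤ _ := mul_le_mul_of_nonneg_left h2 (by positivity)
  have hsU := hsecond U CU hCU fun k hk => (hU (z k) (hzc k hk)).2
  have hsD := hsecond D CD hCD fun k hk => (hD (z k) (hzc k hk)).2
  have hsplit : E (fun k => ((∏ i ∈ U, (1 + z k i) - 1 - ∑ i ∈ U, z k i)
          - (∏ i ∈ D, (1 + z k i) - 1 - ∑ i ∈ D, z k i)) * y k j)
      = E (fun k => (∏ i ∈ U, (1 + z k i) - 1 - ∑ i ∈ U, z k i) * y k j)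
        - E (fun k => (∏ i ∈ D, (1 + z k i) - 1 - ∑ i ∈ D, z k i) * y k j) := by
    simp only [hE]
    rw [← condExp_sub]
    congr 1; funext k; ring
  rw [hsplit]
  refine (abs_sub _ _).trans (add_le_add ?_ ((abs_sub _ _).trans (add_le_add hsU hsD)))
  rw [abs_mul]
  exact mul_le_mul hδ2 hfirst (abs_nonneg _) (by norm_num)

end Covariance

/-! ### Tiles and tile counts on the torus -/

section TorusTiles

variable (n : ℕ) [NeZero n] (τ : Finset (ℤ × ℤ))

/-- Reduction of the lattice modulo `n`. -/
def toTorus (c : ℤ × ℤ) : ZMod n × ZMod n := ((c.1 : ZMod n), (c.2 : ZMod n))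

/-- The tiles of the torus: translates of `τ` (`Sum.inl`) and singletons (`Sum.inr`). -/
def torusTile : (ZMod n × ZMod n) ⊕ (ZMod n × ZMod n) → TorusVertex n → ℕ :=
  Sum.elim (polyTile n τ) (singleTile n τ)

/-- The torus of side `n` is so large that `τ` embeds in it and has no periods. -/
structure Embeds : Prop where
  two_le : 2 ≤ τ.card
  injOn : Set.InjOn (toTorus n) τ
  polyTile_injective : Function.Injective (polyTile n τ)

theorem torusTiles_eq : torusTiles n τ = Finset.univ.image (torusTile n τ) := by
  ext t
  simp [torusTiles, polyTiles, singleTiles, torusTile]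

theorem polyTile_some (a x : ZMod n × ZMod n) :
    polyTile n τ a (some x) = (τ.filter fun c => a + toTorus n c = x).card := rfl

variable {n τ}

theorem sum_mul_polyTile {R : Type} [CommSemiring R] (f : ZMod n × ZMod n → R)
    (x : ZMod n × ZMod n) :
    ∑ a, f a * (polyTile n τ a (some x) : R) = ∑ c ∈ τ, f (x - toTorus n c) := by
  simp_rw [polyTile_some, Finset.card_filter]
  push_cast
  simp_rw [Finset.mul_sum]
  rw [Finset.sum_comm]
  refine Finset.sum_congr rfl fun c _ => ?_
  rw [Finset.sum_eq_single (x - toTorus n c)]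
  · simp
  · intro b _ hb
    rw [if_neg, mul_zero]
    intro h
    exact hb (eq_sub_of_add_eq h)
  · simp

theorem sum_mul_torusTile_some {R : Type} [CommSemiring R]
    (f : (ZMod n × ZMod n) ⊕ (ZMod n × ZMod n) → R) (x : ZMod n × ZMod n) :
    ∑ i, f i * (torusTile n τ i (some x) : R)
      = ∑ c ∈ τ, f (Sum.inl (x - toTorus n c)) + f (Sum.inr x) := by
  rw [Fintype.sum_sum_type]
  congr 1
  · exact sum_mul_polyTile (fun a => f (Sum.inl a)) x
  · rw [Finset.sum_eq_single x]
    · simp [torusTile, singleTile]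
    · intro b _ hb
      simp [torusTile, singleTile, Ne.symm hb]
    · simp

theorem sum_mul_torusTile_none {R : Type} [CommSemiring R]
    (f : (ZMod n × ZMod n) ⊕ (ZMod n × ZMod n) → R) :
    ∑ i, f i * (torusTile n τ i none : R) = (∑ a, f (Sum.inr a)) * ((τ.card - 1 : ℕ) : R) := by
  rw [Fintype.sum_sum_type, Finset.sum_mul]
  simp [torusTile, polyTile, singleTile]

theorem sum_torusTile (hd : 1 ≤ τ.card) (i : (ZMod n × ZMod n) ⊕ (ZMod n × ZMod n)) :
    ∑ v, torusTile n τ i v = τ.card := by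
  rw [Fintype.sum_option]
  rcases i with a | a
  · simp only [torusTile, Sum.elim_inl, polyTile_some]
    rw [Finset.sum_card_fiberwise_eq_card_filter]
    simp [polyTile]
  · simp only [torusTile, Sum.elim_inr, singleTile]
    rw [Finset.sum_ite_eq' Finset.univ a]
    simp; omega

namespace Embeds

variable (h : Embeds n τ)

include h

theorem torusTile_injective : Function.Injective (torusTile n τ) := by
  have h2 := h.two_le
  rintro (a | a) (b | b) hab
  · exact congrArg _ (h.polyTile_injective hab)
  · have := congrFun hab none
    simp [torusTile, polyTile, singleTile] at this
    omega
  · have := congrFun hab none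
    simp [torusTile, polyTile, singleTile] at this
    omega
  · have := congrFun hab (some a)
    simp [torusTile, singleTile] at this
    rw [this]

theorem torusTile_ne_zero (i : (ZMod n × ZMod n) ⊕ (ZMod n × ZMod n)) : torusTile n τ i ≠ 0 := by
  intro h0
  have h2 := h.two_le
  have := sum_torusTile (n := n) (τ := τ) (by omega) i
  rw [h0] at this
  simp at this
  omega

theorem torusWeight_inl (w w₀ : ℝ) (a : ZMod n × ZMod n) :
    torusWeight n τ w w₀ (torusTile n τ (Sum.inl a)) = w := by
  unfold torusWeight
  rw [if_pos]
  exact Finset.mem_image_of_mem _ (Finset.mem_univ a)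

theorem torusWeight_inr (w w₀ : ℝ) (a : ZMod n × ZMod n) :
    torusWeight n τ w w₀ (torusTile n τ (Sum.inr a)) = w₀ := by
  unfold torusWeight
  rw [if_neg]
  intro hm
  obtain ⟨b, -, hb⟩ := Finset.mem_image.1 hm
  have := h.torusTile_injective (a₁ := Sum.inl b) (a₂ := Sum.inr a) hb
  simp at this

theorem polyTile_some_eq (a x : ZMod n × ZMod n) :
    polyTile n τ a (some x) = if x ∈ τ.image (fun c => a + toTorus n c) then 1 else 0 := by
  rw [polyTile_some]
  split_ifs with hx
  · obtain ⟨c, hc, rfl⟩ := Finset.mem_image.1 hx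
    rw [Finset.card_eq_one]
    refine ⟨c, ?_⟩
    ext c'
    simp only [Finset.mem_filter, add_right_inj, Finset.mem_singleton]
    constructor
    · rintro ⟨h1, h2⟩; exact h.injOn h1 hc h2
    · rintro rfl; exact ⟨hc, rfl⟩
  · rw [Finset.card_eq_zero, Finset.filter_eq_empty_iff]
    intro c hc hcx
    exact hx (Finset.mem_image.2 ⟨c, hc, hcx⟩)

theorem prod_factorial_inl (a : ZMod n × ZMod n) :
    ∏ v, ((torusTile n τ (Sum.inl a) v).factorial : ℝ) = 1 := by
  refine Finset.prod_eq_one fun v _ => ?_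
  rcases v with _ | x
  · simp [torusTile, polyTile]
  · simp only [torusTile, Sum.elim_inl]
    rw [h.polyTile_some_eq]
    split_ifs <;> simp

omit h in
theorem prod_factorial_inr (a : ZMod n × ZMod n) :
    ∏ v, ((torusTile n τ (Sum.inr a) v).factorial : ℝ) = (τ.card - 1).factorial := by
  rw [Fintype.prod_option]
  simp only [torusTile, Sum.elim_inr, singleTile]
  rw [Finset.prod_eq_one, mul_one]
  intro x _
  split_ifs <;> simp

end Embeds

/-- The configurations of tile counts that cover each vertex as often as its multiplicity. -/
def torusConfigs (n : ℕ) [NeZero n] (τ : Finset (ℤ × ℤ)) (N N₀ : ℕ) :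
    Finset ((ZMod n × ZMod n) ⊕ (ZMod n × ZMod n) → ℕ) :=
  (Fintype.piFinset fun _ => Finset.range (∑ v, torusMult n N N₀ v + 1)).filter
    fun k => ∀ v, ∑ i, k i * torusTile n τ i v = torusMult n N N₀ v

theorem sum_counts (hd : 1 ≤ τ.card) {N N₀ : ℕ}
    {k : (ZMod n × ZMod n) ⊕ (ZMod n × ZMod n) → ℕ}
    (hk : ∀ v, ∑ i, k i * torusTile n τ i v = torusMult n N N₀ v) :
    (∑ i, k i) * τ.card = ∑ v, torusMult n N N₀ v := by
  simp_rw [← hk]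
  rw [Finset.sum_comm, Finset.sum_mul]
  refine Finset.sum_congr rfl fun i _ => ?_
  rw [← Finset.mul_sum, sum_torusTile hd]

theorem mem_torusConfigs (hd : 1 ≤ τ.card) {N N₀ : ℕ}
    {k : (ZMod n × ZMod n) ⊕ (ZMod n × ZMod n) → ℕ} :
    k ∈ torusConfigs n τ N N₀ ↔ ∀ v, ∑ i, k i * torusTile n τ i v = torusMult n N N₀ v := by
  unfold torusConfigs
  rw [Finset.mem_filter, Fintype.mem_piFinset]
  refine ⟨fun hk => hk.2, fun hk => ⟨fun i => ?_, hk⟩⟩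
  rw [Finset.mem_range, Nat.lt_succ_iff, ← sum_counts hd hk]
  calc k i ≤ ∑ i, k i := Finset.single_le_sum (f := k) (fun _ _ => Nat.zero_le _) (Finset.mem_univ i)
    _ ≤ _ := Nat.le_mul_of_pos_right _ (by omega)

/-- Multiplicities and weights for which the torus of side `n` is in the critical gauge. -/
structure TorusCritical (n : ℕ) [NeZero n] (τ : Finset (ℤ × ℤ)) (N N₀ K : ℕ) (w w₀ : ℝ) : Prop where
  K_pos : 0 < K
  feasible : Feasible (torusTiles n τ) (torusMult n N N₀)
  size : τ.card * K = ∑ v, torusMult n N N₀ v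
  w_pos : 0 < w
  w₀_pos : 0 < w₀
  gauge : IsCriticalGauge (torusTiles n τ) (torusWeight n τ w w₀) (torusMult n N N₀) K

/-- The mean numbers of tiles: `K w` for translates of `τ` and `K w₀` for singletons. -/
def torusMean (n K : ℕ) (w w₀ : ℝ) : (ZMod n × ZMod n) ⊕ (ZMod n × ZMod n) → ℝ :=
  Sum.elim (fun _ => K * w) (fun _ => K * w₀)

namespace TorusCritical

variable {N N₀ K : ℕ} {w w₀ : ℝ} (h : Embeds n τ) (hc : TorusCritical n τ N N₀ K w w₀)

include h hc

theorem gauge_sum (v : TorusVertex n) :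
    ∑ i, torusWeight n τ w w₀ (torusTile n τ i) * (torusTile n τ i v : ℝ)
      = (torusMult n N N₀ v : ℝ) / K := by
  rw [← hc.gauge v, torusTiles_eq, Finset.sum_image fun a _ b _ hab => h.torusTile_injective hab]

theorem gauge_some : (K : ℝ) * (τ.card * w + w₀) = N := by
  have := gauge_sum h hc (some (0, 0))
  rw [sum_mul_torusTile_some] at this
  simp_rw [h.torusWeight_inl, h.torusWeight_inr] at this
  rw [Finset.sum_const, nsmul_eq_mul] at this
  have hK : (K : ℝ) ≠ 0 := by exact_mod_cast hc.K_pos.ne'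
  rw [this]
  simp only [torusMult]
  field_simp

theorem gauge_none : (K : ℝ) * ((n : ℝ) ^ 2 * w₀ * ((τ.card - 1 : ℕ) : ℝ)) = N₀ := by
  have := gauge_sum h hc none
  rw [sum_mul_torusTile_none] at this
  simp_rw [h.torusWeight_inr] at this
  rw [Finset.sum_const, nsmul_eq_mul, Finset.card_univ, Fintype.card_prod, ZMod.card] at this
  have hK : (K : ℝ) ≠ 0 := by exact_mod_cast hc.K_pos.ne'
  push_cast at this
  rw [pow_two, this]
  simp only [torusMult]
  field_simp

theorem weight_sum : (n : ℝ) ^ 2 * (w + w₀) = 1 := by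
  have h1 := gauge_some h hc
  have h2 := gauge_none h hc
  have h3 := hc.size
  have h2' := h.two_le
  rw [Fintype.sum_option] at h3
  simp only [torusMult, Finset.sum_const, Finset.card_univ, Fintype.card_prod, ZMod.card,
    smul_eq_mul] at h3
  have h4 : (τ.card : ℝ) * K = N₀ + n * n * N := by exact_mod_cast h3
  have hK : (0 : ℝ) < K := by exact_mod_cast hc.K_pos
  have hd : (0 : ℝ) < τ.card := by
    have : 0 < τ.card := by omega
    exact_mod_cast this
  rw [Nat.cast_sub (by omega)] at h2
  push_cast at h2
  have : ((τ.card : ℝ) * K) * ((n : ℝ) ^ 2 * (w + w₀)) = ((τ.card : ℝ) * K) * 1 := by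
    rw [← h1, ← h2] at h4
    linear_combination -h4
  exact mul_left_cancel₀ (by positivity) this

variable {k : (ZMod n × ZMod n) ⊕ (ZMod n × ZMod n) → ℕ}

theorem sum_eq_K (hk : k ∈ torusConfigs n τ N N₀) : ∑ i, k i = K := by
  have h2 := h.two_le
  have h1 := sum_counts (by omega) ((mem_torusConfigs (by omega)).1 hk)
  rw [← hc.size, mul_comm] at h1
  exact Nat.eq_of_mul_eq_mul_left (by omega) h1

theorem sum_inr (hk : k ∈ torusConfigs n τ N N₀) :
    ((∑ a, k (Sum.inr a) : ℕ) : ℝ) = (n : ℝ) ^ 2 * (K * w₀) := by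
  have h2 := h.two_le
  have h1 := (mem_torusConfigs (by omega)).1 hk none
  have h3 := sum_mul_torusTile_none (τ := τ) k
  simp only [Nat.cast_id] at h3
  rw [h3] at h1
  have h4 := gauge_none h hc
  simp only [torusMult] at h1
  rw [← h1] at h4
  push_cast at h4 ⊢
  have hd : ((τ.card - 1 : ℕ) : ℝ) ≠ 0 := by
    have : τ.card - 1 ≠ 0 := by omega
    exact_mod_cast this
  refine mul_right_cancel₀ hd ?_
  linear_combination -h4

theorem sum_inl (hk : k ∈ torusConfigs n τ N N₀) :
    ((∑ a, k (Sum.inl a) : ℕ) : ℝ) = (n : ℝ) ^ 2 * (K * w) := by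
  have h1 := sum_eq_K h hc hk
  rw [Fintype.sum_sum_type] at h1
  have h2 := sum_inr h hc hk
  have h3 := weight_sum h hc
  have h4 : ((∑ a, k (Sum.inl a) : ℕ) : ℝ) + ((∑ a, k (Sum.inr a) : ℕ) : ℝ) = K := by
    exact_mod_cast h1
  linear_combination h4 - h2 - K * h3

theorem dev_inr (hk : k ∈ torusConfigs n τ N N₀) (x : ZMod n × ZMod n) :
    (k (Sum.inr x) : ℝ) - K * w₀
      = -∑ c ∈ τ, ((k (Sum.inl (x - toTorus n c)) : ℝ) - K * w) := by
  have h2 := h.two_le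
  have h1 := (mem_torusConfigs (by omega)).1 hk (some x)
  have h3 := sum_mul_torusTile_some (τ := τ) k x
  simp only [Nat.cast_id] at h3
  rw [h3] at h1
  simp only [torusMult] at h1
  have h4 := gauge_some h hc
  rw [← h1] at h4
  push_cast at h4
  rw [Finset.sum_sub_distrib, Finset.sum_const, nsmul_eq_mul]
  linear_combination -h4

omit h in
theorem torusMean_pos (i : (ZMod n × ZMod n) ⊕ (ZMod n × ZMod n)) : 0 < torusMean n K w w₀ i := by
  have hK : (0 : ℝ) < K := by exact_mod_cast hc.K_pos
  rcases i with a | a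
  · exact mul_pos hK hc.w_pos
  · exact mul_pos hK hc.w₀_pos

/-- The conditioned Poisson variables with means `K w`, `K w₀` have the law of the tile counts. The
factorials from the copies of the dummy vertex in the singletons are the same for all tilings. -/
theorem expect_eq (F : ((ZMod n × ZMod n) ⊕ (ZMod n × ZMod n) → ℕ) → ℝ) :
    expect (torusTiles n τ) (torusWeight n τ w w₀) (torusMult n N N₀)
        (fun m => F (fun i => tileCount (torusTile n τ i) m))
      = condExp (torusMean n K w w₀) (torusConfigs n τ N N₀) F := by
  have h2 := h.two_le
  have hmem : ∀ k, k ∈ torusConfigs n τ N N₀ ↔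
      ∀ v, ∑ i, k i * torusTile n τ i v = torusMult n N N₀ v :=
    fun k => mem_torusConfigs (by omega)
  have hsum := sum_tilings (N := torusMult n N N₀) h.torusTile_ne_zero h.torusTile_injective
    (torusWeight n τ w w₀) _ hmem
  have hK : (0 : ℝ) < K := by exact_mod_cast hc.K_pos
  obtain ⟨S, hS⟩ : ∃ S : ℕ, ∀ k ∈ torusConfigs n τ N N₀, ∑ a, k (Sum.inr a) = S := by
    rcases (torusConfigs n τ N N₀).eq_empty_or_nonempty with he | ⟨k₀, hk₀⟩
    · exact ⟨0, by simp [he]⟩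
    · refine ⟨∑ a, k₀ (Sum.inr a), fun k hk => ?_⟩
      have := (sum_inr h hc hk).trans (sum_inr h hc hk₀).symm
      exact_mod_cast this
  set c : ℝ := (K : ℝ) ^ K * ((τ.card - 1).factorial : ℝ) ^ S with hcdef
  have hc0 : c ≠ 0 := by positivity
  have hmass : ∀ k ∈ torusConfigs n τ N N₀,
      poissonMass (torusMean n K w w₀) k
        = c * ∏ i, (torusWeight n τ w w₀ (torusTile n τ i) /
          ∏ v, ((torusTile n τ i v).factorial : ℝ)) ^ k i / (k i).factorial := by
    intro k hk
    have hc' : c = ∏ i, (Sum.elim (fun _ => (K : ℝ))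
        (fun _ => (K : ℝ) * ((τ.card - 1).factorial : ℝ)) i) ^ k i := by
      rw [Fintype.prod_sum_type]
      simp only [Sum.elim_inl, Sum.elim_inr]
      rw [Finset.prod_pow_eq_pow_sum, Finset.prod_pow_eq_pow_sum, mul_pow, hS k hk, hcdef,
        ← sum_eq_K h hc hk, Fintype.sum_sum_type, hS k hk, pow_add]
      ring
    unfold poissonMass
    rw [hc', ← Finset.prod_mul_distrib]
    refine Finset.prod_congr rfl fun i _ => ?_
    rw [← mul_div_assoc, ← mul_pow]
    congr 2
    rcases i with a | a
    · rw [h.torusWeight_inl, h.prod_factorial_inl]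
      simp [torusMean]
    · rw [h.torusWeight_inr, Embeds.prod_factorial_inr]
      have : ((τ.card - 1).factorial : ℝ) ≠ 0 := by positivity
      simp only [torusMean, Sum.elim_inr]
      field_simp
  have e1 : ∀ F' : ((ZMod n × ZMod n) ⊕ (ZMod n × ZMod n) → ℕ) → ℝ,
      ∑ k ∈ torusConfigs n τ N N₀, poissonMass (torusMean n K w w₀) k * F' k
        = c * ∑ k ∈ torusConfigs n τ N N₀,
          (∏ i, (torusWeight n τ w w₀ (torusTile n τ i) /
          ∏ v, ((torusTile n τ i v).factorial : ℝ)) ^ k i / (k i).factorial) * F' k := by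
    intro F'
    rw [Finset.mul_sum]
    refine Finset.sum_congr rfl fun k hk => ?_
    rw [hmass k hk, mul_assoc]
  have hP := hsum (fun _ => 1)
  simp only [mul_one] at hP
  have e2 := e1 (fun _ => 1)
  simp only [mul_one] at e2
  unfold expect partitionFn condExp
  rw [torusTiles_eq, hsum F, hP, e1, e2]
  rw [mul_div_mul_left _ _ hc0, mul_div_mul_left]
  exact Finset.prod_ne_zero_iff.2 fun v _ => by positivity

end TorusCritical

end TorusTiles

/-! ### Lattice points near the mean, and translation invariance -/

section TorusLaw

variable {n : ℕ} [NeZero n] {τ : Finset (ℤ × ℤ)}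

/-- A function on a finite type with prescribed sum `m` and values within `1` of the average. -/
theorem exists_balanced {G : Type} [Fintype G] [Nonempty G] (m : ℕ) (μ : ℝ)
    (hμ : (Fintype.card G : ℝ) * μ = m) :
    ∃ x : G → ℕ, ∑ a, x a = m ∧ ∀ a, |(x a : ℝ) - μ| ≤ 1 := by
  classical
  have hG : 0 < Fintype.card G := Fintype.card_pos
  have hr : m % Fintype.card G < Fintype.card G := Nat.mod_lt _ hG
  obtain ⟨S, -, hS⟩ := Finset.exists_subset_card_eq
    (s := (Finset.univ : Finset G)) (n := m % Fintype.card G) (by rw [Finset.card_univ]; exact hr.le)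
  refine ⟨fun a => m / Fintype.card G + if a ∈ S then 1 else 0, ?_, fun a => ?_⟩
  · rw [Finset.sum_add_distrib]
    simp only [Finset.sum_const, Finset.card_univ, smul_eq_mul, Finset.sum_ite_mem,
      Finset.univ_inter, mul_one, hS]
    exact Nat.div_add_mod m _
  · have h1 : (Fintype.card G : ℝ) * ((m / Fintype.card G : ℕ) : ℝ) + ((m % Fintype.card G : ℕ) : ℝ)
        = m := by exact_mod_cast Nat.div_add_mod m (Fintype.card G)
    have hG' : (0 : ℝ) < Fintype.card G := by exact_mod_cast hG
    have hr' : ((m % Fintype.card G : ℕ) : ℝ) < Fintype.card G := by exact_mod_cast hr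
    have hr0 : (0 : ℝ) ≤ ((m % Fintype.card G : ℕ) : ℝ) := Nat.cast_nonneg _
    have h2 : μ = ((m / Fintype.card G : ℕ) : ℝ)
        + ((m % Fintype.card G : ℕ) : ℝ) / (Fintype.card G : ℝ) := by
      field_simp
      linarith
    have h3 : ((m % Fintype.card G : ℕ) : ℝ) / (Fintype.card G : ℝ) ≤ 1 := by
      rw [div_le_one hG']; exact hr'.le
    have h4 : 0 ≤ ((m % Fintype.card G : ℕ) : ℝ) / (Fintype.card G : ℝ) := by positivity
    rw [h2, abs_le]
    push_cast
    split_ifs <;> constructor <;> linarith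

namespace TorusCritical

variable {N N₀ K : ℕ} {w w₀ : ℝ} (h : Embeds n τ) (hc : TorusCritical n τ N N₀ K w w₀)

include h hc

theorem configs_nonempty : (torusConfigs n τ N N₀).Nonempty := by
  have h2 := h.two_le
  obtain ⟨kf, hkf⟩ := hc.feasible
  refine ⟨fun i => kf (torusTile n τ i), (mem_torusConfigs (by omega)).2 fun v => ?_⟩
  rw [hkf, torusTiles_eq, Finset.sum_image fun a _ b _ hab => h.torusTile_injective hab]

/-- A configuration near the mean: the translates are distributed evenly, and the singletons fill
what is left. -/
theorem nearCritical {c : ℝ} (hcw : c ≤ w) (hcw₀ : c ≤ w₀) (hbig : (τ.card : ℝ) ≤ K * w₀) :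
    NearCritical c (τ.card + 1) K (torusMean n K w w₀) (torusConfigs n τ N N₀) := by
  have h2 := h.two_le
  have hK : (0 : ℝ) < K := by exact_mod_cast hc.K_pos
  have hn1 : (1 : ℝ) ≤ (n : ℝ) ^ 2 := by
    have : 1 ≤ n := Nat.one_le_iff_ne_zero.2 (NeZero.ne n)
    have : (1 : ℝ) ≤ n := by exact_mod_cast this
    nlinarith
  have hws := weight_sum h hc
  have hw := hc.w_pos
  have hw0 := hc.w₀_pos
  refine ⟨?_, ?_, ?_, ?_⟩
  · rintro (a | a)
    · simp only [torusMean, Sum.elim_inl]; nlinarith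
    · simp only [torusMean, Sum.elim_inr]; nlinarith
  · rintro (a | a)
    · simp only [torusMean, Sum.elim_inl]
      exact mul_le_of_le_one_right hK.le (by nlinarith)
    · simp only [torusMean, Sum.elim_inr]
      exact mul_le_of_le_one_right hK.le (by nlinarith)
  · intro k hk i
    rw [← sum_eq_K h hc hk]
    exact Finset.single_le_sum (f := k) (fun _ _ => Nat.zero_le _) (Finset.mem_univ i)
  · obtain ⟨k, hk⟩ := configs_nonempty h hc
    obtain ⟨x, hx, hx1⟩ := exists_balanced (G := ZMod n × ZMod n) (∑ a, k (Sum.inl a)) (K * w) (by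
      rw [sum_inl h hc hk, Fintype.card_prod, ZMod.card]; push_cast; ring)
    have hconv : ∀ v, |∑ c ∈ τ, ((x (v - toTorus n c) : ℝ) - K * w)| ≤ τ.card := by
      intro v
      refine (Finset.abs_sum_le_sum_abs _ _).trans ?_
      refine (Finset.sum_le_sum fun c _ => hx1 (v - toTorus n c)).trans ?_
      simp
    have hN := gauge_some h hc
    have hdev : ∀ v, ((∑ c ∈ τ, x (v - toTorus n c) : ℕ) : ℝ)
        = ∑ c ∈ τ, ((x (v - toTorus n c) : ℝ) - K * w) + τ.card * (K * w) := by
      intro v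
      rw [Finset.sum_sub_distrib, Finset.sum_const, nsmul_eq_mul]
      push_cast; ring
    have hle : ∀ v, ∑ c ∈ τ, x (v - toTorus n c) ≤ N := by
      intro v
      have : ((∑ c ∈ τ, x (v - toTorus n c) : ℕ) : ℝ) ≤ N := by
        rw [hdev, ← hN]
        have := (abs_le.1 (hconv v)).2
        nlinarith
      exact_mod_cast this
    refine ⟨Sum.elim x fun v => N - ∑ c ∈ τ, x (v - toTorus n c), ?_, ?_⟩
    · rw [mem_torusConfigs (by omega)]
      have hkm := (mem_torusConfigs (by omega)).1 hk
      rintro (_ | v)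
      · have e1 := sum_mul_torusTile_none (τ := τ) k
        have e2 := sum_mul_torusTile_none (τ := τ)
          (Sum.elim x fun v => N - ∑ c ∈ τ, x (v - toTorus n c))
        simp only [Nat.cast_id] at e1 e2
        rw [e2, ← hkm none, e1]
        congr 1
        -- both sides equal `n² N - |τ| m`
        have tot : ∀ k' : (ZMod n × ZMod n) ⊕ (ZMod n × ZMod n) → ℕ,
            (∀ v, ∑ c ∈ τ, k' (Sum.inl (v - toTorus n c)) + k' (Sum.inr v) = N) →
            τ.card * ∑ a, k' (Sum.inl a) + ∑ a, k' (Sum.inr a)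
              = ∑ _v : ZMod n × ZMod n, N := by
          intro k' hk'
          rw [Finset.sum_congr rfl fun v _ => (hk' v).symm, Finset.sum_add_distrib,
            Finset.sum_comm]
          congr 1
          rw [← smul_eq_mul, ← Finset.sum_const]
          refine Finset.sum_congr rfl fun c _ => ?_
          exact (Equiv.sum_comp (Equiv.subRight (toTorus n c)) fun a => k' (Sum.inl a)).symm
        have t1 := tot k fun v => by
          have := hkm (some v)
          have e := sum_mul_torusTile_some (τ := τ) k v
          simp only [Nat.cast_id] at e
          rw [e] at this
          exact this
        have t2 := tot (Sum.elim x fun v => N - ∑ c ∈ τ, x (v - toTorus n c)) fun v => by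
          simp only [Sum.elim_inl, Sum.elim_inr]
          have := hle v
          omega
        simp only [Sum.elim_inl, Sum.elim_inr] at t2 ⊢
        rw [hx] at t2
        omega
      · have e2 := sum_mul_torusTile_some (τ := τ)
          (Sum.elim x fun v => N - ∑ c ∈ τ, x (v - toTorus n c)) v
        simp only [Nat.cast_id, Sum.elim_inl, Sum.elim_inr] at e2
        rw [e2]
        have := hle v
        simp only [torusMult]
        omega
    · rintro (a | v)
      · simp only [Sum.elim_inl, torusMean]
        refine (hx1 a).trans ?_
        have : (0 : ℝ) ≤ τ.card := Nat.cast_nonneg _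
        linarith
      · simp only [Sum.elim_inr, torusMean]
        rw [Nat.cast_sub (hle v), hdev, ← hN]
        have : (K : ℝ) * (τ.card * w + w₀) - (∑ c ∈ τ, ((x (v - toTorus n c) : ℝ) - K * w)
            + τ.card * (K * w)) - K * w₀ = -∑ c ∈ τ, ((x (v - toTorus n c) : ℝ) - K * w) := by ring
        rw [this, abs_neg]
        linarith [hconv v]

/-! ### Translation invariance -/

theorem condExp_translate (g : ZMod n × ZMod n)
    (F : ((ZMod n × ZMod n) ⊕ (ZMod n × ZMod n) → ℕ) → ℝ) :
    condExp (torusMean n K w w₀) (torusConfigs n τ N N₀) F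
      = condExp (torusMean n K w w₀) (torusConfigs n τ N N₀)
        (fun k => F (k ∘ Sum.map (· + g) (· + g))) := by
  have h2 := h.two_le
  set σ : (ZMod n × ZMod n) ⊕ (ZMod n × ZMod n) ≃ (ZMod n × ZMod n) ⊕ (ZMod n × ZMod n) :=
    Equiv.sumCongr (Equiv.addRight g) (Equiv.addRight g) with hσ
  have hσc : ⇑σ = Sum.map (· + g) (· + g) := rfl
  have hmem : ∀ g' : ZMod n × ZMod n, ∀ k ∈ torusConfigs n τ N N₀,
      k ∘ Sum.map (· + g') (· + g') ∈ torusConfigs n τ N N₀ := by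
    intro g' k hk
    rw [mem_torusConfigs (by omega)] at hk ⊢
    rintro (_ | v)
    · have e1 := sum_mul_torusTile_none (τ := τ) k
      have e2 := sum_mul_torusTile_none (τ := τ) (k ∘ Sum.map (· + g') (· + g'))
      simp only [Nat.cast_id] at e1 e2
      rw [e2, ← hk none, e1]
      congr 1
      exact Equiv.sum_comp (Equiv.addRight g') fun a => k (Sum.inr a)
    · have e1 := sum_mul_torusTile_some (τ := τ) k (v + g')
      have e2 := sum_mul_torusTile_some (τ := τ) (k ∘ Sum.map (· + g') (· + g')) v
      simp only [Nat.cast_id] at e1 e2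
      rw [e2]
      have := hk (some (v + g'))
      rw [e1] at this
      simp only [torusMult] at this ⊢
      rw [← this]
      simp only [Function.comp, Sum.map_inl, Sum.map_inr]
      congr 1
      refine Finset.sum_congr rfl fun c _ => ?_
      congr 2; ring
  have hmass : ∀ k, poissonMass (torusMean n K w w₀) (k ∘ σ) = poissonMass (torusMean n K w w₀) k := by
    intro k
    unfold poissonMass
    rw [← σ.prod_comp fun i => torusMean n K w w₀ i ^ k i / (k i).factorial]
    refine Finset.prod_congr rfl fun i _ => ?_
    rcases i with a | a <;> rfl
  unfold condExp
  congr 1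
  symm
  refine Finset.sum_bij' (fun k _ => k ∘ σ) (fun k _ => k ∘ Sum.map (· + -g) (· + -g)) ?_ ?_ ?_ ?_ ?_
  · intro k hk; exact hmem g k hk
  · intro k hk; exact hmem (-g) k hk
  · intro k _
    funext i
    rcases i with a | a <;> simp [hσc]
  · intro k _
    funext i
    rcases i with a | a <;> simp [hσc]
  · intro k _
    rw [hmass]; rfl

theorem condExp_inl (a : ZMod n × ZMod n) :
    condExp (torusMean n K w w₀) (torusConfigs n τ N N₀) (fun k => (k (Sum.inl a) : ℝ)) = K * w := by
  have hpos := torusMean_pos (n := n) hc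
  have e1 : ∀ b, condExp (torusMean n K w w₀) (torusConfigs n τ N N₀)
      (fun k => (k (Sum.inl b) : ℝ)) = condExp (torusMean n K w w₀) (torusConfigs n τ N N₀)
      (fun k => (k (Sum.inl a) : ℝ)) := by
    intro b
    rw [condExp_translate h hc (a - b)]
    simp
  have e2 : ∑ b, condExp (torusMean n K w w₀) (torusConfigs n τ N N₀)
      (fun k => (k (Sum.inl b) : ℝ)) = (n : ℝ) ^ 2 * (K * w) := by
    rw [← condExp_sum, ← condExp_const hpos (configs_nonempty h hc) ((n : ℝ) ^ 2 * (K * w))]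
    refine condExp_congr fun k hk => ?_
    rw [← sum_inl h hc hk]
    push_cast; rfl
  simp_rw [e1] at e2
  rw [Finset.sum_const, Finset.card_univ, Fintype.card_prod, ZMod.card, nsmul_eq_mul] at e2
  have hn : (n : ℝ) ≠ 0 := by exact_mod_cast NeZero.ne n
  push_cast at e2
  refine mul_left_cancel₀ (pow_ne_zero 2 hn) ?_
  rw [← e2]; ring

theorem tileCov_eq (a b : ZMod n × ZMod n) :
    tileCov (torusTiles n τ) (torusWeight n τ w w₀) (torusMult n N N₀)
        (polyTile n τ a) (polyTile n τ b)
      = condExp (torusMean n K w w₀) (torusConfigs n τ N N₀) (fun k =>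
        ((k (Sum.inl a) : ℝ) - K * w) * ((k (Sum.inl b) : ℝ) - K * w)) := by
  have e1 := expect_eq h hc (fun k => (k (Sum.inl a) : ℝ) * (k (Sum.inl b) : ℝ))
  have e2 := expect_eq h hc (fun k => (k (Sum.inl a) : ℝ))
  have e3 := expect_eq h hc (fun k => (k (Sum.inl b) : ℝ))
  rw [condExp_inl h hc] at e2 e3
  unfold tileCov
  have hp : ∀ a, polyTile n τ a = torusTile n τ (Sum.inl a) := fun a => rfl
  rw [hp a, hp b, e1, e2, e3]
  have hpos := torusMean_pos (n := n) hc
  have : (fun k : (ZMod n × ZMod n) ⊕ (ZMod n × ZMod n) → ℕ =>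
      ((k (Sum.inl a) : ℝ) - K * w) * ((k (Sum.inl b) : ℝ) - K * w))
      = fun k => ((k (Sum.inl a) : ℝ) * (k (Sum.inl b) : ℝ) - (K * w) * (k (Sum.inl a) : ℝ))
        - ((K * w) * (k (Sum.inl b) : ℝ) - (K * w) * (K * w)) := by
    funext k; ring
  rw [this, condExp_sub, condExp_sub, condExp_sub, condExp_const_mul, condExp_const_mul,
    condExp_inl h hc, condExp_inl h hc, condExp_const hpos (configs_nonempty h hc)]
  ring

end TorusCritical

end TorusLaw

/-! ### Fourier analysis on the torus -/

section TorusFourier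

variable {n : ℕ} [NeZero n] {τ : Finset (ℤ × ℤ)}

/-- The character of the torus with frequency `ξ`. -/
def torusChar (ξ a : ZMod n × ZMod n) : ℂ :=
  ZMod.stdAddChar (ξ.1 * a.1) * ZMod.stdAddChar (ξ.2 * a.2)

theorem torusChar_add (ξ a b : ZMod n × ZMod n) :
    torusChar ξ (a + b) = torusChar ξ a * torusChar ξ b := by
  simp only [torusChar, Prod.fst_add, Prod.snd_add, mul_add, AddChar.map_add_eq_mul]
  ring

theorem torusChar_zero (ξ : ZMod n × ZMod n) : torusChar ξ 0 = 1 := by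
  simp [torusChar]

theorem torusChar_comm (ξ a : ZMod n × ZMod n) : torusChar ξ a = torusChar a ξ := by
  simp [torusChar, mul_comm]

theorem torusChar_neg (ξ a : ZMod n × ZMod n) :
    torusChar ξ (-a) = (starRingEnd ℂ) (torusChar ξ a) := by
  simp only [torusChar, Prod.fst_neg, Prod.snd_neg, mul_neg, map_mul, AddChar.map_neg_eq_conj]

theorem sum_torusChar (ξ : ZMod n × ZMod n) :
    ∑ a, torusChar ξ a = if ξ = 0 then (n : ℂ) ^ 2 else 0 := by
  simp only [torusChar]
  rw [Fintype.sum_prod_type]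
  simp_rw [← Finset.mul_sum]
  rw [← Finset.sum_mul]
  have h : ∀ x : ZMod n, ∑ y : ZMod n, (ZMod.stdAddChar (x * y) : ℂ)
      = if x = 0 then (n : ℂ) else 0 := by
    intro x
    have := AddChar.sum_mulShift x (ZMod.isPrimitive_stdAddChar n)
    simp_rw [mul_comm _ x] at this
    rw [this, ZMod.card]
    split_ifs <;> simp
  rw [h, h]
  rcases ξ with ⟨x, y⟩
  simp only [Prod.mk_eq_zero]
  split_ifs <;> simp_all [pow_two]

variable (n τ) in
/-- The characteristic polynomial at the `n`-th roots of unity with frequency `ξ`. -/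
def torusSymbol (ξ : ZMod n × ZMod n) : ℂ := ∑ c ∈ τ, torusChar ξ (toTorus n c)

variable (n τ) in
/-- The normalized covariance of two translates of `τ` that differ by `e` on the torus of side
`n`. -/
def torusCov (ε : ℝ) (e : ZMod n × ZMod n) : ℂ :=
  1 / (n : ℂ) ^ 2 * ∑ ξ ∈ Finset.univ.erase (0 : ZMod n × ZMod n),
    torusChar ξ e / ((ε + ‖torusSymbol n τ ξ‖ ^ 2 : ℝ) : ℂ)

theorem sum_torusChar_mul_translate (ξ g : ZMod n × ZMod n) (M : ZMod n × ZMod n → ℂ) :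
    ∑ b, torusChar ξ b * M (b + g) = torusChar ξ (-g) * ∑ b, torusChar ξ b * M b := by
  rw [← Equiv.sum_comp (Equiv.addRight g) fun b => torusChar ξ b * M b, Finset.mul_sum]
  refine Finset.sum_congr rfl fun b _ => ?_
  rw [Equiv.coe_addRight, ← mul_assoc, ← torusChar_add, neg_add_eq_sub, add_sub_cancel_right]

theorem sum_torusChar_mul_autocorrelation (ξ : ZMod n × ZMod n) (M : ZMod n × ZMod n → ℂ) :
    ∑ b, torusChar ξ b * ∑ c ∈ τ, ∑ c' ∈ τ, M (b + (toTorus n c - toTorus n c'))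
      = ((‖torusSymbol n τ ξ‖ ^ 2 : ℝ) : ℂ) * ∑ b, torusChar ξ b * M b := by
  simp_rw [Finset.mul_sum]
  rw [Finset.sum_comm]
  simp_rw [Finset.sum_comm (s := Finset.univ), sum_torusChar_mul_translate]
  simp_rw [← Finset.mul_sum, ← Finset.sum_mul]
  congr 1
  push_cast
  rw [← Complex.conj_mul']
  simp only [torusSymbol, map_sum]
  rw [Finset.sum_mul_sum]
  refine Finset.sum_congr rfl fun c _ => Finset.sum_congr rfl fun c' _ => ?_
  rw [← torusChar_neg, ← torusChar_add]
  congr 1; ring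

/-- Fourier inversion at the origin. -/
theorem eq_sum_fourier (M : ZMod n × ZMod n → ℂ) :
    M 0 = 1 / (n : ℂ) ^ 2 * ∑ ξ, ∑ b, torusChar ξ b * M b := by
  rw [Finset.sum_comm]
  simp_rw [← Finset.sum_mul]
  have : ∀ b : ZMod n × ZMod n, ∑ ξ, torusChar ξ b = if b = 0 then (n : ℂ) ^ 2 else 0 := by
    intro b
    rw [← sum_torusChar b]
    exact Finset.sum_congr rfl fun ξ _ => torusChar_comm ξ b
  simp_rw [this, ite_mul, zero_mul]
  rw [Finset.sum_ite_eq']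
  have hn : (n : ℂ) ≠ 0 := by exact_mod_cast NeZero.ne n
  simp
  field_simp

/-! ### The exchange of a translate of `τ` for another one -/

/-- Remove the translate at `a` and the singletons in the translate at `b`. -/
def exchangeSet (n : ℕ) [NeZero n] (τ : Finset (ℤ × ℤ)) (a b : ZMod n × ZMod n) :
    Finset ((ZMod n × ZMod n) ⊕ (ZMod n × ZMod n)) :=
  ({a} : Finset (ZMod n × ZMod n)).disjSum (τ.image fun c => b + toTorus n c)

/-- A translate of `τ` at `a` and the singletons in the translate at `b` cover the same vertices as
a translate at `b` and the singletons in the translate at `a`. -/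
theorem Embeds.exchange (h : Embeds n τ) (N N₀ : ℕ) (a b : ZMod n × ZMod n)
    (m : (ZMod n × ZMod n) ⊕ (ZMod n × ZMod n) → ℕ) :
    m + ind (exchangeSet n τ a b) ∈ torusConfigs n τ N N₀
      ↔ m + ind (exchangeSet n τ b a) ∈ torusConfigs n τ N N₀ := by
  have h2 := h.two_le
  rw [mem_torusConfigs (by omega), mem_torusConfigs (by omega)]
  have key : ∀ v, ∑ i, ind (exchangeSet n τ a b) i * torusTile n τ i v
      = ∑ i, ind (exchangeSet n τ b a) i * torusTile n τ i v := by
    have hcard : ∀ a, (τ.image fun c => a + toTorus n c).card = τ.card := by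
      intro a
      exact Finset.card_image_of_injOn fun c hc c' hc' hcc =>
        h.injOn hc hc' (add_left_cancel hcc)
    rintro (_ | x)
    · have e := fun a b => sum_mul_torusTile_none (τ := τ) (ind (exchangeSet n τ a b))
      simp only [Nat.cast_id] at e
      rw [e, e]
      congr 1
      have : ∀ a b, ∑ x, ind (exchangeSet n τ a b) (Sum.inr x) = τ.card := by
        intro a b
        simp only [ind, exchangeSet, Finset.inr_mem_disjSum]
        rw [Finset.sum_ite_mem, Finset.univ_inter, Finset.sum_const, hcard]; simp
      rw [this, this]
    · have e : ∀ a b, ∑ i, ind (exchangeSet n τ a b) i * torusTile n τ i (some x)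
          = polyTile n τ a (some x) + polyTile n τ b (some x) := by
        intro a b
        have e1 := sum_mul_torusTile_some (τ := τ) (ind (exchangeSet n τ a b)) x
        have e2 := sum_mul_polyTile (τ := τ) (fun y => ind (exchangeSet n τ a b) (Sum.inl y)) x
        simp only [Nat.cast_id] at e1 e2
        have e3 : ∑ y, ind (exchangeSet n τ a b) (Sum.inl y) * polyTile n τ y (some x)
            = polyTile n τ a (some x) := by
          rw [Finset.sum_eq_single a]
          · simp [ind, exchangeSet]
          · intro y _ hy
            simp [ind, exchangeSet, hy]
          · simp
        rw [e1, ← e2, e3, h.polyTile_some_eq b]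
        congr 1
        simp only [ind, exchangeSet, Finset.inr_mem_disjSum]
      rw [e, e, add_comm]
  refine forall_congr' fun v => ?_
  simp only [Pi.add_apply, add_mul, Finset.sum_add_distrib]
  rw [key]

/-- The linearized exchange in terms of the covariances `M` of translates alone: the singletons are
eliminated by the covering constraint, which produces the autocorrelation of `τ`. -/
theorem TorusCritical.exchange_linear {N N₀ K : ℕ} {w w₀ : ℝ} (h : Embeds n τ)
    (hc : TorusCritical n τ N N₀ K w w₀) (a b e : ZMod n × ZMod n)
    (M : ZMod n × ZMod n → ℝ)
    (hMx : ∀ x, M x = condExp (torusMean n K w w₀) (torusConfigs n τ N N₀) (fun k =>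
      ((k (Sum.inl x) : ℝ) - K * w) * ((k (Sum.inl e) : ℝ) - K * w))) :
    condExp (torusMean n K w w₀) (torusConfigs n τ N N₀) (fun k =>
        (∑ i ∈ exchangeSet n τ b a, ((k i : ℝ) - torusMean n K w w₀ i) / torusMean n K w w₀ i
          - ∑ i ∈ exchangeSet n τ a b, ((k i : ℝ) - torusMean n K w w₀ i) / torusMean n K w w₀ i)
          * ((k (Sum.inl e) : ℝ) - torusMean n K w w₀ (Sum.inl e)))
      = (1 / (K * w) * M b + 1 / (K * w₀) *
            ∑ c ∈ τ, ∑ c' ∈ τ, M (b + (toTorus n c - toTorus n c')))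
          - (1 / (K * w) * M a + 1 / (K * w₀) *
            ∑ c ∈ τ, ∑ c' ∈ τ, M (a + (toTorus n c - toTorus n c'))) := by
  have hM : ∀ x, 1 / (K * w) * M x + 1 / (K * w₀) *
      ∑ c ∈ τ, ∑ c' ∈ τ, M (x + (toTorus n c - toTorus n c'))
      = condExp (torusMean n K w w₀) (torusConfigs n τ N N₀) (fun k =>
        1 / (K * w) * (((k (Sum.inl x) : ℝ) - K * w) * ((k (Sum.inl e) : ℝ) - K * w)) +
        1 / (K * w₀) * ∑ c ∈ τ, ∑ c' ∈ τ,
          ((k (Sum.inl (x + (toTorus n c - toTorus n c'))) : ℝ) - K * w) *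
            ((k (Sum.inl e) : ℝ) - K * w)) := by
    intro x
    rw [condExp_add, condExp_const_mul, condExp_const_mul, condExp_sum]
    simp_rw [condExp_sum, hMx]
  rw [hM, hM, ← condExp_sub]
  refine condExp_congr fun k hk => ?_
  have hS : ∀ a b, ∑ i ∈ exchangeSet n τ a b,
      ((k i : ℝ) - torusMean n K w w₀ i) / torusMean n K w w₀ i
      = 1 / (K * w) * ((k (Sum.inl a) : ℝ) - K * w) - 1 / (K * w₀) *
        ∑ c ∈ τ, ∑ c' ∈ τ, ((k (Sum.inl (b + (toTorus n c - toTorus n c'))) : ℝ) - K * w) := by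
    intro a b
    unfold exchangeSet
    rw [Finset.sum_disjSum, Finset.sum_singleton, Finset.sum_image fun c hc c' hc' hcc =>
        h.injOn hc hc' (add_left_cancel hcc)]
    simp only [torusMean, Sum.elim_inl, Sum.elim_inr]
    rw [Finset.mul_sum, sub_eq_add_neg (1 / ((K : ℝ) * w) * _), ← Finset.sum_neg_distrib]
    congr 1
    · ring
    · refine Finset.sum_congr rfl fun c _ => ?_
      rw [TorusCritical.dev_inr h hc hk]
      have : ∀ c' : ℤ × ℤ, b + toTorus n c - toTorus n c' = b + (toTorus n c - toTorus n c') :=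
        fun c' => add_sub_assoc _ _ _
      simp_rw [this]
      ring
  rw [hS, hS]
  simp only [torusMean, Sum.elim_inl]
  simp_rw [← Finset.sum_mul]
  ring

/-- The limit of the normalized covariances on a fixed torus, found by diagonalizing the linear
equations of `tendsto_condExp_linear` by characters. -/
theorem hasTorusCov (h : Embeds n τ) {ε : ℝ} (hε : 0 < ε) (s t : ℤ) :
    HasTorusCov n τ ε s t (torusCov n τ ε (toTorus n (s, t))).re := by
  intro N N₀ K w w₀ hN hfeas hsize hw hw₀ hgauge hratio
  have hnpos : (0 : ℝ) < n := by exact_mod_cast Nat.pos_of_ne_zero (NeZero.ne n)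
  set e := toTorus n (s, t) with he
  -- the number of tiles tends to infinity
  have hKN : ∀ k, N k ≤ τ.card * K k := by
    intro k
    rw [hsize k]
    exact Finset.single_le_sum (f := torusMult n (N k) (N₀ k)) (fun _ _ => Nat.zero_le _)
      (Finset.mem_univ (some (0, 0)))
  have hK : Tendsto K atTop atTop := by
    rw [tendsto_atTop]
    intro B
    filter_upwards [hN.eventually_gt_atTop (τ.card * B)] with k hk
    have := hKN k
    by_contra hlt
    push Not at hlt
    have : τ.card * K k ≤ τ.card * B := Nat.mul_le_mul_left _ hlt.le
    omega
  have hcrit : ∀ᶠ k in atTop, TorusCritical n τ (N k) (N₀ k) (K k) (w k) (w₀ k) := by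
    filter_upwards [hK.eventually_gt_atTop 0] with k hk
    exact ⟨hk, hfeas k, hsize k, hw k, hw₀ k, hgauge k⟩
  -- the critical weights converge to positive limits
  have hwlim : Tendsto w atTop (𝓝 (1 / ((n : ℝ) ^ 2 * (1 + ε)))) := by
    have h1 : Tendsto (fun k => 1 / ((n : ℝ) ^ 2 * (1 + w₀ k / w k))) atTop
        (𝓝 (1 / ((n : ℝ) ^ 2 * (1 + ε)))) := by
      refine Tendsto.div tendsto_const_nhds ((hratio.const_add 1).const_mul _) ?_
      positivity
    refine h1.congr' ?_
    filter_upwards [hcrit] with k hk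
    have hs := TorusCritical.weight_sum h hk
    have := hw k
    have h3 : (n : ℝ) ^ 2 * (1 + w₀ k / w k) = 1 / w k := by
      field_simp; linear_combination hs
    rw [h3, one_div_one_div]
  have hw₀lim : Tendsto w₀ atTop (𝓝 (ε * (1 / ((n : ℝ) ^ 2 * (1 + ε))))) := by
    refine (hratio.mul hwlim).congr fun k => ?_
    have := (hw k).ne'
    field_simp
  obtain ⟨c, hc0, hcw, hcw₀⟩ : ∃ c : ℝ, 0 < c ∧ c < 1 / ((n : ℝ) ^ 2 * (1 + ε)) ∧
      c < ε * (1 / ((n : ℝ) ^ 2 * (1 + ε))) := by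
    have p1 : 0 < 1 / ((n : ℝ) ^ 2 * (1 + ε)) := by positivity
    have p2 : 0 < ε * (1 / ((n : ℝ) ^ 2 * (1 + ε))) := by positivity
    obtain ⟨c, hc1, hc2⟩ := exists_between (lt_min p1 p2)
    exact ⟨c, hc1, hc2.trans_le (min_le_left _ _), hc2.trans_le (min_le_right _ _)⟩
  have hKr : Tendsto (fun k => (K k : ℝ)) atTop atTop := tendsto_natCast_atTop_atTop.comp hK
  have hnear : ∀ᶠ k in atTop, NearCritical c (τ.card + 1) (K k)
      (torusMean n (K k) (w k) (w₀ k)) (torusConfigs n τ (N k) (N₀ k)) := by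
    filter_upwards [hcrit, hwlim.eventually_const_lt hcw, hw₀lim.eventually_const_lt hcw₀,
      (hKr.const_mul_atTop hc0).eventually_ge_atTop (τ.card : ℝ)] with k hk h1 h2 h3
    refine TorusCritical.nearCritical h hk h1.le h2.le (h3.trans ?_)
    rw [mul_comm]
    gcongr
  set M : ℕ → ZMod n × ZMod n → ℝ := fun k x =>
    condExp (torusMean n (K k) (w k) (w₀ k)) (torusConfigs n τ (N k) (N₀ k)) (fun m =>
      ((m (Sum.inl x) : ℝ) - K k * w k) * ((m (Sum.inl e) : ℝ) - K k * w k)) with hM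
  set H : ℕ → ZMod n × ZMod n → ℝ := fun k x => 1 / (K k * w k) * M k x + 1 / (K k * w₀ k) *
    ∑ c ∈ τ, ∑ c' ∈ τ, M k (x + (toTorus n c - toTorus n c')) with hH
  have hlin : ∀ b, Tendsto (fun k => H k b - H k 0) atTop
      (𝓝 ((if e = b then 1 else 0) - (if e = 0 then 1 else 0))) := by
    intro b
    have := tendsto_condExp_linear hc0 hK hnear (D := exchangeSet n τ 0 b)
      (U := exchangeSet n τ b 0) (Eventually.of_forall fun k m => h.exchange _ _ 0 b m) (Sum.inl e)
    have hlim : ((ind (exchangeSet n τ b 0) (Sum.inl e) : ℝ)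
        - (ind (exchangeSet n τ 0 b) (Sum.inl e) : ℝ))
        = (if e = b then 1 else 0) - (if e = 0 then 1 else 0) := by
      simp [ind, exchangeSet]
    rw [hlim] at this
    refine this.congr' ?_
    filter_upwards [hcrit] with k hk
    exact TorusCritical.exchange_linear h hk 0 b e (M k) fun x => rfl
  -- the equations hold up to a constant in `b`, so they determine the Fourier coefficients at
  -- `ξ ≠ 0`; the one at `0` vanishes because the number of translates is fixed
  set Mhat : ℕ → ZMod n × ZMod n → ℂ := fun k ξ => ∑ b, torusChar ξ b * (M k b : ℂ) with hMhat
  have hhat0 : ∀ᶠ k in atTop, Mhat k 0 = 0 := by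
    filter_upwards [hcrit] with k hk
    have e0 : ∀ b : ZMod n × ZMod n, torusChar 0 b = 1 := fun b => by
      rw [torusChar_comm, torusChar_zero]
    simp only [hMhat, e0, one_mul]
    have : ∑ b, M k b = 0 := by
      simp only [hM]
      rw [← condExp_sum, ← condExp_const (TorusCritical.torusMean_pos hk)
        (TorusCritical.configs_nonempty h hk) 0]
      refine condExp_congr fun m hm => ?_
      rw [← Finset.sum_mul, Finset.sum_sub_distrib]
      have := TorusCritical.sum_inl h hk hm
      push_cast at this
      rw [this]
      simp only [Finset.sum_const, Finset.card_univ, Fintype.card_prod, ZMod.card, nsmul_eq_mul]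
      push_cast
      ring
    exact_mod_cast this
  have hhat : ∀ ξ, ξ ≠ 0 → Tendsto (fun k => Mhat k ξ / ((K k * w₀ k : ℝ) : ℂ)) atTop
      (𝓝 (torusChar ξ e / ((ε + ‖torusSymbol n τ ξ‖ ^ 2 : ℝ) : ℂ))) := by
    intro ξ hξ
    have hsum0 : ∑ b, torusChar ξ b = 0 := by rw [sum_torusChar, if_neg hξ]
    have h1 : Tendsto (fun k => ∑ b, torusChar ξ b * ((H k b - H k 0 : ℝ) : ℂ)) atTop
        (𝓝 (∑ b, torusChar ξ b *
          (((if e = b then 1 else 0) - (if e = 0 then 1 else 0) : ℝ) : ℂ))) :=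
      tendsto_finsetSum _ fun b _ => ((Complex.continuous_ofReal.tendsto _).comp (hlin b)).const_mul _
    have h2 : ∑ b, torusChar ξ b *
          (((if e = b then 1 else 0) - (if e = 0 then 1 else 0) : ℝ) : ℂ) = torusChar ξ e := by
      have hcast : ∀ x, (((if e = x then 1 else 0) : ℝ) : ℂ) = if e = x then 1 else 0 := by
        intro x; split_ifs <;> simp
      simp_rw [Complex.ofReal_sub, mul_sub]
      rw [Finset.sum_sub_distrib, ← Finset.sum_mul, hsum0]
      simp_rw [hcast]
      simp
    have h3 : ∀ k, ∑ b, torusChar ξ b * ((H k b - H k 0 : ℝ) : ℂ)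
        = (((w₀ k / w k + ‖torusSymbol n τ ξ‖ ^ 2 : ℝ)) : ℂ) *
          (Mhat k ξ / ((K k * w₀ k : ℝ) : ℂ)) := by
      intro k
      have e1 : ∑ b, torusChar ξ b * ((H k b - H k 0 : ℝ) : ℂ) = ∑ b, torusChar ξ b * (H k b : ℂ) := by
        push_cast
        simp_rw [mul_sub]
        rw [Finset.sum_sub_distrib, ← Finset.sum_mul, hsum0]
        simp
      have e2 : ∑ b, torusChar ξ b * (H k b : ℂ) = 1 / (K k * w k : ℂ) * Mhat k ξ
          + 1 / (K k * w₀ k : ℂ) * (((‖torusSymbol n τ ξ‖ ^ 2 : ℝ) : ℂ) * Mhat k ξ) := by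
        simp only [hMhat]
        rw [← sum_torusChar_mul_autocorrelation, Finset.mul_sum, Finset.mul_sum,
          ← Finset.sum_add_distrib]
        refine Finset.sum_congr rfl fun b _ => ?_
        simp only [hH]
        push_cast
        ring
      rw [e1, e2]
      have p1 : (w k : ℂ) ≠ 0 := by exact_mod_cast (hw k).ne'
      have p2 : (w₀ k : ℂ) ≠ 0 := by exact_mod_cast (hw₀ k).ne'
      rcases eq_or_ne (K k) 0 with h0 | h0
      · simp [h0]
      · have p3 : (K k : ℂ) ≠ 0 := by exact_mod_cast h0
        push_cast
        field_simp
    rw [h2] at h1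
    have h4 : Tendsto (fun k => (((w₀ k / w k + ‖torusSymbol n τ ξ‖ ^ 2 : ℝ)) : ℂ)) atTop
        (𝓝 ((ε + ‖torusSymbol n τ ξ‖ ^ 2 : ℝ) : ℂ)) :=
      (Complex.continuous_ofReal.tendsto _).comp (hratio.add_const _)
    have h5 : ((ε + ‖torusSymbol n τ ξ‖ ^ 2 : ℝ) : ℂ) ≠ 0 := by
      have : 0 < ε + ‖torusSymbol n τ ξ‖ ^ 2 := by positivity
      exact_mod_cast this.ne'
    refine (h1.div h4 h5).congr fun k => ?_
    simp only [Pi.div_apply]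
    rw [h3, mul_div_cancel_left₀]
    have : 0 < w₀ k / w k + ‖torusSymbol n τ ξ‖ ^ 2 := by
      have := hw k; have := hw₀ k; positivity
    exact_mod_cast this.ne'
  have hfin : Tendsto (fun k => ((M k 0 / (K k * w₀ k) : ℝ) : ℂ)) atTop (𝓝 (torusCov n τ ε e)) := by
    have h1 := (tendsto_finsetSum (Finset.univ.erase (0 : ZMod n × ZMod n)) fun ξ hξ =>
      hhat ξ (Finset.ne_of_mem_erase hξ)).const_mul (1 / (n : ℂ) ^ 2)
    refine h1.congr' ?_
    filter_upwards [hhat0] with k hk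
    push_cast
    rw [eq_sum_fourier fun x => (M k x : ℂ), ← Finset.add_sum_erase _ _ (Finset.mem_univ 0)]
    change _ = 1 / (n : ℂ) ^ 2 * (Mhat k 0 + _) / _
    rw [hk, zero_add, mul_div_assoc, Finset.sum_div]
  have hre := (Complex.continuous_re.tendsto _).comp hfin
  refine hre.congr' ?_
  filter_upwards [hcrit] with k hk
  simp only [Function.comp, Complex.ofReal_re]
  rw [TorusCritical.tileCov_eq h hk]
  rfl

theorem torusCov_im (ε : ℝ) (e : ZMod n × ZMod n) : (torusCov n τ ε e).im = 0 := by
  rw [← Complex.conj_eq_iff_im]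
  have hneg : ∀ ξ a : ZMod n × ZMod n, (starRingEnd ℂ) (torusChar ξ a) = torusChar (-ξ) a := by
    intro ξ a
    rw [torusChar_comm (-ξ) a, torusChar_neg, torusChar_comm]
  have hsym : ∀ ξ : ZMod n × ZMod n, ‖torusSymbol n τ (-ξ)‖ = ‖torusSymbol n τ ξ‖ := by
    intro ξ
    rw [← Complex.norm_conj (torusSymbol n τ ξ)]
    simp only [torusSymbol, map_sum, hneg]
  simp only [torusCov, map_mul, map_sum, map_div₀, map_one, map_pow, map_natCast, hneg,
    Complex.conj_ofReal]
  congr 1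
  refine Finset.sum_bij' (fun ξ _ => -ξ) (fun ξ _ => -ξ) ?_ ?_ ?_ ?_ ?_
  · intro ξ hξ; simpa using hξ
  · intro ξ hξ; simpa using hξ
  · simp
  · simp
  · intro ξ _
    rw [hsym]

end TorusFourier

/-! ### Large tori and Riemann sums -/

section LargeTorus

theorem intCast_zmod_injOn {n : ℕ} {B : ℤ} (hB : B < n) {x y : ℤ} (hxy : |x - y| ≤ B)
    (h : (x : ZMod n) = (y : ZMod n)) : x = y := by
  rw [ZMod.intCast_eq_intCast_iff_dvd_sub] at h
  have := Int.eq_zero_of_abs_lt_dvd h (by rw [abs_sub_comm]; omega)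
  omega

/-- A finite set of lattice points has no periods on a torus that is large enough: the
translation would act on it by one fixed integer vector, and so change its center of mass. -/
theorem eventually_embeds {τ : Finset (ℤ × ℤ)} (hτ : 2 ≤ τ.card) :
    ∀ᶠ n : ℕ in atTop, ∀ _ : NeZero n, Embeds n τ := by
  obtain ⟨B, hB⟩ : ∃ B : ℤ, ∀ c ∈ τ, |c.1| ≤ B ∧ |c.2| ≤ B := by
    refine ⟨∑ c ∈ τ, (|c.1| + |c.2|), fun c hc => ?_⟩
    have := Finset.single_le_sum (f := fun c : ℤ × ℤ => |c.1| + |c.2|)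
      (fun c _ => by positivity) hc
    have h1 := abs_nonneg c.1
    have h2 := abs_nonneg c.2
    constructor <;> linarith
  filter_upwards [eventually_gt_atTop (4 * B).toNat] with n hn _
  have hn4 : 4 * B < n := by omega
  have hdist : ∀ c ∈ τ, ∀ c' ∈ τ, |c.1 - c'.1| ≤ 2 * B ∧ |c.2 - c'.2| ≤ 2 * B := by
    intro c hc c' hc'
    have h1 := hB c hc
    have h2 := hB c' hc'
    simp only [abs_le] at h1 h2 ⊢
    omega
  have hB0 : 0 ≤ B := by
    obtain ⟨c, hc⟩ := Finset.card_pos.1 (by omega : 0 < τ.card)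
    exact (abs_nonneg _).trans (hB c hc).1
  have hinj : Set.InjOn (toTorus n) (τ : Set (ℤ × ℤ)) := by
    intro c hc c' hc' hcc
    have h := hdist c hc c' hc'
    have h1 := congrArg Prod.fst hcc
    have h2 := congrArg Prod.snd hcc
    exact Prod.ext (intCast_zmod_injOn (by omega) h.1 h1) (intCast_zmod_injOn (by omega) h.2 h2)
  refine ⟨hτ, hinj, fun a b hab => ?_⟩
  have hex : ∀ c ∈ τ, ∃ c' ∈ τ, a + toTorus n c = b + toTorus n c' := by
    intro c hc
    have h1 : 0 < polyTile n τ a (some (a + toTorus n c)) := by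
      rw [polyTile_some, Finset.card_pos]
      exact ⟨c, by simp [hc]⟩
    rw [hab, polyTile_some, Finset.card_pos] at h1
    obtain ⟨c', hc'⟩ := h1
    rw [Finset.mem_filter] at hc'
    exact ⟨c', hc'.1, hc'.2.symm⟩
  choose! f hfτ hf using hex
  have hfinj : Set.InjOn f τ := by
    intro c hc c' hc' hcc
    refine hinj hc hc' ?_
    have h1 := hf c hc
    have h2 := hf c' hc'
    rw [hcc, ← h2] at h1
    exact add_left_cancel h1
  have himg : τ.image f = τ := by
    refine Finset.eq_of_subset_of_card_le (fun x hx => ?_) ?_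
    · obtain ⟨c, hc, rfl⟩ := Finset.mem_image.1 hx
      exact hfτ c hc
    · rw [Finset.card_image_of_injOn hfinj]
  obtain ⟨c₀, hc₀⟩ := Finset.card_pos.1 (by omega : 0 < τ.card)
  have hshift : ∀ c ∈ τ, f c - c = f c₀ - c₀ := by
    intro c hc
    have h1 : toTorus n c + toTorus n (f c₀) = toTorus n c₀ + toTorus n (f c) := by
      have e1 := hf c hc
      have e2 := hf c₀ hc₀
      have : a - b = toTorus n (f c) - toTorus n c := by
        rw [sub_eq_sub_iff_add_eq_add, e1, add_comm]
      have h' : a - b = toTorus n (f c₀) - toTorus n c₀ := by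
        rw [sub_eq_sub_iff_add_eq_add, e2, add_comm]
      rw [this, sub_eq_sub_iff_add_eq_add] at h'
      rw [add_comm, ← h', add_comm]
    have d1 := hdist (f c) (hfτ c hc) c hc
    have d2 := hdist (f c₀) (hfτ c₀ hc₀) c₀ hc₀
    simp only [abs_le] at d1 d2
    have h11 := congrArg Prod.fst h1
    have h12 := congrArg Prod.snd h1
    simp only [toTorus, Prod.fst_add, Prod.snd_add] at h11 h12
    have k1 : c.1 + (f c₀).1 = c₀.1 + (f c).1 :=
      intCast_zmod_injOn hn4 (by rw [abs_le]; omega) (by push_cast; exact h11)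
    have k2 : c.2 + (f c₀).2 = c₀.2 + (f c).2 :=
      intCast_zmod_injOn hn4 (by rw [abs_le]; omega) (by push_cast; exact h12)
    ext
    · simp only [Prod.fst_sub]; omega
    · simp only [Prod.snd_sub]; omega
  have hsum : ∑ c ∈ τ, (f c - c) = 0 := by
    rw [Finset.sum_sub_distrib, ← Finset.sum_image (f := fun x => x) hfinj, himg, sub_self]
  rw [Finset.sum_congr rfl hshift, Finset.sum_const] at hsum
  have h0 : f c₀ - c₀ = 0 := by
    have hc : (τ.card : ℤ) ≠ 0 := by omega
    have g1 := congrArg Prod.fst hsum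
    have g2 := congrArg Prod.snd hsum
    simp only [nsmul_eq_mul, Prod.fst_zero] at g1
    simp only [nsmul_eq_mul, Prod.snd_zero] at g2
    exact Prod.ext ((mul_eq_zero.1 g1).resolve_left hc) ((mul_eq_zero.1 g2).resolve_left hc)
  have := hf c₀ hc₀
  rw [sub_eq_zero.1 h0] at this
  exact add_right_cancel this

end LargeTorus

section RiemannSum

theorem norm_riemannSum_sub_integral_le {g : ℝ → ℂ} (hg : Continuous g) {n : ℕ} (hn : 0 < n)
    {η : ℝ} (hη : ∀ j < n, ∀ x ∈ Set.Icc ((j : ℝ) / n) ((j + 1 : ℝ) / n), ‖g x - g (j / n)‖ ≤ η) :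
    ‖1 / (n : ℂ) * ∑ j ∈ Finset.range n, g (j / n) - ∫ x in (0 : ℝ)..1, g x‖ ≤ η := by
  have hn0 : (0 : ℝ) < n := by exact_mod_cast hn
  have hsplit : ∫ x in (0 : ℝ)..1, g x
      = ∑ j ∈ Finset.range n, ∫ x in ((j : ℝ) / n)..((j + 1 : ℝ) / n), g x := by
    have := intervalIntegral.sum_integral_adjacent_intervals (μ := MeasureTheory.volume) (f := g)
      (a := fun j : ℕ => (j : ℝ) / n) (n := n) fun k _ => hg.intervalIntegrable _ _
    simp only [Nat.cast_zero, zero_div, div_self hn0.ne'] at this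
    rw [← this]
    push_cast; rfl
  have hconst : 1 / (n : ℂ) * ∑ j ∈ Finset.range n, g (j / n)
      = ∑ j ∈ Finset.range n, ∫ _x in ((j : ℝ) / n)..((j + 1 : ℝ) / n), g (j / n) := by
    rw [Finset.mul_sum]
    refine Finset.sum_congr rfl fun j _ => ?_
    rw [intervalIntegral.integral_const]
    have : (j + 1 : ℝ) / n - j / n = 1 / n := by ring
    rw [this, Complex.real_smul]
    push_cast; rfl
  rw [hconst, hsplit, ← Finset.sum_sub_distrib]
  calc _ ≤ ∑ j ∈ Finset.range n, η * (1 / n) := by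
        refine (norm_sum_le _ _).trans (Finset.sum_le_sum fun j hj => ?_)
        rw [← intervalIntegral.integral_sub (by simp) (hg.intervalIntegrable _ _)]
        have hle : (j : ℝ) / n ≤ (j + 1) / n := by gcongr; linarith
        have := intervalIntegral.norm_integral_le_of_norm_le_const (a := (j : ℝ) / n)
          (b := (j + 1 : ℝ) / n) (C := η) (f := fun x => g (j / n) - g x) (by
            intro x hx
            rw [Set.uIoc_of_le hle] at hx
            rw [norm_sub_rev]
            exact hη j (Finset.mem_range.1 hj) x ⟨hx.1.le, hx.2⟩)
        have e : (j + 1 : ℝ) / n - j / n = 1 / n := by ring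
        rwa [e, abs_of_pos (by positivity)] at this
    _ = η := by
        rw [Finset.sum_const, Finset.card_range, nsmul_eq_mul]; field_simp

theorem tendsto_riemannSum_square {F : ℝ → ℝ → ℂ} (hF : Continuous (Function.uncurry F)) :
    Tendsto (fun n : ℕ => 1 / (n : ℂ) ^ 2 *
        ∑ j ∈ Finset.range n, ∑ k ∈ Finset.range n, F (j / n) (k / n)) atTop
      (𝓝 (∫ x in (0 : ℝ)..1, ∫ y in (0 : ℝ)..1, F x y)) := by
  rw [Metric.tendsto_atTop]
  intro η hη
  have hcomp : IsCompact (Set.Icc (0 : ℝ) 1 ×ˢ Set.Icc (0 : ℝ) 1) := isCompact_Icc.prod isCompact_Icc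
  have hunif := hcomp.uniformContinuousOn_of_continuous hF.continuousOn
  rw [Metric.uniformContinuousOn_iff] at hunif
  obtain ⟨δ, hδ, hδF⟩ := hunif (η / 3) (by positivity)
  obtain ⟨n₀, hn₀⟩ := exists_nat_gt (1 / δ)
  refine ⟨n₀ + 1, fun n hn => ?_⟩
  have hn1 : 0 < n := by omega
  have hn0 : (0 : ℝ) < n := by exact_mod_cast hn1
  have hnδ : 1 / (n : ℝ) < δ := by
    rw [one_div_lt hn0 hδ]
    refine hn₀.trans ?_
    exact_mod_cast hn
  have hcell : ∀ j < n, ∀ x ∈ Set.Icc ((j : ℝ) / n) ((j + 1 : ℝ) / n),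
      x ∈ Set.Icc (0 : ℝ) 1 ∧ (j : ℝ) / n ∈ Set.Icc (0 : ℝ) 1 ∧ dist x (j / n) < δ := by
    intro j hj x hx
    have hj1 : ((j : ℝ) + 1) / n ≤ 1 := by
      rw [div_le_one hn0]; exact_mod_cast hj
    have hj0 : (0 : ℝ) ≤ j / n := by positivity
    have e : (j + 1 : ℝ) / n - j / n = 1 / n := by ring
    refine ⟨⟨hj0.trans hx.1, hx.2.trans hj1⟩, ⟨hj0, ?_⟩, ?_⟩
    · exact (hx.1.trans hx.2).trans hj1
    · rw [Real.dist_eq, abs_of_nonneg (by linarith [hx.1])]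
      linarith [hx.2]
  have hG : Continuous fun x => ∫ y in (0 : ℝ)..1, F x y :=
    intervalIntegral.continuous_parametric_intervalIntegral_of_continuous' hF 0 1
  have hFx : ∀ x, Continuous (F x) := fun x => hF.comp (by fun_prop : Continuous fun y => (x, y))
  have hFy : ∀ y, Continuous fun x => F x y :=
    fun y => hF.comp (by fun_prop : Continuous fun x => (x, y))
  have h1 : ∀ j < n, ‖1 / (n : ℂ) * ∑ k ∈ Finset.range n, F (j / n) (k / n)
      - ∫ y in (0 : ℝ)..1, F (j / n) y‖ ≤ η / 3 := by
    intro j hj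
    refine norm_riemannSum_sub_integral_le (hFx _) hn1 fun k hk y hy => ?_
    obtain ⟨hy1, hk1, hd⟩ := hcell k hk y hy
    have hj1 := (hcell j hj (j / n) ⟨le_rfl, by gcongr; linarith⟩).1
    have := hδF (j / n, y) ⟨hj1, hy1⟩ (j / n, k / n) ⟨hj1, hk1⟩ (by
      exact max_lt (by simpa using hδ) hd)
    rw [dist_eq_norm] at this
    exact this.le
  have h2 : ‖1 / (n : ℂ) * ∑ j ∈ Finset.range n, (∫ y in (0 : ℝ)..1, F (j / n) y)
      - ∫ x in (0 : ℝ)..1, ∫ y in (0 : ℝ)..1, F x y‖ ≤ η / 3 := by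
    refine norm_riemannSum_sub_integral_le hG hn1 fun j hj x hx => ?_
    obtain ⟨hx1, hj1, hd⟩ := hcell j hj x hx
    rw [← intervalIntegral.integral_sub ((hFx _).intervalIntegrable _ _)
      ((hFx _).intervalIntegrable _ _)]
    have := intervalIntegral.norm_integral_le_of_norm_le_const (a := (0 : ℝ)) (b := 1)
      (C := η / 3) (f := fun y => F x y - F (j / n) y) (by
        intro y hy
        rw [Set.uIoc_of_le zero_le_one] at hy
        have := hδF (x, y) ⟨hx1, hy.1.le, hy.2⟩ (j / n, y) ⟨hj1, hy.1.le, hy.2⟩ (by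
          exact max_lt hd (by simpa using hδ))
        rw [dist_eq_norm] at this
        exact this.le)
    simpa using this
  rw [dist_eq_norm]
  have hdecomp : 1 / (n : ℂ) ^ 2 * ∑ j ∈ Finset.range n, ∑ k ∈ Finset.range n, F (j / n) (k / n)
      - ∫ x in (0 : ℝ)..1, ∫ y in (0 : ℝ)..1, F x y
      = 1 / (n : ℂ) * ∑ j ∈ Finset.range n, (1 / (n : ℂ) * ∑ k ∈ Finset.range n, F (j / n) (k / n)
        - ∫ y in (0 : ℝ)..1, F (j / n) y)
        + (1 / (n : ℂ) * ∑ j ∈ Finset.range n, (∫ y in (0 : ℝ)..1, F (j / n) y)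
          - ∫ x in (0 : ℝ)..1, ∫ y in (0 : ℝ)..1, F x y) := by
    rw [Finset.sum_sub_distrib, ← Finset.mul_sum]; ring
  rw [hdecomp]
  refine (norm_add_le _ _).trans_lt ?_
  have h3 : ‖1 / (n : ℂ) * ∑ j ∈ Finset.range n, (1 / (n : ℂ) *
      ∑ k ∈ Finset.range n, F (j / n) (k / n) - ∫ y in (0 : ℝ)..1, F (j / n) y)‖ ≤ η / 3 := by
    rw [norm_mul]
    calc _ ≤ ‖1 / (n : ℂ)‖ * ∑ j ∈ Finset.range n, η / 3 := by
          gcongr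
          exact (norm_sum_le _ _).trans (Finset.sum_le_sum fun j hj => h1 j (Finset.mem_range.1 hj))
      _ = η / 3 := by
          rw [Finset.sum_const, Finset.card_range, nsmul_eq_mul]
          simp
          field_simp
  linarith

end RiemannSum

/-! ### The covariance in the plane as a Fourier coefficient -/

section PlaneCov

/-- The character `e^{i(sx+ty)}` of the plane. -/
def planeWave (s t : ℤ) (v : ℝ × ℝ) : ℂ :=
  Complex.exp (Complex.I * ((s : ℂ) * (v.1 : ℂ) + (t : ℂ) * (v.2 : ℂ)))

theorem continuous_planeWave (s t : ℤ) : Continuous (planeWave s t) := by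
  unfold planeWave; fun_prop

theorem norm_planeWave (s t : ℤ) (v : ℝ × ℝ) : ‖planeWave s t v‖ = 1 := by
  unfold planeWave
  have : Complex.I * ((s : ℂ) * (v.1 : ℂ) + (t : ℂ) * (v.2 : ℂ))
      = ((s * v.1 + t * v.2 : ℝ) : ℂ) * Complex.I := by push_cast; ring
  rw [this, Complex.norm_exp_ofReal_mul_I]

theorem planeWave_add (s t : ℤ) (v v' : ℝ × ℝ) :
    planeWave s t (v + v') = planeWave s t v * planeWave s t v' := by
  unfold planeWave
  rw [← Complex.exp_add]
  congr 1
  simp only [Prod.fst_add, Prod.snd_add]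
  push_cast; ring

theorem planeWave_eq_zpow (s t : ℤ) (v : ℝ × ℝ) :
    planeWave s t v = Complex.exp (v.1 * Complex.I) ^ s * Complex.exp (v.2 * Complex.I) ^ t := by
  unfold planeWave
  rw [← Complex.exp_int_mul, ← Complex.exp_int_mul, ← Complex.exp_add]
  congr 1; ring

/-- The characteristic polynomial at `(e^{ix}, e^{iy})`. -/
def planeSymbol (τ : Finset (ℤ × ℤ)) (v : ℝ × ℝ) : ℂ := ∑ c ∈ τ, planeWave c.1 c.2 v

theorem continuous_planeSymbol (τ : Finset (ℤ × ℤ)) : Continuous (planeSymbol τ) :=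
  continuous_finsetSum _ fun c _ => continuous_planeWave c.1 c.2

theorem planeSymbol_eq_charPoly (τ : Finset (ℤ × ℤ)) (v : ℝ × ℝ) :
    planeSymbol τ v = charPoly τ (Complex.exp (v.1 * Complex.I)) (Complex.exp (v.2 * Complex.I)) :=
  Finset.sum_congr rfl fun c _ => planeWave_eq_zpow c.1 c.2 v

/-- The density `e^{i(sx+ty)} / (ε + |p|²)`. -/
def planeDensity (τ : Finset (ℤ × ℤ)) (ε : ℝ) (s t : ℤ) (v : ℝ × ℝ) : ℂ :=
  planeWave s t v / ((ε + ‖planeSymbol τ v‖ ^ 2 : ℝ) : ℂ)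

theorem continuous_planeDensity (τ : Finset (ℤ × ℤ)) {ε : ℝ} (hε : 0 < ε) (s t : ℤ) :
    Continuous (planeDensity τ ε s t) := by
  have h := continuous_planeSymbol τ
  unfold planeDensity
  refine (continuous_planeWave s t).div (by fun_prop) fun v => ?_
  have : 0 < ε + ‖planeSymbol τ v‖ ^ 2 := by positivity
  exact_mod_cast this.ne'

/-- The normalized covariance in the plane, a Fourier coefficient of `1 / (ε + |p|²)`. -/
def planeCov (τ : Finset (ℤ × ℤ)) (ε : ℝ) (s t : ℤ) : ℂ :=
  1 / (2 * (Real.pi : ℂ)) ^ 2 *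
    ∫ x in (0 : ℝ)..2 * Real.pi, ∫ y in (0 : ℝ)..2 * Real.pi, planeDensity τ ε s t (x, y)

theorem planeWave_periodic (s t : ℤ) (v : ℝ × ℝ) :
    planeWave s t (v.1 + 2 * Real.pi, v.2) = planeWave s t v ∧
      planeWave s t (v.1, v.2 + 2 * Real.pi) = planeWave s t v := by
  simp only [planeWave_eq_zpow]
  have h : ∀ x : ℝ, Complex.exp (((x + 2 * Real.pi : ℝ) : ℂ) * Complex.I)
      = Complex.exp (x * Complex.I) := by
    intro x
    push_cast
    rw [add_mul, Complex.exp_periodic]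
  exact ⟨by rw [h], by rw [h]⟩

theorem planeDensity_periodic (τ : Finset (ℤ × ℤ)) (ε : ℝ) (s t : ℤ) (x y : ℝ) :
    planeDensity τ ε s t (x + 2 * Real.pi, y) = planeDensity τ ε s t (x, y) ∧
      planeDensity τ ε s t (x, y + 2 * Real.pi) = planeDensity τ ε s t (x, y) := by
  have h := fun s t => planeWave_periodic s t (x, y)
  simp only at h
  simp only [planeDensity, planeSymbol, (h _ _).1, (h _ _).2, and_self]

/-- The domain of integration can be any square of side `2π`. -/
theorem planeCov_eq_setIntegral (τ : Finset (ℤ × ℤ)) {ε : ℝ} (hε : 0 < ε) (s t : ℤ) (a : ℝ) :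
    planeCov τ ε s t = 1 / (2 * (Real.pi : ℂ)) ^ 2 *
      ∫ v in Set.Ioc a (a + 2 * Real.pi) ×ˢ Set.Ioc a (a + 2 * Real.pi),
        planeDensity τ ε s t v := by
  have hcont := continuous_planeDensity τ hε s t
  have hpi : a ≤ a + 2 * Real.pi := by linarith [Real.pi_pos]
  unfold planeCov
  congr 1
  have h1 : ∀ x, ∫ y in (0 : ℝ)..2 * Real.pi, planeDensity τ ε s t (x, y)
      = ∫ y in a..(a + 2 * Real.pi), planeDensity τ ε s t (x, y) := by
    intro x
    have hper : Function.Periodic (fun y => planeDensity τ ε s t (x, y)) (2 * Real.pi) :=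
      fun y => (planeDensity_periodic τ ε s t x y).2
    have := hper.intervalIntegral_add_eq 0 a
    rwa [zero_add] at this
  simp_rw [h1]
  have hper : Function.Periodic
      (fun x => ∫ y in a..(a + 2 * Real.pi), planeDensity τ ε s t (x, y)) (2 * Real.pi) := by
    intro x
    simp only [(planeDensity_periodic τ ε s t x _).1]
  have := hper.intervalIntegral_add_eq 0 a
  rw [zero_add] at this
  rw [this, MeasureTheory.Measure.volume_eq_prod, MeasureTheory.setIntegral_prod,
    intervalIntegral.integral_of_le hpi]
  · simp_rw [intervalIntegral.integral_of_le hpi]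
  · refine (hcont.continuousOn.integrableOn_compact
      (isCompact_Icc.prod isCompact_Icc)).mono_set
      (Set.prod_mono (Set.Ioc_subset_Icc_self (a := a) (b := a + 2 * Real.pi))
        (Set.Ioc_subset_Icc_self (a := a) (b := a + 2 * Real.pi)))

theorem sum_zmod_eq_sum_range {n : ℕ} [NeZero n] (f : ℕ → ℂ) :
    ∑ x : ZMod n, f x.val = ∑ j ∈ Finset.range n, f j := by
  refine Finset.sum_bij' (fun x _ => x.val) (fun j _ => (j : ZMod n)) ?_ ?_ ?_ ?_ ?_
  · intro x _; exact Finset.mem_range.2 (ZMod.val_lt x)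
  · intro j _; exact Finset.mem_univ _
  · intro x _; exact ZMod.natCast_zmod_val x
  · intro j hj; exact ZMod.val_cast_of_lt (Finset.mem_range.1 hj)
  · intro x _; rfl

theorem torusChar_eq_planeWave {n : ℕ} [NeZero n] (ξ : ZMod n × ZMod n) (c : ℤ × ℤ) :
    torusChar ξ (toTorus n c) = planeWave c.1 c.2
      (2 * Real.pi * (ξ.1.val / n : ℝ), 2 * Real.pi * (ξ.2.val / n : ℝ)) := by
  have h : ∀ (x : ZMod n) (j : ℤ), (ZMod.stdAddChar (x * (j : ZMod n)) : ℂ)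
      = Complex.exp (Complex.I * (j * (2 * Real.pi * (x.val / n)))) := by
    intro x j
    have : x * (j : ZMod n) = (((x.val : ℤ) * j : ℤ) : ZMod n) := by
      push_cast; rw [ZMod.natCast_zmod_val]
    rw [this, ZMod.stdAddChar_coe]
    congr 1
    push_cast; ring
  simp only [torusChar, toTorus, h]
  rw [← Complex.exp_add]
  unfold planeWave
  congr 1
  push_cast; ring

theorem torusCov_eq_riemannSum {n : ℕ} [NeZero n] (τ : Finset (ℤ × ℤ)) (ε : ℝ) (s t : ℤ) :
    torusCov n τ ε (toTorus n (s, t)) = 1 / (n : ℂ) ^ 2 *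
        (∑ j ∈ Finset.range n, ∑ k ∈ Finset.range n,
          planeDensity τ ε s t (2 * Real.pi * (j / n : ℝ), 2 * Real.pi * (k / n : ℝ)))
      - 1 / (n : ℂ) ^ 2 * planeDensity τ ε s t (0, 0) := by
  have h1 : ∀ ξ : ZMod n × ZMod n, torusChar ξ (toTorus n (s, t)) /
      ((ε + ‖torusSymbol n τ ξ‖ ^ 2 : ℝ) : ℂ) = planeDensity τ ε s t
        (2 * Real.pi * (ξ.1.val / n : ℝ), 2 * Real.pi * (ξ.2.val / n : ℝ)) := by
    intro ξ
    simp only [planeDensity, planeSymbol, torusSymbol, torusChar_eq_planeWave]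
  unfold torusCov
  simp_rw [h1]
  rw [← mul_sub]
  congr 1
  rw [eq_sub_iff_add_eq]
  have h2 := Finset.sum_erase_add Finset.univ (fun ξ : ZMod n × ZMod n => planeDensity τ ε s t
        (2 * Real.pi * (ξ.1.val / n : ℝ), 2 * Real.pi * (ξ.2.val / n : ℝ))) (Finset.mem_univ 0)
  simp only [Prod.fst_zero, Prod.snd_zero, ZMod.val_zero, Nat.cast_zero, zero_div, mul_zero] at h2
  rw [h2, Fintype.sum_prod_type]
  rw [← sum_zmod_eq_sum_range (n := n) fun j => ∑ k ∈ Finset.range n,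
    planeDensity τ ε s t (2 * Real.pi * (j / n : ℝ), 2 * Real.pi * (k / n : ℝ))]
  refine Finset.sum_congr rfl fun x _ => ?_
  exact sum_zmod_eq_sum_range (n := n) fun k =>
    planeDensity τ ε s t (2 * Real.pi * ((x.val : ℕ) / n : ℝ), 2 * Real.pi * (k / n : ℝ))

theorem tendsto_torusCov (τ : Finset (ℤ × ℤ)) {ε : ℝ} (hε : 0 < ε) (s t : ℤ) :
    Tendsto (fun m : ℕ => torusCov (m + 1) τ ε (toTorus (m + 1) (s, t))) atTop
      (𝓝 (planeCov τ ε s t)) := by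
  have hcont := continuous_planeDensity τ hε s t
  have h1 := tendsto_riemannSum_square (F := fun x y =>
    planeDensity τ ε s t (2 * Real.pi * x, 2 * Real.pi * y)) (by
      exact hcont.comp (by fun_prop : Continuous fun v : ℝ × ℝ =>
        (2 * Real.pi * v.1, 2 * Real.pi * v.2)))
  have h2 : Tendsto (fun n : ℕ => 1 / (n : ℂ) ^ 2 * planeDensity τ ε s t (0, 0)) atTop (𝓝 0) := by
    have : Tendsto (fun n : ℕ => 1 / (n : ℂ) ^ 2) atTop (𝓝 0) := by
      have := (tendsto_one_div_atTop_nhds_zero_nat (𝕜 := ℂ)).pow 2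
      simpa using this
    simpa using this.mul_const (planeDensity τ ε s t (0, 0))
  have h3 : ∫ x in (0 : ℝ)..1, ∫ y in (0 : ℝ)..1,
      planeDensity τ ε s t (2 * Real.pi * x, 2 * Real.pi * y) = planeCov τ ε s t := by
    have hpi : (2 * Real.pi : ℝ) ≠ 0 := by positivity
    have e1 : ∀ x : ℝ, ∫ y in (0 : ℝ)..1, planeDensity τ ε s t (x, 2 * Real.pi * y)
        = (2 * Real.pi : ℝ)⁻¹ • ∫ y in (0 : ℝ)..2 * Real.pi, planeDensity τ ε s t (x, y) := by
      intro x
      have := intervalIntegral.integral_comp_mul_left (a := 0) (b := 1)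
        (fun y => planeDensity τ ε s t (x, y)) hpi
      simpa only [mul_zero, mul_one] using this
    simp_rw [e1]
    have e2 := intervalIntegral.integral_comp_mul_left (a := 0) (b := 1)
        (fun x => (2 * Real.pi : ℝ)⁻¹ • ∫ y in (0 : ℝ)..2 * Real.pi, planeDensity τ ε s t (x, y)) hpi
    simp only [mul_zero, mul_one] at e2
    rw [e2, intervalIntegral.integral_smul, smul_smul, Complex.real_smul]
    unfold planeCov
    congr 1
    push_cast
    ring
  have h4 := (h1.sub h2).comp (tendsto_add_atTop_nat 1)
  rw [h3, sub_zero] at h4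
  refine h4.congr fun m => ?_
  rw [torusCov_eq_riemannSum]
  rfl

/-- The covariances on the tori converge to the Fourier coefficient; two cells are needed for the
tori to be nondegenerate. -/
theorem hasPlaneCov {τ : Finset (ℤ × ℤ)} (hτ : 2 ≤ τ.card) {ε : ℝ} (hε : 0 < ε) (s t : ℤ) :
    HasPlaneCov τ ε s t (planeCov τ ε s t).re := by
  refine ⟨fun m => (torusCov (m + 1) τ ε (toTorus (m + 1) (s, t))).re, ?_,
    (Complex.continuous_re.tendsto _).comp (tendsto_torusCov τ hε s t)⟩
  filter_upwards [(tendsto_add_atTop_nat 1).eventually (eventually_embeds hτ)] with m hm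
  exact hasTorusCov (hm inferInstance) hε s t

theorem ofReal_planeCov_re (τ : Finset (ℤ × ℤ)) {ε : ℝ} (hε : 0 < ε) (s t : ℤ) :
    ((planeCov τ ε s t).re : ℂ) = planeCov τ ε s t := by
  have h := (Complex.continuous_im.tendsto _).comp (tendsto_torusCov τ hε s t)
  have h0 : (Complex.im ∘ fun m : ℕ => torusCov (m + 1) τ ε (toTorus (m + 1) (s, t)))
      = fun _ => 0 := funext fun m => torusCov_im _ _
  rw [h0] at h
  have : (planeCov τ ε s t).im = 0 := tendsto_nhds_unique h tendsto_const_nhds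
  exact Complex.ext (by simp) (by simp [this])

end PlaneCov

/-! ### The heat kernel representation of the Bessel function -/

section BesselKernel

open MeasureTheory Set

/-- The integrand `e^{-εl - κ/(4l)} / l` of the heat kernel representation of `K₀`. -/
def besselKernel (ε κ l : ℝ) : ℝ := Real.exp (-(ε * l) - κ / (4 * l)) / l

theorem besselKernel_nonneg (ε κ : ℝ) {l : ℝ} (hl : 0 < l) : 0 ≤ besselKernel ε κ l :=
  div_nonneg (Real.exp_pos _).le hl.le

theorem measurable_besselKernel (ε κ : ℝ) : Measurable (besselKernel ε κ) := by
  unfold besselKernel; fun_prop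

theorem besselKernel_le_inv {ε κ l : ℝ} (hε : 0 ≤ ε) (hκ : 0 < κ) (hl : 0 < l) :
    besselKernel ε κ l ≤ 4 / κ := by
  have hx : 0 < κ / (4 * l) := by positivity
  have h1 : Real.exp (-(ε * l) - κ / (4 * l)) ≤ (κ / (4 * l))⁻¹ := by
    rw [← one_div, le_div_iff₀ hx]
    have h2 := Real.add_one_le_exp (κ / (4 * l))
    calc _ ≤ Real.exp (-(ε * l) - κ / (4 * l)) * Real.exp (κ / (4 * l)) := by gcongr; linarith
      _ = Real.exp (-(ε * l)) := by rw [← Real.exp_add]; congr 1; ring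
      _ ≤ 1 := Real.exp_le_one_iff.2 (by nlinarith)
  unfold besselKernel
  rw [div_le_iff₀ hl]
  refine h1.trans (le_of_eq ?_)
  field_simp

theorem besselKernel_le_exp_div {ε κ l : ℝ} (hκ : 0 ≤ κ) (hl : 0 < l) :
    besselKernel ε κ l ≤ Real.exp (-(ε * l)) / l := by
  unfold besselKernel
  gcongr
  have : 0 ≤ κ / (4 * l) := by positivity
  linarith

theorem besselKernel_le_exp {ε κ l : ℝ} (hκ : 0 ≤ κ) (hl : 1 ≤ l) :
    besselKernel ε κ l ≤ Real.exp (-ε * l) := by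
  refine (besselKernel_le_exp_div hκ (by linarith)).trans ?_
  rw [neg_mul]
  exact div_le_self (Real.exp_pos _).le hl

theorem integrableOn_besselKernel_Ioi_one {ε κ : ℝ} (hε : 0 < ε) (hκ : 0 ≤ κ) :
    IntegrableOn (besselKernel ε κ) (Ioi 1) := by
  refine Integrable.mono' (integrableOn_exp_mul_Ioi (neg_lt_zero.2 hε) 1)
    (measurable_besselKernel ε κ).aestronglyMeasurable ?_
  refine (ae_restrict_iff' measurableSet_Ioi).2 (ae_of_all _ fun l hl => ?_)
  have hl' : (1 : ℝ) < l := hl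
  rw [Real.norm_eq_abs, abs_of_nonneg (besselKernel_nonneg ε κ (by linarith))]
  exact besselKernel_le_exp hκ hl'.le

theorem integrableOn_besselKernel_Ioc {ε κ : ℝ} (hε : 0 ≤ ε) (hκ : 0 < κ) :
    IntegrableOn (besselKernel ε κ) (Ioc 0 1) := by
  refine Measure.integrableOn_of_bounded (M := 4 / κ) (by simp)
    (measurable_besselKernel ε κ).aestronglyMeasurable ?_
  refine (ae_restrict_iff' measurableSet_Ioc).2 (ae_of_all _ fun l hl => ?_)
  rw [Real.norm_eq_abs, abs_of_nonneg (besselKernel_nonneg ε κ hl.1)]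
  exact besselKernel_le_inv hε hκ hl.1

theorem integrableOn_besselKernel {ε κ : ℝ} (hε : 0 < ε) (hκ : 0 < κ) :
    IntegrableOn (besselKernel ε κ) (Ioi 0) := by
  rw [← Ioc_union_Ioi_eq_Ioi (zero_le_one' ℝ)]
  exact (integrableOn_besselKernel_Ioc hε.le hκ).union (integrableOn_besselKernel_Ioi_one hε hκ.le)

theorem integral_besselKernel_split {ε κ : ℝ} (hε : 0 < ε) (hκ : 0 < κ) :
    ∫ l in Ioi 0, besselKernel ε κ l
      = (∫ l in Ioc 0 1, besselKernel ε κ l) + ∫ l in Ioi 1, besselKernel ε κ l := by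
  rw [← Ioc_union_Ioi_eq_Ioi (zero_le_one' ℝ)]
  exact setIntegral_union (Ioc_disjoint_Ioi le_rfl) measurableSet_Ioi
    (integrableOn_besselKernel_Ioc hε.le hκ) (integrableOn_besselKernel_Ioi_one hε hκ.le)

theorem integral_besselKernel_Ioc_mem {ε κ : ℝ} (hε : 0 ≤ ε) (hκ : 0 < κ) :
    0 ≤ ∫ l in Ioc 0 1, besselKernel ε κ l ∧ ∫ l in Ioc 0 1, besselKernel ε κ l ≤ 4 / κ := by
  constructor
  · exact setIntegral_nonneg measurableSet_Ioc fun l hl => besselKernel_nonneg ε κ hl.1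
  · have := setIntegral_mono_on (integrableOn_besselKernel_Ioc hε hκ)
      (integrableOn_const (C := 4 / κ) (μ := volume) (s := Ioc (0 : ℝ) 1) (by simp) )
      measurableSet_Ioc fun l hl => besselKernel_le_inv hε hκ hl.1
    simpa using this

/-- `∫_1^∞ e^{-εl - κ/(4l)} dl / l` is `log (1/ε)` up to a bounded error. -/
theorem abs_integral_besselKernel_sub_log_le {ε κ : ℝ} (hε : 0 < ε) (hε1 : ε ≤ 1) (hκ : 0 ≤ κ) :
    |(∫ l in Ioi 1, besselKernel ε κ l) - Real.log (1 / ε)| ≤ 1 + κ / 4 := by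
  have h1ε : 1 ≤ 1 / ε := by rw [le_div_iff₀ hε]; linarith
  have hint := integrableOn_besselKernel_Ioi_one hε hκ
  have hsplit : ∫ l in Ioi 1, besselKernel ε κ l
      = (∫ l in Ioc 1 (1 / ε), besselKernel ε κ l) + ∫ l in Ioi (1 / ε), besselKernel ε κ l := by
    rw [← Ioc_union_Ioi_eq_Ioi h1ε] at hint ⊢
    exact setIntegral_union (Ioc_disjoint_Ioi le_rfl) measurableSet_Ioi hint.left_of_union
      hint.right_of_union
  have hintc : IntegrableOn (besselKernel ε κ) (Ioc 1 (1 / ε)) := hint.mono_set Ioc_subset_Ioi_self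
  have hintt : IntegrableOn (besselKernel ε κ) (Ioi (1 / ε)) := hint.mono_set (Ioi_subset_Ioi h1ε)
  have hpos : ∀ l ∈ uIcc 1 (1 / ε), l ≠ 0 := by
    intro l hl
    rw [uIcc_of_le h1ε] at hl
    linarith [hl.1]
  have htail0 : 0 ≤ ∫ l in Ioi (1 / ε), besselKernel ε κ l :=
    setIntegral_nonneg measurableSet_Ioi fun l hl => besselKernel_nonneg ε κ
      (lt_trans (by positivity) hl)
  have htail1 : ∫ l in Ioi (1 / ε), besselKernel ε κ l ≤ 1 := by
    have := setIntegral_mono_on hintt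
      ((integrableOn_exp_mul_Ioi (neg_lt_zero.2 hε) (1 / ε)).const_mul ε) measurableSet_Ioi
      (fun l hl => by
        have hl' : 1 / ε < l := hl
        have hl0 : 0 < l := lt_trans (by positivity) hl'
        refine (besselKernel_le_exp_div hκ hl0).trans ?_
        rw [neg_mul, div_eq_inv_mul]
        gcongr
        rw [inv_le_comm₀ hl0 hε, ← one_div]
        exact hl'.le)
    refine this.trans ?_
    rw [integral_const_mul, integral_exp_mul_Ioi (neg_lt_zero.2 hε)]
    have e : -ε * (1 / ε) = -1 := by field_simp
    rw [e]
    have : ε * (-Real.exp (-1) / -ε) = Real.exp (-1) := by field_simp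
    rw [this]
    exact Real.exp_le_one_iff.2 (by norm_num)
  have hupper : ∫ l in Ioc 1 (1 / ε), besselKernel ε κ l ≤ Real.log (1 / ε) := by
    have hi : IntegrableOn (fun l : ℝ => 1 / l) (Ioc 1 (1 / ε)) := by
      rw [← intervalIntegrable_iff_integrableOn_Ioc_of_le h1ε]
      exact intervalIntegral.intervalIntegrable_one_div (by simpa using hpos) continuousOn_id
    have := setIntegral_mono_on hintc hi measurableSet_Ioc (fun l hl => by
      have hl0 : 0 < l := by linarith [hl.1]
      refine (besselKernel_le_exp_div hκ hl0).trans ?_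
      gcongr
      exact Real.exp_le_one_iff.2 (by nlinarith))
    refine this.trans (le_of_eq ?_)
    rw [← intervalIntegral.integral_of_le h1ε, integral_one_div_of_pos one_pos (by positivity)]
    simp
  have hlower : Real.log (1 / ε) - 1 - κ / 4 ≤ ∫ l in Ioc 1 (1 / ε), besselKernel ε κ l := by
    have hderiv : ∀ l ∈ uIcc 1 (1 / ε), HasDerivAt (fun l => Real.log l - ε * l + κ / 4 * l⁻¹)
        (l⁻¹ - ε * 1 + κ / 4 * -(l ^ 2)⁻¹) l := by
      intro l hl
      have h0 := hpos l hl
      exact ((Real.hasDerivAt_log h0).sub ((hasDerivAt_id l).const_mul ε)).add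
        ((hasDerivAt_inv h0).const_mul _)
    have hci : IntervalIntegrable (fun l : ℝ => l⁻¹ - ε * 1 + κ / 4 * -(l ^ 2)⁻¹) volume 1 (1 / ε) := by
      refine ContinuousOn.intervalIntegrable ?_
      have c1 : ContinuousOn (fun l : ℝ => l⁻¹) (uIcc 1 (1 / ε)) :=
        continuousOn_id.inv₀ hpos
      have c2 : ContinuousOn (fun l : ℝ => (l ^ 2)⁻¹) (uIcc 1 (1 / ε)) :=
        (continuousOn_id.pow 2).inv₀ fun l hl => pow_ne_zero 2 (hpos l hl)
      fun_prop
    have hval := intervalIntegral.integral_eq_sub_of_hasDerivAt hderiv hci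
    have hmono := setIntegral_mono_on
      ((intervalIntegrable_iff_integrableOn_Ioc_of_le h1ε).1 hci) hintc measurableSet_Ioc
      (fun l hl => by
        have hl0 : 0 < l := by linarith [hl.1]
        have h1 := Real.add_one_le_exp (-(ε * l) - κ / (4 * l))
        unfold besselKernel
        rw [le_div_iff₀ hl0]
        refine le_trans (le_of_eq ?_) h1
        field_simp
        ring)
    rw [← intervalIntegral.integral_of_le h1ε, hval] at hmono
    refine le_trans ?_ hmono
    rw [Real.log_one]
    have e : ε * (1 / ε) = 1 := by field_simp
    rw [e]
    have : 0 ≤ κ / 4 * (1 / ε)⁻¹ := by positivity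
    have : (1 : ℝ)⁻¹ = 1 := inv_one
    rw [this]
    linarith
  rw [hsplit, abs_le]
  constructor
  · linarith
  · have : 0 ≤ κ / 4 := by positivity
    linarith

theorem exp_le_integral_besselKernel {ε κ M : ℝ} (hε : 0 < ε) (hκ : 0 < κ) (hM : ε * κ ≤ M) :
    Real.exp (-2 - M / 4) / 2 ≤ ∫ l in Ioi 0, besselKernel ε κ l := by
  have hint := integrableOn_besselKernel hε hκ
  have h12 : 1 / ε ≤ 2 / ε := by gcongr; norm_num
  have hsub : Ioc (1 / ε) (2 / ε) ⊆ Ioi 0 := fun l hl => lt_trans (by positivity) hl.1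
  have h1 : ∫ l in Ioc (1 / ε) (2 / ε), besselKernel ε κ l ≤ ∫ l in Ioi 0, besselKernel ε κ l :=
    setIntegral_mono_set hint ((ae_restrict_iff' measurableSet_Ioi).2
      (ae_of_all _ fun l hl => besselKernel_nonneg ε κ hl)) hsub.eventuallyLE
  refine le_trans ?_ h1
  have h2 := setIntegral_mono_on
    (integrableOn_const (C := Real.exp (-2 - M / 4) * (ε / 2)) (μ := volume)
      (s := Ioc (1 / ε) (2 / ε)) (by simp))
    (hint.mono_set hsub) measurableSet_Ioc (fun l hl => by
      have hl0 : 0 < l := hsub hl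
      have a1 : ε * l ≤ 2 := by
        have := (le_div_iff₀ hε).1 hl.2; linarith
      have a2 : 1 < ε * l := by
        have := (div_lt_iff₀ hε).1 hl.1; linarith
      unfold besselKernel
      rw [div_eq_mul_inv (Real.exp _) l]
      refine mul_le_mul (Real.exp_le_exp.2 ?_) ?_ (by positivity) (Real.exp_pos _).le
      · have : κ / (4 * l) ≤ M / 4 := by
          rw [div_le_div_iff₀ (by positivity) (by norm_num)]
          nlinarith
        linarith
      · rw [le_inv_comm₀ (by positivity) hl0]
        rw [inv_div]; exact hl.2)
  refine le_trans (le_of_eq ?_) h2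
  rw [setIntegral_const, Measure.real, Real.volume_Ioc, ENNReal.toReal_ofReal (by linarith)]
  rw [smul_eq_mul]
  field_simp
  ring

/-- The substitution `l = √κ / (2 √ε) e^u` turns the exponent into `-√(εκ) cosh u`. -/
theorem integral_besselKernel_eq_besselK {ε κ : ℝ} (hε : 0 < ε) (hκ : 0 < κ) :
    ∫ l in Ioi 0, besselKernel ε κ l = 2 * besselK (√(ε * κ)) := by
  set r := √(ε * κ) with hr
  have hr0 : 0 < r := Real.sqrt_pos.2 (by positivity)
  have hr2 : r * r = ε * κ := Real.mul_self_sqrt (by positivity)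
  set α := r / (2 * ε) with hα
  have hα0 : 0 < α := by positivity
  have himg : (fun u : ℝ => α * Real.exp u) '' univ = Ioi 0 := by
    ext l
    simp only [image_univ, mem_range, mem_Ioi]
    constructor
    · rintro ⟨u, rfl⟩; positivity
    · intro hl
      refine ⟨Real.log (l / α), ?_⟩
      rw [Real.exp_log (by positivity)]; field_simp
  have hcv := integral_image_eq_integral_abs_deriv_smul (s := univ)
    (f := fun u : ℝ => α * Real.exp u) (f' := fun u => α * Real.exp u) MeasurableSet.univ
    (fun u _ => ((Real.hasDerivAt_exp u).const_mul α).hasDerivWithinAt)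
    (fun u _ v _ huv => Real.exp_injective (mul_left_cancel₀ hα0.ne' huv)) (besselKernel ε κ)
  rw [himg] at hcv
  rw [hcv, Measure.restrict_univ]
  unfold besselK
  rw [← integral_comp_abs (f := fun x => Real.exp (-(r * Real.cosh x)))]
  refine integral_congr_ae (ae_of_all _ fun u => ?_)
  simp only [Real.cosh_abs]
  have h0 : 0 < α * Real.exp u := by positivity
  rw [abs_of_pos h0, smul_eq_mul]
  unfold besselKernel
  rw [mul_div_cancel₀ _ h0.ne']
  congr 1
  rw [Real.cosh_eq, Real.exp_neg, hα]
  have hu := (Real.exp_pos u).ne'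
  have hκ' : κ = r * r / ε := by rw [hr2]; field_simp
  rw [hκ']
  field_simp
  ring

end BesselKernel

/-! ### Quadratic forms and Gaussian integrals in the plane -/

section GaussianPlane

open MeasureTheory Set

/-- The quadratic form `a x² + b x y + c y²`. -/
def quadForm (a b c : ℝ) (v : ℝ × ℝ) : ℝ := a * v.1 ^ 2 + b * (v.1 * v.2) + c * v.2 ^ 2

theorem continuous_quadForm (a b c : ℝ) : Continuous (quadForm a b c) := by
  unfold quadForm; fun_prop

variable {a b c : ℝ}

theorem quadForm_lower (ha : 0 < a) (hc : 0 < c) (v : ℝ × ℝ) :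
    (a * c - b ^ 2 / 4) / (a + c) * (v.1 ^ 2 + v.2 ^ 2) ≤ quadForm a b c v := by
  set m := (a * c - b ^ 2 / 4) / (a + c) with hm
  have hac : 0 < a + c := by linarith
  have hmac : m * (a + c) = a * c - b ^ 2 / 4 := div_mul_cancel₀ _ hac.ne'
  have ham : 0 < a - m := by
    rw [sub_pos, hm, div_lt_iff₀ hac]
    nlinarith [sq_nonneg b, sq_pos_of_pos ha]
  have key : 0 ≤ (a - m) * (quadForm a b c v - m * (v.1 ^ 2 + v.2 ^ 2)) := by
    have : (a - m) * (quadForm a b c v - m * (v.1 ^ 2 + v.2 ^ 2))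
        = ((a - m) * v.1 + b / 2 * v.2) ^ 2 + (m * v.2) ^ 2 := by
      unfold quadForm
      linear_combination (- v.2 ^ 2) * hmac
    rw [this]; positivity
  have := nonneg_of_mul_nonneg_right key ham
  linarith

theorem quadForm_nonneg (ha : 0 < a) (hc : 0 < c) (hD : 0 < a * c - b ^ 2 / 4) (v : ℝ × ℝ) :
    0 ≤ quadForm a b c v := by
  refine le_trans ?_ (quadForm_lower ha hc v)
  have : 0 < a + c := by linarith
  positivity

theorem integrable_gaussian_plane {m : ℝ} (hm : 0 < m) :
    Integrable fun v : ℝ × ℝ => Real.exp (-m * (v.1 ^ 2 + v.2 ^ 2)) := by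
  have := (integrable_exp_neg_mul_sq hm).mul_prod (integrable_exp_neg_mul_sq hm)
  rw [← Measure.volume_eq_prod] at this
  refine this.congr (ae_of_all _ fun v => ?_)
  simp only
  rw [← Real.exp_add]; congr 1; ring

theorem integrable_exp_quadForm (ha : 0 < a) (hc : 0 < c) (hD : 0 < a * c - b ^ 2 / 4) {l : ℝ}
    (hl : 0 < l) : Integrable fun v => Real.exp (-(l * quadForm a b c v)) := by
  have hac : 0 < a + c := by linarith
  refine (integrable_gaussian_plane (m := l * ((a * c - b ^ 2 / 4) / (a + c)))
    (by positivity)).mono' ?_ (ae_of_all _ fun v => ?_)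
  · have := continuous_quadForm a b c
    exact (by fun_prop : Continuous fun v => Real.exp (-(l * quadForm a b c v))).aestronglyMeasurable
  · rw [Real.norm_eq_abs, abs_of_pos (Real.exp_pos _)]
    refine Real.exp_le_exp.2 ?_
    have := mul_le_mul_of_nonneg_left (quadForm_lower (b := b) ha hc v) hl.le
    linarith

theorem integrable_planeWave_mul {f : ℝ × ℝ → ℝ} {μ : Measure (ℝ × ℝ)} (hf : Integrable f μ)
    (s t : ℤ) : Integrable (fun v => planeWave s t v * (f v : ℂ)) μ := by
  refine hf.ofReal.bdd_mul (c := 1) (continuous_planeWave s t).aestronglyMeasurable ?_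
  exact ae_of_all _ fun v => (norm_planeWave s t v).le

/-- The exponent in the Fourier transform of the Gaussian with form `a x² + b x y + c y²`. -/
def dualForm (a b c : ℝ) (s t : ℤ) : ℝ :=
  (c * (s : ℝ) ^ 2 - b * (s : ℝ) * (t : ℝ) + a * (t : ℝ) ^ 2) / (a * c - b ^ 2 / 4)

theorem integral_planeWave_gaussian (ha : 0 < a) (hc : 0 < c) (hD : 0 < a * c - b ^ 2 / 4) {l : ℝ}
    (hl : 0 < l) (s t : ℤ) :
    ∫ v, planeWave s t v * (Real.exp (-(l * quadForm a b c v)) : ℂ)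
      = ((Real.pi / √(a * c - b ^ 2 / 4) * (Real.exp (-(dualForm a b c s t / (4 * l))) / l) : ℝ) : ℂ) := by
  have hint := integrable_planeWave_mul (integrable_exp_quadForm ha hc hD hl) s t
  rw [Measure.volume_eq_prod] at hint ⊢
  rw [integral_prod _ hint]
  set D := a * c - b ^ 2 / 4 with hDdef
  have hpos : ∀ x : ℝ, 0 < x → ((x : ℂ)) ^ (1 / 2 : ℂ) = ((√x : ℝ) : ℂ) := by
    intro x hx
    rw [Real.sqrt_eq_rpow, Complex.ofReal_cpow hx.le]; push_cast; rfl
  have hlC : (l : ℂ) ≠ 0 := by exact_mod_cast hl.ne'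
  have hcC : (c : ℂ) ≠ 0 := by exact_mod_cast hc.ne'
  have hDC : (D : ℂ) ≠ 0 := by exact_mod_cast hD.ne'
  have h1 : ∀ x : ℝ, ∫ y : ℝ, planeWave s t (x, y) * (Real.exp (-(l * quadForm a b c (x, y))) : ℂ)
      = ((√(Real.pi / (l * c)) : ℝ) : ℂ) * Complex.exp ((-(l * D / c : ℝ) : ℂ) * (x : ℂ) ^ 2
        + (Complex.I * (s - t * b / (2 * c))) * x + (-(t ^ 2 / (4 * l * c)))) := by
    intro x
    have := integral_cexp_quadratic (b := (-(l * c : ℝ) : ℂ)) (by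
      rw [Complex.neg_re, Complex.ofReal_re]; nlinarith) (Complex.I * t - l * b * x)
      (-(l * a) * x ^ 2 + Complex.I * s * x)
    rw [neg_neg, ← Complex.ofReal_div, hpos _ (by positivity)] at this
    convert this using 2
    · funext y
      unfold planeWave quadForm
      push_cast
      rw [← Complex.exp_add]
      congr 1; ring
    · congr 1
      rw [hDdef]
      push_cast
      field_simp
      ring_nf
      simp only [Complex.I_sq]
      ring
  simp_rw [h1]
  rw [integral_const_mul, integral_cexp_quadratic (by
    rw [Complex.neg_re, Complex.ofReal_re]; have : 0 < l * D / c := by positivity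
    linarith)]
  rw [neg_neg, ← Complex.ofReal_div, hpos _ (by positivity), ← mul_assoc, ← Complex.ofReal_mul]
  have hsq : √(Real.pi / (l * c)) * √(Real.pi / (l * D / c)) = Real.pi / √D / l := by
    rw [← Real.sqrt_mul (by positivity)]
    have : Real.pi / (l * c) * (Real.pi / (l * D / c)) = (Real.pi / l) ^ 2 / D := by field_simp
    rw [this, Real.sqrt_div (by positivity), Real.sqrt_sq (by positivity)]
    ring
  have hexp : (-(t ^ 2 / (4 * l * c)) : ℂ) - (Complex.I * (s - t * b / (2 * c))) ^ 2 /
      (4 * (-(l * D / c : ℝ) : ℂ)) = ((-(dualForm a b c s t / (4 * l)) : ℝ) : ℂ) := by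
    have hD' : (D : ℂ) = a * c - b ^ 2 / 4 := by rw [hDdef]; push_cast; ring
    unfold dualForm
    rw [← hDdef]
    push_cast
    rw [mul_pow, Complex.I_sq]
    field_simp
    rw [hD']
    ring
  rw [hsq, hexp, ← Complex.ofReal_exp, ← Complex.ofReal_mul]
  congr 1
  ring

/-! ### Integration by parts along one variable -/

theorem integral_abs_mul_exp_le {μ : ℝ} (hμ : 0 < μ) :
    ∫ x : ℝ, 2 * μ * (|x| * Real.exp (-μ * x ^ 2)) = 2 := by
  rw [integral_const_mul]
  have h1 : ∫ x : ℝ, |x| * Real.exp (-μ * x ^ 2)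
      = 2 * ∫ x in Ioi (0 : ℝ), x * Real.exp (-μ * x ^ 2) := by
    rw [← integral_comp_abs (f := fun x => x * Real.exp (-μ * x ^ 2))]
    simp
  have h2 := integral_mul_cexp_neg_mul_sq (b := (μ : ℂ)) (by simpa using hμ)
  have h3 : ∫ x in Ioi (0 : ℝ), x * Real.exp (-μ * x ^ 2) = (2 * μ)⁻¹ := by
    have : ∀ r : ℝ, (r : ℂ) * Complex.exp (-(μ : ℂ) * (r : ℂ) ^ 2)
        = ((r * Real.exp (-μ * r ^ 2) : ℝ) : ℂ) := by intro r; push_cast; rfl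
    simp_rw [this] at h2
    rw [integral_complex_ofReal] at h2
    exact_mod_cast h2
  rw [h1, h3]
  field_simp

theorem norm_integral_wave_gaussian_le {s : ℤ} (hs : s ≠ 0) {μ : ℝ} (hμ : 0 < μ) (x₀ L : ℝ)
    (hL : 0 ≤ L) :
    ‖∫ x in (-L)..L, (Real.exp (-μ * (x - x₀) ^ 2) : ℂ) * Complex.exp (Complex.I * s * x)‖ ≤ 4 := by
  have hsC : (s : ℂ) ≠ 0 := by exact_mod_cast hs
  have hs1 : (1 : ℝ) ≤ ‖(s : ℂ)‖ := by
    rw [Complex.norm_intCast]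
    exact_mod_cast Int.one_le_abs hs
  have hu : ∀ x ∈ uIcc (-L) L, HasDerivAt (fun x : ℝ => (Real.exp (-μ * (x - x₀) ^ 2) : ℂ))
      ((Real.exp (-μ * (x - x₀) ^ 2) * (-μ * (2 * (x - x₀))) : ℝ) : ℂ) x := by
    intro x _
    have h1 : HasDerivAt (fun x : ℝ => -μ * (x - x₀) ^ 2) (-μ * (2 * (x - x₀))) x := by
      have := (((hasDerivAt_id x).sub_const x₀).pow 2).const_mul (-μ)
      simpa using this
    exact h1.exp.ofReal_comp
  have hv : ∀ x ∈ uIcc (-L) L, HasDerivAt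
      (fun x : ℝ => Complex.exp (Complex.I * s * x) / (Complex.I * s))
      (Complex.exp (Complex.I * s * x)) x := by
    intro x _
    have h1 : HasDerivAt (fun x : ℝ => Complex.I * s * (x : ℂ)) (Complex.I * s) x := by
      simpa using (Complex.ofRealCLM.hasDerivAt (x := x)).const_mul (Complex.I * s)
    have := h1.cexp.div_const (Complex.I * s)
    rwa [mul_div_cancel_right₀ _ (mul_ne_zero Complex.I_ne_zero hsC)] at this
  have hnv : ∀ x : ℝ, ‖Complex.exp (Complex.I * s * x) / (Complex.I * s)‖ ≤ 1 := by
    intro x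
    have : Complex.I * s * x = ((s * x : ℝ) : ℂ) * Complex.I := by push_cast; ring
    rw [norm_div, this, Complex.norm_exp_ofReal_mul_I, norm_mul, Complex.norm_I, one_mul]
    rw [div_le_one (by linarith)]
    exact hs1
  rw [intervalIntegral.integral_mul_deriv_eq_deriv_mul hu hv
    (Continuous.intervalIntegrable (by fun_prop) _ _)
    (Continuous.intervalIntegrable (by fun_prop) _ _)]
  have hbd : ∀ x : ℝ, ‖(Real.exp (-μ * (x - x₀) ^ 2) : ℂ) *
      (Complex.exp (Complex.I * s * x) / (Complex.I * s))‖ ≤ 1 := by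
    intro x
    rw [norm_mul, Complex.norm_real, Real.norm_eq_abs, abs_of_pos (Real.exp_pos _)]
    refine mul_le_one₀ ?_ (norm_nonneg _) (hnv x)
    exact Real.exp_le_one_iff.2 (by nlinarith [sq_nonneg (x - x₀)])
  have hint : Integrable fun x : ℝ => 2 * μ * (|x - x₀| * Real.exp (-μ * (x - x₀) ^ 2)) := by
    have h := (integrable_mul_exp_neg_mul_sq hμ).norm.const_mul (2 * μ)
    have h' := h.comp_sub_right x₀
    refine h'.congr (ae_of_all _ fun x => ?_)
    simp only [norm_mul, Real.norm_eq_abs, abs_of_pos (Real.exp_pos _)]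
  have hlast : ‖∫ x in (-L)..L, ((Real.exp (-μ * (x - x₀) ^ 2) * (-μ * (2 * (x - x₀))) : ℝ) : ℂ) *
      (Complex.exp (Complex.I * s * x) / (Complex.I * s))‖ ≤ 2 := by
    have hLL : -L ≤ L := by linarith
    calc _ ≤ ∫ x in (-L)..L, 2 * μ * (|x - x₀| * Real.exp (-μ * (x - x₀) ^ 2)) := by
          refine intervalIntegral.norm_integral_le_of_norm_le hLL (ae_of_all _ fun x _ => ?_)
            hint.intervalIntegrable
          rw [norm_mul, Complex.norm_real, Real.norm_eq_abs, abs_mul, abs_of_pos (Real.exp_pos _),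
            abs_mul, abs_neg, abs_of_pos hμ, abs_mul, abs_of_pos (two_pos : (0 : ℝ) < 2)]
          have := hnv x
          have h0 : 0 ≤ Real.exp (-μ * (x - x₀) ^ 2) * (μ * (2 * |x - x₀|)) := by positivity
          nlinarith
      _ ≤ ∫ x : ℝ, 2 * μ * (|x - x₀| * Real.exp (-μ * (x - x₀) ^ 2)) := by
          rw [intervalIntegral.integral_of_le hLL]
          exact setIntegral_le_integral hint (ae_of_all _ fun x => by positivity)
      _ = 2 := by
          rw [integral_sub_right_eq_self (fun x => 2 * μ * (|x| * Real.exp (-μ * x ^ 2))) x₀]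
          exact integral_abs_mul_exp_le hμ
  refine (norm_sub_le _ _).trans ?_
  refine (add_le_add (norm_sub_le _ _) hlast).trans ?_
  linarith [hbd L, hbd (-L)]

end GaussianPlane

/-! ### Fourier integrals of reciprocal quadratic forms -/

section FourierIntegrals

open MeasureTheory Set

variable {a b c : ℝ}

theorem planeWave_swap (s t : ℤ) (v : ℝ × ℝ) : planeWave s t v.swap = planeWave t s v := by
  unfold planeWave
  congr 1
  simp only [Prod.fst_swap, Prod.snd_swap]
  ring

theorem quadForm_swap (v : ℝ × ℝ) : quadForm a b c v.swap = quadForm c b a v := by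
  unfold quadForm
  simp only [Prod.fst_swap, Prod.snd_swap]
  ring

theorem continuous_wave_gaussian (a b c : ℝ) (s t : ℤ) (l : ℝ) :
    Continuous fun v => planeWave s t v * (Real.exp (-(l * quadForm a b c v)) : ℂ) := by
  have h1 := continuous_planeWave s t
  have h2 := continuous_quadForm a b c
  fun_prop

theorem norm_box_integral_le_of_ne (ha : 0 < a) (hD : 0 < a * c - b ^ 2 / 4)
    {s : ℤ} (hs : s ≠ 0) (t : ℤ) {l L : ℝ} (hl : 0 < l) (hL : 0 ≤ L) :
    ‖∫ v in Icc (-L) L ×ˢ Icc (-L) L, planeWave s t v *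
        (Real.exp (-(l * quadForm a b c v)) : ℂ)‖
      ≤ 4 * √(Real.pi / (l * ((a * c - b ^ 2 / 4) / a))) := by
  set D := a * c - b ^ 2 / 4 with hDdef
  have hLL : -L ≤ L := by linarith
  have hcont := continuous_wave_gaussian a b c s t l
  rw [Measure.volume_eq_prod, ← setIntegral_prod_swap, setIntegral_prod]
  swap
  · exact ((hcont.comp continuous_swap).continuousOn.integrableOn_compact
      (isCompact_Icc.prod isCompact_Icc))
  have hinner : ∀ y : ℝ, ‖∫ x in Icc (-L) L, planeWave s t ((y, x) : ℝ × ℝ).swap *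
      (Real.exp (-(l * quadForm a b c ((y, x) : ℝ × ℝ).swap)) : ℂ)‖
      ≤ 4 * Real.exp (-(l * (D / a)) * y ^ 2) := by
    intro y
    rw [integral_Icc_eq_integral_Ioc, ← intervalIntegral.integral_of_le hLL]
    have he : ∀ x : ℝ, planeWave s t ((y, x) : ℝ × ℝ).swap *
        (Real.exp (-(l * quadForm a b c ((y, x) : ℝ × ℝ).swap)) : ℂ)
        = (Complex.exp (Complex.I * t * y) * (Real.exp (-(l * (D / a)) * y ^ 2) : ℂ)) *
          ((Real.exp (-(l * a) * (x - (-(b * y / (2 * a)))) ^ 2) : ℂ) *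
            Complex.exp (Complex.I * s * x)) := by
      intro x
      unfold planeWave quadForm
      simp only [Prod.swap_prod_mk]
      push_cast
      simp only [← Complex.exp_add]
      congr 1
      have haC : (a : ℂ) ≠ 0 := by exact_mod_cast ha.ne'
      rw [hDdef]
      push_cast
      field_simp
      ring
    simp_rw [he]
    rw [intervalIntegral.integral_const_mul, norm_mul, norm_mul]
    have h1 : ‖Complex.exp (Complex.I * t * y)‖ = 1 := by
      have : Complex.I * t * y = ((t * y : ℝ) : ℂ) * Complex.I := by push_cast; ring
      rw [this, Complex.norm_exp_ofReal_mul_I]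
    rw [h1, one_mul, Complex.norm_real, Real.norm_eq_abs, abs_of_pos (Real.exp_pos _), mul_comm 4]
    gcongr
    exact norm_integral_wave_gaussian_le hs (by positivity) _ L hL
  have hgi : Integrable fun y : ℝ => 4 * Real.exp (-(l * (D / a)) * y ^ 2) :=
    (integrable_exp_neg_mul_sq (by positivity)).const_mul 4
  refine (norm_integral_le_of_norm_le hgi.integrableOn (ae_of_all _ hinner)).trans ?_
  refine (setIntegral_le_integral hgi (ae_of_all _ fun y => by positivity)).trans ?_
  rw [integral_const_mul, integral_gaussian]

/-- The Fourier integrals of Gaussians over boxes are `O(l ^ (-1/2))`, uniformly in the box. -/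
theorem exists_box_bound (ha : 0 < a) (hc : 0 < c) (hD : 0 < a * c - b ^ 2 / 4)
    {s t : ℤ} (hst : (s, t) ≠ (0, 0)) :
    ∃ C : ℝ, ∀ l L : ℝ, 0 < l → 0 ≤ L →
      ‖∫ v in Icc (-L) L ×ˢ Icc (-L) L, planeWave s t v *
        (Real.exp (-(l * quadForm a b c v)) : ℂ)‖ ≤ C * l ^ (-(1 / 2) : ℝ) := by
  have hsqrt : ∀ m l : ℝ, 0 < m → 0 < l →
      4 * √(Real.pi / (l * m)) = 4 * √(Real.pi / m) * l ^ (-(1 / 2) : ℝ) := by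
    intro m l hm hl
    rw [Real.rpow_neg hl.le, ← Real.sqrt_eq_rpow, ← Real.sqrt_inv, mul_assoc,
      ← Real.sqrt_mul (by positivity)]
    congr 2
    field_simp
  by_cases hs : s = 0
  · have ht : t ≠ 0 := by
      rintro rfl; exact hst (by rw [hs])
    refine ⟨4 * √(Real.pi / ((c * a - b ^ 2 / 4) / c)), fun l L hl hL => ?_⟩
    rw [mul_comm a c] at hD
    rw [← hsqrt _ l (by positivity) hl]
    have := norm_box_integral_le_of_ne (a := c) (b := b) (c := a) hc hD ht s hl hL
    refine le_trans (le_of_eq ?_) this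
    rw [Measure.volume_eq_prod, ← setIntegral_prod_swap]
    simp_rw [planeWave_swap, quadForm_swap]
  · refine ⟨4 * √(Real.pi / ((a * c - b ^ 2 / 4) / a)), fun l L hl hL => ?_⟩
    rw [← hsqrt _ l (by positivity) hl]
    exact norm_box_integral_le_of_ne ha hD hs t hl hL

theorem integral_Ioi_exp_eq_inv {q : ℝ} (hq : 0 < q) :
    ∫ l in Ioi (0 : ℝ), Real.exp (-q * l) = 1 / q := by
  rw [integral_exp_mul_Ioi (neg_lt_zero.2 hq)]
  simp

/-- The Fourier integral of `1 / (ε + Q)` as an improper integral, from the Laplace representation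
`1 / (ε + Q) = ∫_0^∞ e^{-l (ε + Q)} dl`. -/
theorem hasImproperIntegral_quadForm (ha : 0 < a) (hc : 0 < c) (hD : 0 < a * c - b ^ 2 / 4)
    {ε : ℝ} (hε : 0 < ε) {s t : ℤ} (hst : (s, t) ≠ (0, 0)) :
    HasImproperIntegral (fun v => planeWave s t v / ((ε + quadForm a b c v : ℝ) : ℂ))
      ((Real.pi / √(a * c - b ^ 2 / 4) *
        ∫ l in Ioi 0, besselKernel ε (dualForm a b c s t) l : ℝ) : ℂ) := by
  have hQ0 := quadForm_nonneg ha hc hD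
  have hQc := continuous_quadForm a b c
  have hWc := continuous_planeWave s t
  set J : ℝ → ℝ → ℂ := fun L l => ∫ v in Icc (-L) L ×ˢ Icc (-L) L,
    planeWave s t v * (Real.exp (-(l * quadForm a b c v)) : ℂ) with hJ
  have hexpint : Integrable (fun l : ℝ => Real.exp (-ε * l)) (volume.restrict (Ioi 0)) :=
    integrableOn_exp_mul_Ioi (neg_lt_zero.2 hε) 0
  have hprod : ∀ L : ℝ, Integrable (Function.uncurry fun (v : ℝ × ℝ) (l : ℝ) =>
      (Real.exp (-ε * l) : ℂ) * (planeWave s t v * (Real.exp (-(l * quadForm a b c v)) : ℂ)))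
      ((volume.restrict (Icc (-L) L ×ˢ Icc (-L) L)).prod (volume.restrict (Ioi 0))) := by
    intro L
    have : IsFiniteMeasure (volume.restrict (Icc (-L) L ×ˢ Icc (-L) L)) :=
      ⟨by rw [Measure.restrict_apply_univ]
          exact (isCompact_Icc.prod isCompact_Icc).measure_lt_top⟩
    have hdom := (integrable_const (1 : ℝ)
      (μ := volume.restrict (Icc (-L) L ×ˢ Icc (-L) L))).mul_prod hexpint
    refine hdom.mono' ?_ ?_
    · refine Continuous.aestronglyMeasurable ?_
      unfold Function.uncurry
      fun_prop
    · rw [Measure.prod_restrict]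
      refine (ae_restrict_iff' (((measurableSet_Icc).prod measurableSet_Icc).prod
        measurableSet_Ioi)).2 (ae_of_all _ ?_)
      rintro ⟨v, l⟩ ⟨-, hl⟩
      have hl' : 0 < l := hl
      simp only [Function.uncurry]
      rw [norm_mul, norm_mul, norm_planeWave, one_mul, Complex.norm_real, Complex.norm_real,
        Real.norm_eq_abs, Real.norm_eq_abs, abs_of_pos (Real.exp_pos _),
        abs_of_pos (Real.exp_pos _), one_mul]
      refine mul_le_of_le_one_right (Real.exp_pos _).le (Real.exp_le_one_iff.2 ?_)
      have := mul_nonneg hl'.le (hQ0 v)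
      linarith
  have hbox : ∀ L : ℝ, ∫ v in Icc (-L) L ×ˢ Icc (-L) L,
      planeWave s t v / ((ε + quadForm a b c v : ℝ) : ℂ)
      = ∫ l in Ioi (0 : ℝ), (Real.exp (-ε * l) : ℂ) * J L l := by
    intro L
    have h1 := integral_integral_swap (hprod L)
    simp_rw [integral_const_mul] at h1
    rw [hJ, ← h1]
    refine integral_congr_ae (ae_of_all _ fun v => ?_)
    have hpos : 0 < ε + quadForm a b c v := by linarith [hQ0 v]
    have h2 : ∀ l : ℝ, (Real.exp (-ε * l) : ℂ) *
        (planeWave s t v * (Real.exp (-(l * quadForm a b c v)) : ℂ))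
        = planeWave s t v * ((Real.exp (-(ε + quadForm a b c v) * l) : ℝ) : ℂ) := by
      intro l
      have : -(ε + quadForm a b c v) * l = -ε * l + -(l * quadForm a b c v) := by ring
      rw [this, Real.exp_add]
      push_cast; ring
    simp_rw [h2]
    rw [integral_const_mul, integral_complex_ofReal, integral_Ioi_exp_eq_inv hpos]
    push_cast
    rw [mul_one_div]
  have hlim : ∀ l : ℝ, 0 < l → Tendsto (fun L => J L l) atTop
      (𝓝 ((Real.pi / √(a * c - b ^ 2 / 4) *
        (Real.exp (-(dualForm a b c s t / (4 * l))) / l) : ℝ) : ℂ)) := by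
    intro l hl
    rw [← integral_planeWave_gaussian ha hc hD hl]
    have hint := integrable_planeWave_mul (integrable_exp_quadForm ha hc hD hl) s t
    have hcov := aecover_closedBall (μ := (volume : Measure (ℝ × ℝ))) (x := (0, 0))
      (tendsto_id (α := ℝ) (x := atTop))
    have := hcov.integral_tendsto_of_countably_generated hint
    refine this.congr fun L => ?_
    rw [hJ]
    simp only [id]
    rw [← closedBall_prod_same, Real.closedBall_eq_Icc]
    simp
  -- dominated convergence in `l`, with majorant `C l ^ (-1/2) e^{-εl}`
  obtain ⟨C, hC⟩ := exists_box_bound ha hc hD hst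
  unfold HasImproperIntegral
  simp_rw [hbox]
  have hint_bound : Integrable (fun l : ℝ => C * (l ^ (-(1 / 2) : ℝ) * Real.exp (-ε * l ^ (1 : ℝ))))
      (volume.restrict (Ioi 0)) :=
    Integrable.const_mul (integrableOn_rpow_mul_exp_neg_mul_rpow (by norm_num) one_pos hε) C
  have hdct := tendsto_integral_filter_of_dominated_convergence
    (μ := volume.restrict (Ioi (0 : ℝ))) (l := atTop)
    (F := fun (L : ℝ) (l : ℝ) => (Real.exp (-ε * l) : ℂ) * J L l)
    (f := fun l => ((Real.pi / √(a * c - b ^ 2 / 4) *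
        besselKernel ε (dualForm a b c s t) l : ℝ) : ℂ))
    _ ?_ ?_ hint_bound ?_
  · rw [integral_complex_ofReal, integral_const_mul] at hdct
    exact hdct
  · refine Eventually.of_forall fun L => ?_
    have := (hprod L).swap.aestronglyMeasurable.integral_prod_right'
    refine this.congr (ae_of_all _ fun l => ?_)
    simp only [Function.comp, Prod.swap_prod_mk, Function.uncurry]
    rw [integral_const_mul]
  · filter_upwards [eventually_ge_atTop 0] with L hL
    refine (ae_restrict_iff' measurableSet_Ioi).2 (ae_of_all _ fun l hl => ?_)
    rw [norm_mul, Complex.norm_real, Real.norm_eq_abs, abs_of_pos (Real.exp_pos _), Real.rpow_one]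
    have := hC l L hl hL
    calc _ ≤ Real.exp (-ε * l) * (C * l ^ (-(1 / 2) : ℝ)) := by gcongr
      _ = _ := by ring
  · refine (ae_restrict_iff' measurableSet_Ioi).2 (ae_of_all _ fun l hl => ?_)
    have := (hlim l hl).const_mul (Real.exp (-ε * l) : ℂ)
    convert this using 2
    rw [← Complex.ofReal_mul]
    congr 1
    unfold besselKernel
    have : -(ε * l) - dualForm a b c s t / (4 * l)
        = -ε * l + -(dualForm a b c s t / (4 * l)) := by ring
    rw [this, Real.exp_add]
    ring

/-- The part of the Laplace representation of `1 / (ε + Q)` over `l > 1`: it has the same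
singularity at the origin, but decays like a Gaussian. -/
def gaussCutoff (a b c ε : ℝ) (v : ℝ × ℝ) : ℝ :=
  Real.exp (-(ε + quadForm a b c v)) / (ε + quadForm a b c v)

theorem integrable_gaussCutoff (ha : 0 < a) (hc : 0 < c) (hD : 0 < a * c - b ^ 2 / 4)
    {ε : ℝ} (hε : 0 < ε) : Integrable (gaussCutoff a b c ε) := by
  have hQ0 := quadForm_nonneg ha hc hD
  have hQc := continuous_quadForm a b c
  refine ((integrable_exp_quadForm ha hc hD one_pos).const_mul (1 / ε)).mono' ?_
    (ae_of_all _ fun v => ?_)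
  · refine Continuous.aestronglyMeasurable ?_
    unfold gaussCutoff
    exact Continuous.div (by fun_prop) (by fun_prop) fun v => by linarith [hQ0 v]
  · have hpos : 0 < ε + quadForm a b c v := by linarith [hQ0 v]
    unfold gaussCutoff
    rw [Real.norm_eq_abs, abs_of_pos (by positivity), div_eq_mul_one_div, mul_comm]
    gcongr
    · linarith [hQ0 v]
    · linarith

theorem integral_planeWave_gaussCutoff (ha : 0 < a) (hc : 0 < c) (hD : 0 < a * c - b ^ 2 / 4)
    {ε : ℝ} (hε : 0 < ε) (s t : ℤ) :
    ∫ v, planeWave s t v * (gaussCutoff a b c ε v : ℂ)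
      = ((Real.pi / √(a * c - b ^ 2 / 4) *
        ∫ l in Ioi 1, besselKernel ε (dualForm a b c s t) l : ℝ) : ℂ) := by
  have hQ0 := quadForm_nonneg ha hc hD
  have hQc := continuous_quadForm a b c
  have hWc := continuous_planeWave s t
  have hprod : Integrable (Function.uncurry fun (v : ℝ × ℝ) (l : ℝ) =>
      (Real.exp (-ε * l) : ℂ) * (planeWave s t v * (Real.exp (-(l * quadForm a b c v)) : ℂ)))
      ((volume : Measure (ℝ × ℝ)).prod (volume.restrict (Ioi 1))) := by
    have hdom := (integrable_exp_quadForm ha hc hD one_pos).mul_prod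
      (integrableOn_exp_mul_Ioi (neg_lt_zero.2 hε) 1)
    refine hdom.mono' ?_ ?_
    · refine Continuous.aestronglyMeasurable ?_
      unfold Function.uncurry
      fun_prop
    · have hrestr : (volume : Measure (ℝ × ℝ)).prod (volume.restrict (Ioi (1 : ℝ)))
          = ((volume : Measure (ℝ × ℝ)).prod volume).restrict (univ ×ˢ Ioi 1) := by
        rw [← Measure.prod_restrict, Measure.restrict_univ]
      rw [hrestr]
      refine (ae_restrict_iff' (MeasurableSet.univ.prod measurableSet_Ioi)).2 (ae_of_all _ ?_)
      rintro ⟨v, l⟩ ⟨-, hl⟩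
      have hl' : 1 < l := hl
      simp only [Function.uncurry]
      rw [norm_mul, norm_mul, norm_planeWave, one_mul, Complex.norm_real, Complex.norm_real,
        Real.norm_eq_abs, Real.norm_eq_abs, abs_of_pos (Real.exp_pos _),
        abs_of_pos (Real.exp_pos _), mul_comm]
      gcongr
      exact hQ0 v
  have h1 := integral_integral_swap hprod
  simp_rw [integral_const_mul] at h1
  have hleft : ∀ v, ∫ l in Ioi (1 : ℝ), (Real.exp (-ε * l) : ℂ) *
      (planeWave s t v * (Real.exp (-(l * quadForm a b c v)) : ℂ))
      = planeWave s t v * (gaussCutoff a b c ε v : ℂ) := by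
    intro v
    have hpos : 0 < ε + quadForm a b c v := by linarith [hQ0 v]
    have h2 : ∀ l : ℝ, (Real.exp (-ε * l) : ℂ) *
        (planeWave s t v * (Real.exp (-(l * quadForm a b c v)) : ℂ))
        = planeWave s t v * ((Real.exp (-(ε + quadForm a b c v) * l) : ℝ) : ℂ) := by
      intro l
      have : -(ε + quadForm a b c v) * l = -ε * l + -(l * quadForm a b c v) := by ring
      rw [this, Real.exp_add]
      push_cast; ring
    simp_rw [h2]
    rw [integral_const_mul, integral_complex_ofReal, integral_exp_mul_Ioi (neg_lt_zero.2 hpos)]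
    congr 2
    unfold gaussCutoff
    rw [mul_one, neg_div_neg_eq]
  simp_rw [hleft] at h1
  rw [h1, ← integral_const_mul, ← integral_complex_ofReal]
  refine setIntegral_congr_fun measurableSet_Ioi fun l hl => ?_
  have hl0 : (0 : ℝ) < l := lt_trans one_pos hl
  rw [integral_planeWave_gaussian ha hc hD hl0, ← Complex.ofReal_mul]
  congr 1
  unfold besselKernel
  have : -(ε * l) - dualForm a b c s t / (4 * l)
      = -ε * l + -(dualForm a b c s t / (4 * l)) := by ring
  rw [this, Real.exp_add]
  ring

end FourierIntegrals

/-! ### Simple roots of the characteristic polynomial -/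

section SimpleRoots

variable {τ : Finset (ℤ × ℤ)}

theorem zDeriv_eq_sum {z : ℂ} (hz : z ≠ 0) (u : ℂ) :
    zDeriv τ z u = ∑ c ∈ τ, (c.1 : ℂ) * (z ^ c.1 * u ^ c.2) := by
  have h : HasDerivAt (fun z' => charPoly τ z' u)
      (∑ c ∈ τ, ((c.1 : ℂ) * z ^ (c.1 - 1)) * u ^ c.2) z := by
    unfold charPoly
    exact HasDerivAt.fun_sum fun c _ =>
      (hasDerivAt_zpow c.1 z (Or.inl hz)).mul_const (u ^ c.2)
  rw [zDeriv, h.deriv, Finset.mul_sum]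
  refine Finset.sum_congr rfl fun c _ => ?_
  rw [zpow_sub_one₀ hz]
  field_simp

theorem uDeriv_eq_sum (z : ℂ) {u : ℂ} (hu : u ≠ 0) :
    uDeriv τ z u = ∑ c ∈ τ, (c.2 : ℂ) * (z ^ c.1 * u ^ c.2) := by
  have h : HasDerivAt (fun u' => charPoly τ z u')
      (∑ c ∈ τ, z ^ c.1 * ((c.2 : ℂ) * u ^ (c.2 - 1))) u := by
    unfold charPoly
    exact HasDerivAt.fun_sum fun c _ =>
      (hasDerivAt_zpow c.2 u (Or.inl hu)).const_mul (z ^ c.1)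
  rw [uDeriv, h.deriv, Finset.mul_sum]
  refine Finset.sum_congr rfl fun c _ => ?_
  rw [zpow_sub_one₀ hu]
  field_simp

theorem norm_sq_linear_eq_quadForm (q : ℂ × ℂ) (v : ℝ × ℝ) :
    ‖zDeriv τ q.1 q.2 * (v.1 : ℂ) + uDeriv τ q.1 q.2 * (v.2 : ℂ)‖ ^ 2
      = quadForm (quadA τ q) (quadB τ q) (quadC τ q) v := by
  unfold quadForm quadA quadB quadC
  simp only [← Complex.normSq_eq_norm_sq, Complex.normSq_apply, Complex.add_re, Complex.add_im,
    Complex.mul_re, Complex.mul_im, Complex.ofReal_re, Complex.ofReal_im, Complex.conj_re,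
    Complex.conj_im]
  ring

/-- The form is nondegenerate exactly when the two derivatives are not real multiples of each
other. -/
theorem quadDet_eq_im_sq (q : ℂ × ℂ) :
    quadDet τ q = (zDeriv τ q.1 q.2 * (starRingEnd ℂ) (uDeriv τ q.1 q.2)).im ^ 2 := by
  unfold quadDet quadA quadB quadC
  simp only [← Complex.normSq_eq_norm_sq, Complex.normSq_apply,
    Complex.mul_re, Complex.mul_im, Complex.conj_re, Complex.conj_im]
  ring

theorem IsSimpleRoot.quadDet_pos {q : ℂ × ℂ} (h : IsSimpleRoot τ q.1 q.2) : 0 < quadDet τ q := by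
  rw [quadDet_eq_im_sq]
  refine lt_of_le_of_ne (sq_nonneg _) (Ne.symm (pow_ne_zero 2 fun him => ?_))
  refine h.2.2 ((zDeriv τ q.1 q.2 * (starRingEnd ℂ) (uDeriv τ q.1 q.2)).re
    / Complex.normSq (uDeriv τ q.1 q.2)) ?_
  have h1 : zDeriv τ q.1 q.2 * (starRingEnd ℂ) (uDeriv τ q.1 q.2)
      = (((zDeriv τ q.1 q.2 * (starRingEnd ℂ) (uDeriv τ q.1 q.2)).re : ℝ) : ℂ) :=
    Complex.ext (by simp) (by rw [him]; simp)
  rw [Complex.ofReal_div, ← h1, ← Complex.mul_conj]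
  have h2 : (starRingEnd ℂ) (uDeriv τ q.1 q.2) ≠ 0 := by simpa using h.2.1
  field_simp

theorem IsSimpleRoot.quadC_pos {q : ℂ × ℂ} (h : IsSimpleRoot τ q.1 q.2) : 0 < quadC τ q :=
  pow_pos (norm_pos_iff.2 h.2.1) 2

theorem IsSimpleRoot.quadA_pos {q : ℂ × ℂ} (h : IsSimpleRoot τ q.1 q.2) : 0 < quadA τ q := by
  refine pow_pos (norm_pos_iff.2 fun h0 => h.2.2 0 ?_) 2
  rw [h0]; simp

/-- A monomial has no zero on the unit torus, so a polyomino with a simple root there has at least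
two cells. -/
theorem IsSimpleRoot.two_le_card {z u : ℂ} (hz : z ≠ 0) (hu : u ≠ 0) (h : IsSimpleRoot τ z u) :
    2 ≤ τ.card := by
  by_contra hlt
  have : τ.card = 0 ∨ τ.card = 1 := by omega
  rcases this with h0 | h1
  · rw [Finset.card_eq_zero] at h0
    apply h.2.1
    rw [uDeriv_eq_sum z hu, h0, Finset.sum_empty]
  · obtain ⟨c, rfl⟩ := Finset.card_eq_one.1 h1
    have h2 := h.1
    rw [charPoly, Finset.sum_singleton] at h2
    exact mul_ne_zero (zpow_ne_zero _ hz) (zpow_ne_zero _ hu) h2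

end SimpleRoots

section LocalExpansion

/-- The linear part of `planeSymbol τ` at the point whose exponential is `q`, without the
factor `i`. -/
def rootLinear (τ : Finset (ℤ × ℤ)) (q : ℂ × ℂ) (v : ℝ × ℝ) : ℂ :=
  zDeriv τ q.1 q.2 * (v.1 : ℂ) + uDeriv τ q.1 q.2 * (v.2 : ℂ)

/-- The quadratic form `|z p_z x + u p_u y|²` at the root `q`. -/
def rootForm (τ : Finset (ℤ × ℤ)) (q : ℂ × ℂ) : ℝ × ℝ → ℝ :=
  quadForm (quadA τ q) (quadB τ q) (quadC τ q)

theorem norm_rootLinear_sq (τ : Finset (ℤ × ℤ)) (q : ℂ × ℂ) (v : ℝ × ℝ) :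
    ‖rootLinear τ q v‖ ^ 2 = rootForm τ q v := norm_sq_linear_eq_quadForm q v

theorem norm_exp_I_sub_one_sub_le (u : ℝ) :
    ‖Complex.exp (Complex.I * u) - 1 - Complex.I * u‖ ≤ 3 * u ^ 2 := by
  rcases le_or_gt |u| 1 with h | h
  · have := Complex.norm_exp_sub_one_sub_id_le (x := Complex.I * u) (by simpa using h)
    have h2 : ‖Complex.I * (u : ℂ)‖ ^ 2 = u ^ 2 := by simp
    rw [h2] at this
    nlinarith [sq_nonneg u]
  · have h1 : ‖Complex.exp (Complex.I * u)‖ = 1 := by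
      rw [mul_comm]; exact Complex.norm_exp_ofReal_mul_I u
    have h2 : ‖Complex.I * (u : ℂ)‖ = |u| := by simp
    have h3 := norm_sub_le (Complex.exp (Complex.I * u) - 1) (Complex.I * u)
    have h4 := norm_sub_le (Complex.exp (Complex.I * u)) 1
    rw [h1, norm_one] at h4
    rw [h2] at h3
    nlinarith [sq_abs u]

/-- First order Taylor expansion of the characteristic polynomial in the angles. -/
theorem exists_norm_planeSymbol_add_sub_le (τ : Finset (ℤ × ℤ)) :
    ∃ C : ℝ, 0 ≤ C ∧ ∀ (q : ℂ × ℂ) (x : ℝ × ℝ),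
      Complex.exp (x.1 * Complex.I) = q.1 → Complex.exp (x.2 * Complex.I) = q.2 →
      ∀ v, ‖planeSymbol τ (x + v) - planeSymbol τ x - Complex.I * rootLinear τ q v‖
        ≤ C * ‖v‖ ^ 2 := by
  refine ⟨∑ c ∈ τ, 3 * (|(c.1 : ℝ)| + |(c.2 : ℝ)|) ^ 2,
    Finset.sum_nonneg fun c _ => by positivity, fun q x h1 h2 v => ?_⟩
  have hq1 : q.1 ≠ 0 := h1 ▸ Complex.exp_ne_zero _
  have hq2 : q.2 ≠ 0 := h2 ▸ Complex.exp_ne_zero _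
  have hrw : planeSymbol τ (x + v) - planeSymbol τ x - Complex.I * rootLinear τ q v
      = ∑ c ∈ τ, planeWave c.1 c.2 x *
        (Complex.exp (Complex.I * ((c.1 * v.1 + c.2 * v.2 : ℝ) : ℂ)) - 1
          - Complex.I * ((c.1 * v.1 + c.2 * v.2 : ℝ) : ℂ)) := by
    rw [rootLinear, zDeriv_eq_sum hq1, uDeriv_eq_sum _ hq2, Finset.sum_mul, Finset.sum_mul,
      ← Finset.sum_add_distrib, Finset.mul_sum, planeSymbol, planeSymbol,
      ← Finset.sum_sub_distrib, ← Finset.sum_sub_distrib]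
    refine Finset.sum_congr rfl fun c _ => ?_
    rw [planeWave_add, ← h1, ← h2, ← planeWave_eq_zpow]
    have : planeWave c.1 c.2 v
        = Complex.exp (Complex.I * ((c.1 * v.1 + c.2 * v.2 : ℝ) : ℂ)) := by
      unfold planeWave; push_cast; rfl
    rw [this]
    push_cast
    ring
  rw [hrw, Finset.sum_mul]
  refine norm_sum_le_of_le _ fun c _ => ?_
  rw [norm_mul, norm_planeWave, one_mul]
  refine (norm_exp_I_sub_one_sub_le _).trans ?_
  rw [mul_assoc, ← mul_pow]
  refine mul_le_mul_of_nonneg_left ?_ (by norm_num)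
  rw [← sq_abs]
  refine pow_le_pow_left₀ (abs_nonneg _) ?_ 2
  have hv1 : |v.1| ≤ ‖v‖ := norm_fst_le v
  have hv2 : |v.2| ≤ ‖v‖ := norm_snd_le v
  calc |(c.1 : ℝ) * v.1 + c.2 * v.2| ≤ |(c.1 : ℝ)| * |v.1| + |(c.2 : ℝ)| * |v.2| := by
        rw [← abs_mul, ← abs_mul]; exact abs_add_le _ _
    _ ≤ (|(c.1 : ℝ)| + |(c.2 : ℝ)|) * ‖v‖ := by
        rw [add_mul]; gcongr

end LocalExpansion

/-! ### Positions of the roots and estimates at a single root -/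

section RootPositions

open Set

theorem eq_of_exp_eq_of_mem_Ioc {a u v : ℝ} (hu : u ∈ Ioc a (a + 2 * Real.pi))
    (hv : v ∈ Ioc a (a + 2 * Real.pi))
    (h : Complex.exp (u * Complex.I) = Complex.exp (v * Complex.I)) : u = v := by
  obtain ⟨n, hn⟩ := Complex.exp_eq_exp_iff_exists_int.1 h
  have h1 : u = v + n * (2 * Real.pi) := by
    have h2 := congrArg Complex.im hn
    simpa using h2
  have hpi := Real.pi_pos
  have h3 : n < 1 := by
    have : (n : ℝ) < 1 := by
      by_contra hc
      push Not at hc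
      nlinarith [hu.1, hu.2, hv.1, hv.2]
    exact_mod_cast this
  have h4 : -1 < n := by
    have : (-1 : ℝ) < n := by
      by_contra hc
      push Not at hc
      nlinarith [hu.1, hu.2, hv.1, hv.2]
    exact_mod_cast this
  have : n = 0 := by omega
  rw [h1, this]; simp

theorem exists_base_angle (S : Finset ℂ) : ∃ a : ℝ, Complex.exp (a * Complex.I) ∉ S := by
  by_contra! h
  have hinj : InjOn (fun a : ℝ => Complex.exp (a * Complex.I)) (Ioc 0 (0 + 2 * Real.pi)) :=
    fun u hu v hv huv => eq_of_exp_eq_of_mem_Ioc hu hv huv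
  have hfin : (Ioc (0 : ℝ) (0 + 2 * Real.pi)).Finite :=
    Set.Finite.of_injOn (fun a _ => h a) hinj S.finite_toSet
  exact Set.Ioc_infinite (by linarith [Real.pi_pos]) hfin

theorem exists_angle {a : ℝ} {z : ℂ} (hz : ‖z‖ = 1) (ha : Complex.exp (a * Complex.I) ≠ z) :
    ∃ x ∈ Ioo a (a + 2 * Real.pi), Complex.exp (x * Complex.I) = z := by
  have hmem := toIocMod_mem_Ioc Real.two_pi_pos a (Complex.arg z)
  have hexp : Complex.exp ((toIocMod Real.two_pi_pos a (Complex.arg z) : ℝ) * Complex.I) = z := by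
    have harg := Complex.norm_mul_exp_arg_mul_I z
    rw [hz, Complex.ofReal_one, one_mul] at harg
    refine Eq.trans ?_ harg
    refine Complex.exp_eq_exp_iff_exists_int.2
      ⟨-toIocDiv Real.two_pi_pos a (Complex.arg z), ?_⟩
    rw [toIocMod, zsmul_eq_mul]
    push_cast
    ring
  refine ⟨_, ⟨hmem.1, lt_of_le_of_ne hmem.2 fun he => ha ?_⟩, hexp⟩
  rw [← hexp, he]
  push_cast
  rw [add_mul, Complex.exp_add, Complex.exp_two_pi_mul_I, mul_one]

/-- The half-open period square with corner `(a, a)`. -/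
def periodSquare (a : ℝ) : Set (ℝ × ℝ) :=
  Ioc a (a + 2 * Real.pi) ×ˢ Ioc a (a + 2 * Real.pi)

/-- A period square can be chosen with no root on its boundary; `x q` is the position in it of
the root `q`. -/
theorem exists_root_positions {τ : Finset (ℤ × ℤ)} {R : Finset (ℂ × ℂ)}
    (hR : ∀ q : ℂ × ℂ, q ∈ R ↔ ‖q.1‖ = 1 ∧ ‖q.2‖ = 1 ∧ charPoly τ q.1 q.2 = 0) :
    ∃ (a : ℝ) (x : ℂ × ℂ → ℝ × ℝ),
      (∀ q ∈ R, x q ∈ Ioo a (a + 2 * Real.pi) ×ˢ Ioo a (a + 2 * Real.pi)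
        ∧ Complex.exp ((x q).1 * Complex.I) = q.1 ∧ Complex.exp ((x q).2 * Complex.I) = q.2) ∧
      ∀ v ∈ Icc a (a + 2 * Real.pi) ×ˢ Icc a (a + 2 * Real.pi), planeSymbol τ v = 0 →
        ∃ q ∈ R, v = x q := by
  obtain ⟨a, ha⟩ := exists_base_angle (R.image Prod.fst ∪ R.image Prod.snd)
  have ha1 : ∀ q ∈ R, Complex.exp (a * Complex.I) ≠ q.1 := fun q hq h =>
    ha (Finset.mem_union_left _ (Finset.mem_image.2 ⟨q, hq, h.symm⟩))
  have ha2 : ∀ q ∈ R, Complex.exp (a * Complex.I) ≠ q.2 := fun q hq h =>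
    ha (Finset.mem_union_right _ (Finset.mem_image.2 ⟨q, hq, h.symm⟩))
  have hex : ∀ q ∈ R, ∃ x : ℝ × ℝ, x ∈ Ioo a (a + 2 * Real.pi) ×ˢ Ioo a (a + 2 * Real.pi)
      ∧ Complex.exp (x.1 * Complex.I) = q.1 ∧ Complex.exp (x.2 * Complex.I) = q.2 := by
    intro q hq
    obtain ⟨x1, hx1, he1⟩ := exists_angle ((hR q).1 hq).1 (ha1 q hq)
    obtain ⟨x2, hx2, he2⟩ := exists_angle ((hR q).1 hq).2.1 (ha2 q hq)
    exact ⟨(x1, x2), ⟨hx1, hx2⟩, he1, he2⟩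
  choose! x hx using hex
  refine ⟨a, x, hx, fun v hv h0 => ?_⟩
  have hqR : (Complex.exp (v.1 * Complex.I), Complex.exp (v.2 * Complex.I)) ∈ R := by
    rw [hR]
    refine ⟨Complex.norm_exp_ofReal_mul_I _, Complex.norm_exp_ofReal_mul_I _, ?_⟩
    rw [← h0, planeSymbol_eq_charPoly]
  have hlow : ∀ y ∈ Icc a (a + 2 * Real.pi),
      Complex.exp (a * Complex.I) ≠ Complex.exp (y * Complex.I) →
      y ∈ Ioc a (a + 2 * Real.pi) := by
    intro y hy hne
    refine ⟨lt_of_le_of_ne hy.1 fun h => hne (by rw [h]), hy.2⟩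
  refine ⟨_, hqR, ?_⟩
  obtain ⟨hm, h1, h2⟩ := hx _ hqR
  refine Prod.ext ?_ ?_
  · exact eq_of_exp_eq_of_mem_Ioc (hlow _ hv.1 (ha1 _ hqR)) (Ioo_subset_Ioc_self hm.1) h1.symm
  · exact eq_of_exp_eq_of_mem_Ioc (hlow _ hv.2 (ha2 _ hqR)) (Ioo_subset_Ioc_self hm.2) h2.symm

end RootPositions

section Analysis

open Set MeasureTheory

/-- The Riemann–Lebesgue lemma. -/
theorem integral_planeWave_small (f : ℝ × ℝ → ℝ) {η : ℝ} (hη : 0 < η) :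
    ∃ ρ : ℝ, ∀ s t : ℤ, ρ < (s : ℝ) ^ 2 + (t : ℝ) ^ 2 →
      ‖∫ v, planeWave s t v * (f v : ℂ)‖ ≤ η := by
  have h := tendsto_integral_exp_smul_cocompact (fun v : ℝ × ℝ => (f v : ℂ)) volume
  have h1 := (h.norm).eventually (Iio_mem_nhds (show ‖(0 : ℂ)‖ < η by rwa [norm_zero]))
  rw [← Metric.cobounded_eq_cocompact, ← comap_norm_atTop, eventually_comap] at h1
  obtain ⟨r, hr⟩ := eventually_atTop.1 h1
  set r' := max r 0
  refine ⟨2 * (2 * Real.pi * r') ^ 2, fun s t hst => ?_⟩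
  set w : StrongDual ℝ (ℝ × ℝ) := -(1 / (2 * Real.pi)) •
    ((s : ℝ) • ContinuousLinearMap.fst ℝ ℝ ℝ + (t : ℝ) • ContinuousLinearMap.snd ℝ ℝ ℝ) with hw
  have hwv : ∀ v, w v = -((s * v.1 + t * v.2) / (2 * Real.pi)) := by
    intro v
    simp [hw]
    ring
  have hpi := Real.pi_pos
  have hnorm : r ≤ ‖w‖ := by
    have hs : |(s : ℝ)| ≤ 2 * Real.pi * ‖w‖ := by
      have h2 := w.le_opNorm ((1 : ℝ), (0 : ℝ))
      have h3 : ‖((1 : ℝ), (0 : ℝ))‖ = 1 := by simp [Prod.norm_def]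
      rw [hwv, h3, mul_one, norm_neg, Real.norm_eq_abs, mul_one, mul_zero, add_zero, abs_div,
        abs_of_pos Real.two_pi_pos, div_le_iff₀ Real.two_pi_pos] at h2
      linarith
    have ht : |(t : ℝ)| ≤ 2 * Real.pi * ‖w‖ := by
      have h2 := w.le_opNorm ((0 : ℝ), (1 : ℝ))
      have h3 : ‖((0 : ℝ), (1 : ℝ))‖ = 1 := by simp [Prod.norm_def]
      rw [hwv, h3, mul_one, norm_neg, Real.norm_eq_abs, mul_one, mul_zero, zero_add, abs_div,
        abs_of_pos Real.two_pi_pos, div_le_iff₀ Real.two_pi_pos] at h2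
      linarith
    have h4 : (s : ℝ) ^ 2 + (t : ℝ) ^ 2 ≤ 2 * (2 * Real.pi * ‖w‖) ^ 2 := by
      rw [← sq_abs (s : ℝ), ← sq_abs (t : ℝ)]
      have := pow_le_pow_left₀ (abs_nonneg _) hs 2
      have := pow_le_pow_left₀ (abs_nonneg _) ht 2
      linarith
    have h5 : r' ^ 2 < ‖w‖ ^ 2 := by
      have h6 := hst.trans_le h4
      rw [mul_pow, mul_pow _ ‖w‖] at h6
      have : 0 < (2 * Real.pi) ^ 2 := by positivity
      nlinarith
    exact (le_max_left r 0).trans (lt_of_pow_lt_pow_left₀ 2 (norm_nonneg _) h5).le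
  have h7 := hr ‖w‖ hnorm w rfl
  refine le_of_eq_of_le ?_ h7.le
  congr 2
  funext v
  rw [Circle.smul_def, smul_eq_mul, Real.fourierChar_apply, hwv]
  congr 1
  unfold planeWave
  congr 1
  push_cast
  have : (Real.pi : ℂ) ≠ 0 := by exact_mod_cast hpi.ne'
  field_simp

/-- The radial majorant at a root: an integrable singularity of order one with Gaussian decay. -/
def radialBound (m : ℝ) (w : ℝ × ℝ) : ℝ := (1 + ‖w‖⁻¹) * Real.exp (-m * ‖w‖ ^ 2)

theorem radialBound_nonneg (m : ℝ) (w : ℝ × ℝ) : 0 ≤ radialBound m w := by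
  unfold radialBound; positivity

theorem integrable_radialBound {m : ℝ} (hm : 0 < m) : Integrable (radialBound m) := by
  have h : IntegrableOn (fun y : ℝ => y ^ (Module.finrank ℝ (ℝ × ℝ) - 1) •
      ((1 + y⁻¹) * Real.exp (-m * y ^ 2))) (Ioi 0) := by
    have h1 := ((integrable_mul_exp_neg_mul_sq hm).add (integrable_exp_neg_mul_sq hm)).integrableOn
      (s := Ioi 0)
    refine h1.congr_fun (fun y hy => ?_) measurableSet_Ioi
    have hy0 : y ≠ 0 := (show (0 : ℝ) < y from hy).ne'
    simp only [Module.finrank_prod, Module.finrank_self, Pi.add_apply, smul_eq_mul]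
    norm_num
    field_simp
  exact (integrable_fun_norm_addHaar (volume : Measure (ℝ × ℝ))
    (f := fun y : ℝ => (1 + y⁻¹) * Real.exp (-m * y ^ 2))).2 h

end Analysis

section SingleRoot

theorem rootForm_lower {τ : Finset (ℤ × ℤ)} {q : ℂ × ℂ} (h : IsSimpleRoot τ q.1 q.2) :
    ∃ m : ℝ, 0 < m ∧ ∀ w, m * ‖w‖ ^ 2 ≤ rootForm τ q w := by
  have hA := h.quadA_pos
  have hC := h.quadC_pos
  have hD := h.quadDet_pos
  refine ⟨quadDet τ q / (quadA τ q + quadC τ q), by positivity, fun w => ?_⟩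
  refine le_trans ?_ (quadForm_lower hA hC w)
  refine mul_le_mul_of_nonneg_left ?_ (by positivity)
  rw [Prod.norm_def]
  rcases max_choice ‖w.1‖ ‖w.2‖ with h | h <;> rw [h, Real.norm_eq_abs, sq_abs]
  · linarith [sq_nonneg w.2]
  · linarith [sq_nonneg w.1]

theorem norm_rootLinear_le (τ : Finset (ℤ × ℤ)) (q : ℂ × ℂ) (w : ℝ × ℝ) :
    ‖rootLinear τ q w‖ ≤ (‖zDeriv τ q.1 q.2‖ + ‖uDeriv τ q.1 q.2‖) * ‖w‖ := by
  unfold rootLinear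
  refine (norm_add_le _ _).trans ?_
  rw [norm_mul, norm_mul, Complex.norm_real, Complex.norm_real, add_mul]
  gcongr
  · exact norm_fst_le w
  · exact norm_snd_le w

/-- Near a simple root `|p|²` may be replaced by its quadratic part: the reciprocals differ by
`O(1/‖w‖)`, which is integrable in the plane, uniformly in `ε ≥ 0`. -/
theorem exists_reciprocal_sub_le {τ : Finset (ℤ × ℤ)} {q : ℂ × ℂ} (h : IsSimpleRoot τ q.1 q.2)
    {x : ℝ × ℝ} (h1 : Complex.exp (x.1 * Complex.I) = q.1)
    (h2 : Complex.exp (x.2 * Complex.I) = q.2) :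
    ∃ δ : ℝ, 0 < δ ∧ ∃ K : ℝ, 0 ≤ K ∧ ∀ ε : ℝ, 0 ≤ ε → ∀ w : ℝ × ℝ, ‖w‖ ≤ δ →
      |1 / (ε + ‖planeSymbol τ (x + w)‖ ^ 2) - 1 / (ε + rootForm τ q w)| ≤ K * ‖w‖⁻¹ := by
  obtain ⟨C, hC, hexp⟩ := exists_norm_planeSymbol_add_sub_le τ
  obtain ⟨m, hm, hlow⟩ := rootForm_lower h
  have hx0 : planeSymbol τ x = 0 := by
    rw [planeSymbol_eq_charPoly, h1, h2]; exact h.1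
  set Λ : ℝ := ‖zDeriv τ q.1 q.2‖ + ‖uDeriv τ q.1 q.2‖ with hΛ
  have hΛ0 : 0 ≤ Λ := by positivity
  set μ : ℝ := √m with hμ
  have hμ0 : 0 < μ := Real.sqrt_pos.2 hm
  have hμm : μ ^ 2 = m := Real.sq_sqrt hm.le
  -- so small that the quadratic error is at most half of the linear term
  set δ : ℝ := min 1 (μ / (2 * (C + 1))) with hδ
  refine ⟨δ, by positivity, C * (2 * Λ + C) / (m * (m / 4)), by positivity, fun ε hε w hw => ?_⟩
  have hw1 : ‖w‖ ≤ 1 := hw.trans (min_le_left _ _)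
  have hwμ : C * ‖w‖ ≤ μ / 2 := by
    have h3 : ‖w‖ ≤ μ / (2 * (C + 1)) := hw.trans (min_le_right _ _)
    rw [le_div_iff₀ (by positivity)] at h3
    nlinarith [norm_nonneg w]
  rcases (norm_nonneg w).eq_or_lt with h0 | hwpos
  · have hw0 : w = 0 := norm_eq_zero.1 h0.symm
    have : rootForm τ q w = 0 := by rw [hw0]; simp [rootForm, quadForm]
    rw [this, hw0, add_zero x, hx0]
    simp
  set P := planeSymbol τ (x + w) with hP
  set L := rootLinear τ q w with hL
  have hexp' : ‖P - Complex.I * L‖ ≤ C * ‖w‖ ^ 2 := by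
    have := hexp q x h1 h2 w
    rwa [hx0, sub_zero] at this
  have hIL : ‖Complex.I * L‖ = ‖L‖ := by simp
  have hLsq : ‖L‖ ^ 2 = rootForm τ q w := norm_rootLinear_sq τ q w
  have hLle : ‖L‖ ≤ Λ * ‖w‖ := norm_rootLinear_le τ q w
  have hLge : μ * ‖w‖ ≤ ‖L‖ := by
    refine le_of_sq_le_sq ?_ (norm_nonneg _)
    rw [mul_pow, hμm, hLsq]; exact hlow w
  have hd1 : ‖P‖ - ‖L‖ ≤ C * ‖w‖ ^ 2 := by
    rw [← hIL]; exact (norm_sub_norm_le _ _).trans hexp'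
  have hd2 : ‖L‖ - ‖P‖ ≤ C * ‖w‖ ^ 2 := by
    rw [← hIL]; refine (norm_sub_norm_le _ _).trans ?_
    rw [norm_sub_rev]; exact hexp'
  have hPge : μ / 2 * ‖w‖ ≤ ‖P‖ := by nlinarith
  have hPsq : m / 4 * ‖w‖ ^ 2 ≤ ‖P‖ ^ 2 := by
    have := pow_le_pow_left₀ (by positivity) hPge 2
    rw [← hμm]; nlinarith
  have hQsq : m * ‖w‖ ^ 2 ≤ rootForm τ q w := hlow w
  have hw2 : 0 < ‖w‖ ^ 2 := by positivity
  have hA : 0 < ε + ‖P‖ ^ 2 := by nlinarith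
  have hB : 0 < ε + rootForm τ q w := by nlinarith
  have hnum : |rootForm τ q w - ‖P‖ ^ 2| ≤ C * (2 * Λ + C) * ‖w‖ ^ 3 := by
    rw [← hLsq]
    have : ‖L‖ ^ 2 - ‖P‖ ^ 2 = (‖L‖ - ‖P‖) * (‖L‖ + ‖P‖) := by ring
    rw [this, abs_mul, abs_of_nonneg (by positivity : 0 ≤ ‖L‖ + ‖P‖)]
    have h4 : |‖L‖ - ‖P‖| ≤ C * ‖w‖ ^ 2 := abs_le.2 ⟨by linarith, hd2⟩
    have h5 : ‖L‖ + ‖P‖ ≤ (2 * Λ + C) * ‖w‖ := by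
      have : C * ‖w‖ ^ 2 ≤ C * ‖w‖ := by
        refine mul_le_mul_of_nonneg_left ?_ hC
        nlinarith
      linarith
    calc _ ≤ C * ‖w‖ ^ 2 * ((2 * Λ + C) * ‖w‖) := by gcongr
      _ = _ := by ring
  rw [div_sub_div _ _ hA.ne' hB.ne', abs_div, abs_of_pos (mul_pos hA hB)]
  have hrw : 1 * (ε + rootForm τ q w) - (ε + ‖P‖ ^ 2) * 1 = rootForm τ q w - ‖P‖ ^ 2 := by ring
  rw [hrw]
  calc |rootForm τ q w - ‖P‖ ^ 2| / ((ε + ‖P‖ ^ 2) * (ε + rootForm τ q w))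
      ≤ C * (2 * Λ + C) * ‖w‖ ^ 3 / ((m / 4 * ‖w‖ ^ 2) * (m * ‖w‖ ^ 2)) := by
        gcongr
        · linarith
        · linarith
    _ = _ := by field_simp

/-- Restricting `1 / (ε + Q)` to a ball, or cutting it off by the exponential, makes a difference
bounded by a Gaussian. -/
theorem exists_cutoff_sub_le {τ : Finset (ℤ × ℤ)} {q : ℂ × ℂ} (h : IsSimpleRoot τ q.1 q.2)
    {δ : ℝ} (hδ : 0 < δ) :
    ∃ m : ℝ, 0 < m ∧ ∃ K : ℝ, 0 ≤ K ∧ ∀ ε : ℝ, 0 ≤ ε → ∀ w : ℝ × ℝ,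
      |(if ‖w‖ < δ then 1 / (ε + rootForm τ q w) else 0)
        - gaussCutoff (quadA τ q) (quadB τ q) (quadC τ q) ε w| ≤ K * radialBound m w := by
  obtain ⟨m, hm, hlow⟩ := rootForm_lower h
  refine ⟨m, hm, max (Real.exp (m * δ ^ 2)) (1 / (m * δ ^ 2)), by positivity, fun ε hε w => ?_⟩
  have hgc : gaussCutoff (quadA τ q) (quadB τ q) (quadC τ q) ε w
      = Real.exp (-(ε + rootForm τ q w)) / (ε + rootForm τ q w) := rfl
  have hrad : Real.exp (-m * ‖w‖ ^ 2) ≤ radialBound m w := by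
    unfold radialBound
    have : 0 ≤ ‖w‖⁻¹ * Real.exp (-m * ‖w‖ ^ 2) := by positivity
    linarith
  have hQ0 : 0 ≤ rootForm τ q w := le_trans (by positivity) (hlow w)
  rw [hgc]
  set X := ε + rootForm τ q w with hX
  have hX0 : 0 ≤ X := by positivity
  split_ifs with hw
  · have h1 : |1 / X - Real.exp (-X) / X| ≤ 1 := by
      rw [← sub_div, abs_div, abs_of_nonneg hX0,
        abs_of_nonneg (sub_nonneg.2 (Real.exp_le_one_iff.2 (by linarith)))]
      refine div_le_one_of_le₀ ?_ hX0
      linarith [Real.add_one_le_exp (-X)]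
    refine h1.trans ?_
    have h2 : 1 ≤ Real.exp (m * δ ^ 2) * Real.exp (-m * ‖w‖ ^ 2) := by
      rw [← Real.exp_add]
      refine Real.one_le_exp ?_
      have : ‖w‖ ^ 2 ≤ δ ^ 2 := pow_le_pow_left₀ (norm_nonneg _) hw.le 2
      nlinarith
    refine h2.trans ?_
    gcongr
    exact le_max_left _ _
  · push Not at hw
    have hw2 : m * δ ^ 2 ≤ X := by
      have : δ ^ 2 ≤ ‖w‖ ^ 2 := pow_le_pow_left₀ hδ.le hw 2
      have := hlow w
      nlinarith
    have hXpos : 0 < X := lt_of_lt_of_le (by positivity) hw2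
    rw [zero_sub, abs_neg, abs_of_nonneg (by positivity), div_eq_mul_one_div, mul_comm]
    have h3 : Real.exp (-X) ≤ Real.exp (-m * ‖w‖ ^ 2) := by
      refine Real.exp_le_exp.2 ?_
      have := hlow w
      linarith
    calc 1 / X * Real.exp (-X) ≤ 1 / (m * δ ^ 2) * radialBound m w := by
          gcongr
          exact h3.trans hrad
      _ ≤ _ := by
          have := radialBound_nonneg m w
          gcongr
          exact le_max_right _ _

end SingleRoot

/-! ### Subtraction of the singularities at the roots -/

section Residual

open Set MeasureTheory

/-- The cut-off reciprocal `e^{-(ε + Q)} / (ε + Q)` for the quadratic form `Q` at the root `q`. -/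
def rootCutoff (τ : Finset (ℤ × ℤ)) (q : ℂ × ℂ) (ε : ℝ) : ℝ × ℝ → ℝ :=
  gaussCutoff (quadA τ q) (quadB τ q) (quadC τ q) ε

/-- What remains of `1 / (ε + |p|²)` on the period square after its singular parts at the roots
have been subtracted. -/
def residual (τ : Finset (ℤ × ℤ)) (R : Finset (ℂ × ℂ)) (a : ℝ) (x : ℂ × ℂ → ℝ × ℝ) (ε : ℝ)
    (v : ℝ × ℝ) : ℝ :=
  (periodSquare a).indicator (fun v => 1 / (ε + ‖planeSymbol τ v‖ ^ 2)) v
    - ∑ q ∈ R, rootCutoff τ q ε (v - x q)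

/-- The dual form `(c s² - b s t + a t²) / D` at the root `q`. -/
def rootDual (τ : Finset (ℤ × ℤ)) (q : ℂ × ℂ) (s t : ℤ) : ℝ :=
  dualForm (quadA τ q) (quadB τ q) (quadC τ q) s t

/-- The Fourier integral of the cut-off reciprocal at the root `q`: the part over `l > 1` of the
integral representing `J`. -/
def rootTail (τ : Finset (ℤ × ℤ)) (q : ℂ × ℂ) (ε : ℝ) (s t : ℤ) : ℝ :=
  Real.pi / √(quadDet τ q) * ∫ l in Ioi 1, besselKernel ε (rootDual τ q s t) l

theorem measurableSet_periodSquare (a : ℝ) : MeasurableSet (periodSquare a) :=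
  measurableSet_Ioc.prod measurableSet_Ioc

theorem measurable_rootCutoff (τ : Finset (ℤ × ℤ)) (q : ℂ × ℂ) (ε : ℝ) :
    Measurable (rootCutoff τ q ε) := by
  have h := (continuous_quadForm (quadA τ q) (quadB τ q) (quadC τ q)).measurable
  unfold rootCutoff gaussCutoff
  fun_prop

theorem measurable_residual (τ : Finset (ℤ × ℤ)) (R : Finset (ℂ × ℂ)) (a : ℝ)
    (x : ℂ × ℂ → ℝ × ℝ) (ε : ℝ) : Measurable (residual τ R a x ε) := by
  have h := (continuous_planeSymbol τ).measurable
  refine Measurable.sub (Measurable.indicator (by fun_prop) (measurableSet_periodSquare a))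
    (Finset.measurable_sum _ fun q _ => ?_)
  exact (measurable_rootCutoff τ q ε).comp (by fun_prop)

variable {τ : Finset (ℤ × ℤ)} {R : Finset (ℂ × ℂ)} {a : ℝ} {x : ℂ × ℂ → ℝ × ℝ}

/-- The residual is dominated by an integrable function, uniformly in `ε ≥ 0`: its singularities at
the roots are of order one. -/
theorem exists_residual_bound (hsimple : ∀ q ∈ R, IsSimpleRoot τ q.1 q.2)
    (hx : ∀ q ∈ R, x q ∈ Ioo a (a + 2 * Real.pi) ×ˢ Ioo a (a + 2 * Real.pi)
      ∧ Complex.exp ((x q).1 * Complex.I) = q.1 ∧ Complex.exp ((x q).2 * Complex.I) = q.2)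
    (hroots : ∀ v ∈ Icc a (a + 2 * Real.pi) ×ˢ Icc a (a + 2 * Real.pi), planeSymbol τ v = 0 →
      ∃ q ∈ R, v = x q) :
    ∃ Φ : ℝ × ℝ → ℝ, Integrable Φ ∧ ∀ ε : ℝ, 0 ≤ ε → ∀ v, |residual τ R a x ε v| ≤ Φ v := by
  have hinj : ∀ q ∈ R, ∀ q' ∈ R, x q = x q' → q = q' := fun q hq q' hq' h =>
    Prod.ext ((hx q hq).2.1.symm.trans (h ▸ (hx q' hq').2.1))
      ((hx q hq).2.2.symm.trans (h ▸ (hx q' hq').2.2))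
  choose! δ₀ hδ₀ K₁ hK₁ hrec using fun q (hq : q ∈ R) =>
    exists_reciprocal_sub_le (hsimple q hq) (hx q hq).2.1 (hx q hq).2.2
  -- a common radius: the balls lie in the square and are disjoint
  have hev : ∀ᶠ δ : ℝ in 𝓝[>] 0, 0 < δ ∧ ∀ q ∈ R, δ < δ₀ q ∧
      Metric.ball (x q) δ ⊆ Ioo a (a + 2 * Real.pi) ×ˢ Ioo a (a + 2 * Real.pi) ∧
      ∀ q' ∈ R, q ≠ q' → 2 * δ < dist (x q) (x q') := by
    refine (eventually_mem_nhdsWithin.mono fun δ hδ => hδ).and ?_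
    rw [eventually_all_finset]
    intro q hq
    refine (eventually_nhdsWithin_of_eventually_nhds (Iio_mem_nhds (hδ₀ q hq))).and
      (Filter.Eventually.and ?_ ?_)
    · obtain ⟨r, hr, hsub⟩ := Metric.isOpen_iff.1 (isOpen_Ioo.prod isOpen_Ioo) _ (hx q hq).1
      filter_upwards [eventually_nhdsWithin_of_eventually_nhds (Iio_mem_nhds hr)] with δ hδ
      exact (Metric.ball_subset_ball (le_of_lt hδ)).trans hsub
    · rw [eventually_all_finset]
      intro q' hq'
      by_cases hqq : q = q'
      · exact Eventually.of_forall fun δ h => absurd hqq h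
      · have hd : 0 < dist (x q) (x q') := dist_pos.2 fun h => hqq (hinj q hq q' hq' h)
        filter_upwards [eventually_nhdsWithin_of_eventually_nhds
          (Iio_mem_nhds (half_pos hd))] with δ hδ _
        have : δ < dist (x q) (x q') / 2 := hδ
        linarith
  obtain ⟨δ, hδ, hδR⟩ := hev.exists
  choose! m hm K₂ hK₂ hcut using fun q (hq : q ∈ R) => exists_cutoff_sub_le (hsimple q hq) hδ
  -- away from the balls `|p|²` is bounded below
  obtain ⟨μ, hμ, hfar⟩ : ∃ μ : ℝ, 0 < μ ∧
      ∀ v ∈ Icc a (a + 2 * Real.pi) ×ˢ Icc a (a + 2 * Real.pi),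
        (∀ q ∈ R, δ ≤ ‖v - x q‖) → μ ≤ ‖planeSymbol τ v‖ ^ 2 := by
    set S : Set (ℝ × ℝ) := (Icc a (a + 2 * Real.pi) ×ˢ Icc a (a + 2 * Real.pi)) ∩
      {v | ∀ q ∈ R, δ ≤ ‖v - x q‖} with hS
    have hcl : IsClosed {v : ℝ × ℝ | ∀ q ∈ R, δ ≤ ‖v - x q‖} := by
      simp only [ofPred_forall]
      exact isClosed_iInter fun q => isClosed_iInter fun _ =>
        isClosed_le continuous_const (by fun_prop)
    have hScomp : IsCompact S := (isCompact_Icc.prod isCompact_Icc).inter_right hcl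
    rcases S.eq_empty_or_nonempty with hemp | hnon
    · exact ⟨1, one_pos, fun v hv hq => absurd (show v ∈ S from ⟨hv, hq⟩) (by simp [hemp])⟩
    · obtain ⟨v₀, hv₀, hmin⟩ := hScomp.exists_isMinOn hnon
        (((continuous_planeSymbol τ).norm.pow 2).continuousOn)
      refine ⟨‖planeSymbol τ v₀‖ ^ 2, pow_pos (norm_pos_iff.2 fun h0 => ?_) 2,
        fun v hv hq => hmin ⟨hv, hq⟩⟩
      obtain ⟨q, hq, rfl⟩ := hroots v₀ hv₀.1 h0
      have := hv₀.2 q hq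
      rw [sub_self, norm_zero] at this
      linarith
  -- the cut-offs are compared with `1 / (ε + Q)` restricted to the balls
  refine ⟨fun v => (periodSquare a).indicator (fun _ => 1 / μ) v +
    ∑ q ∈ R, K₁ q * Real.exp (δ ^ 2) * radialBound 1 (v - x q) +
    ∑ q ∈ R, K₂ q * radialBound (m q) (v - x q), ?_, fun ε hε v => ?_⟩
  · refine Integrable.add (Integrable.add ?_ ?_) ?_
    · refine (integrable_indicator_iff (measurableSet_periodSquare a)).2 (integrableOn_const ?_)
      refine ne_of_lt ?_
      refine (measure_mono (t := Icc a (a + 2 * Real.pi) ×ˢ Icc a (a + 2 * Real.pi)) ?_).trans_lt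
        (isCompact_Icc.prod isCompact_Icc).measure_lt_top
      exact prod_mono Ioc_subset_Icc_self Ioc_subset_Icc_self
    · exact integrable_finsetSum _ fun q _ =>
        ((integrable_radialBound one_pos).comp_sub_right (x q)).const_mul _
    · exact integrable_finsetSum _ fun q hq =>
        ((integrable_radialBound (hm q hq)).comp_sub_right (x q)).const_mul _
  · set g : ℂ × ℂ → ℝ := fun q =>
      if ‖v - x q‖ < δ then 1 / (ε + rootForm τ q (v - x q)) else 0 with hg
    have hsplit : residual τ R a x ε v
        = ((periodSquare a).indicator (fun v => 1 / (ε + ‖planeSymbol τ v‖ ^ 2)) v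
            - ∑ q ∈ R, g q)
          + ∑ q ∈ R, (g q - rootCutoff τ q ε (v - x q)) := by
      rw [Finset.sum_sub_distrib, residual]; ring
    rw [hsplit]
    refine (abs_add_le _ _).trans (add_le_add ?_ ?_)
    · have hnn : ∀ q ∈ R, 0 ≤ K₁ q * Real.exp (δ ^ 2) * radialBound 1 (v - x q) := fun q hq =>
        mul_nonneg (mul_nonneg (hK₁ q hq) (Real.exp_nonneg _)) (radialBound_nonneg _ _)
      by_cases hnear : ∃ q ∈ R, ‖v - x q‖ < δ
      · obtain ⟨q, hq, hqδ⟩ := hnear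
        have hball : v ∈ Metric.ball (x q) δ := by rwa [mem_ball_iff_norm]
        have hvsq : v ∈ periodSquare a :=
          prod_mono Ioo_subset_Ioc_self Ioo_subset_Ioc_self ((hδR q hq).2.1 hball)
        have hsum : ∑ q ∈ R, g q = 1 / (ε + rootForm τ q (v - x q)) := by
          rw [Finset.sum_eq_single_of_mem q hq, hg]
          · simp only [if_pos hqδ]
          · intro q' hq' hne
            have h3 := (hδR q hq).2.2 q' hq' hne.symm
            simp only [hg]
            rw [if_neg]
            intro h4
            have h5 := dist_triangle_left (x q) (x q') v
            rw [dist_eq_norm v, dist_eq_norm v] at h5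
            linarith
        rw [indicator_of_mem hvsq, hsum]
        have h6 := hrec q hq ε hε (v - x q) (hqδ.le.trans (hδR q hq).1.le)
        rw [add_sub_cancel] at h6
        refine h6.trans ?_
        have h7 : ‖v - x q‖⁻¹ ≤ Real.exp (δ ^ 2) * radialBound 1 (v - x q) := by
          unfold radialBound
          have h8 : 1 ≤ Real.exp (δ ^ 2) * Real.exp (-1 * ‖v - x q‖ ^ 2) := by
            rw [← Real.exp_add]
            refine Real.one_le_exp ?_
            have : ‖v - x q‖ ^ 2 ≤ δ ^ 2 := pow_le_pow_left₀ (norm_nonneg _) hqδ.le 2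
            linarith
          have h9 : (0 : ℝ) ≤ ‖v - x q‖⁻¹ := by positivity
          nlinarith
        calc K₁ q * ‖v - x q‖⁻¹ ≤ K₁ q * (Real.exp (δ ^ 2) * radialBound 1 (v - x q)) :=
              mul_le_mul_of_nonneg_left h7 (hK₁ q hq)
          _ = K₁ q * Real.exp (δ ^ 2) * radialBound 1 (v - x q) := by ring
          _ ≤ ∑ q ∈ R, K₁ q * Real.exp (δ ^ 2) * radialBound 1 (v - x q) :=
              Finset.single_le_sum hnn hq
          _ ≤ _ := le_add_of_nonneg_left (indicator_nonneg (fun _ _ => by positivity) _)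
      · push Not at hnear
        have hsum : ∑ q ∈ R, g q = 0 := Finset.sum_eq_zero fun q hq => by
          simp only [hg]; rw [if_neg (not_lt.2 (hnear q hq))]
        rw [hsum, sub_zero]
        refine le_trans ?_ (le_add_of_nonneg_right (Finset.sum_nonneg hnn))
        by_cases hv : v ∈ periodSquare a
        · rw [indicator_of_mem hv, indicator_of_mem hv]
          have h3 := hfar v (prod_mono Ioc_subset_Icc_self Ioc_subset_Icc_self hv) hnear
          rw [abs_of_nonneg (by positivity)]
          gcongr
          linarith
        · rw [indicator_of_notMem hv, indicator_of_notMem hv, abs_zero]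
    · refine (Finset.abs_sum_le_sum_abs _ _).trans (Finset.sum_le_sum fun q hq => ?_)
      exact hcut q hq ε hε (v - x q)

/-- The residual converges in `L¹` as `ε → 0`. -/
theorem tendsto_integral_residual_sub (hsimple : ∀ q ∈ R, IsSimpleRoot τ q.1 q.2)
    (hx : ∀ q ∈ R, x q ∈ Ioo a (a + 2 * Real.pi) ×ˢ Ioo a (a + 2 * Real.pi)
      ∧ Complex.exp ((x q).1 * Complex.I) = q.1 ∧ Complex.exp ((x q).2 * Complex.I) = q.2)
    (hroots : ∀ v ∈ Icc a (a + 2 * Real.pi) ×ˢ Icc a (a + 2 * Real.pi), planeSymbol τ v = 0 →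
      ∃ q ∈ R, v = x q) :
    Tendsto (fun ε => ∫ v, |residual τ R a x ε v - residual τ R a x 0 v|) (𝓝[>] 0) (𝓝 0) := by
  obtain ⟨Φ, hΦ, hbound⟩ := exists_residual_bound hsimple hx hroots
  suffices h : Tendsto (fun ε => ∫ v, |residual τ R a x ε v - residual τ R a x 0 v|) (𝓝[>] 0)
      (𝓝 (∫ _ : ℝ × ℝ, (0 : ℝ))) by
    rwa [integral_zero] at h
  refine tendsto_integral_filter_of_dominated_convergence (fun v => Φ v + Φ v) ?_ ?_
    (hΦ.add hΦ) ?_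
  · exact Eventually.of_forall fun ε =>
      (((measurable_residual τ R a x ε).sub (measurable_residual τ R a x 0)).norm).aestronglyMeasurable
  · filter_upwards [self_mem_nhdsWithin] with ε hε
    refine ae_of_all _ fun v => ?_
    rw [Real.norm_eq_abs, abs_abs]
    exact (abs_sub _ _).trans (add_le_add (hbound ε (le_of_lt hε) v) (hbound 0 le_rfl v))
  · have hnull : ∀ᵐ v : ℝ × ℝ, v ∉ (R.image x : Set (ℝ × ℝ)) :=
      measure_eq_zero_iff_ae_notMem.1 ((Finset.finite_toSet _).measure_zero _)
    filter_upwards [hnull] with v hv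
    have hne : ∀ q ∈ R, v - x q ≠ 0 := fun q hq h0 =>
      hv (Finset.mem_coe.2 (Finset.mem_image.2 ⟨q, hq, (sub_eq_zero.1 h0).symm⟩))
    have hid : Tendsto (fun ε : ℝ => ε) (𝓝[>] 0) (𝓝 0) := tendsto_nhdsWithin_of_tendsto_nhds tendsto_id
    have hconv : Tendsto (fun ε => residual τ R a x ε v) (𝓝[>] 0) (𝓝 (residual τ R a x 0 v)) := by
      unfold residual
      refine Tendsto.sub ?_ (tendsto_finsetSum _ fun q hq => ?_)
      · by_cases hvs : v ∈ periodSquare a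
        · simp only [indicator_of_mem hvs]
          refine tendsto_const_nhds.div (hid.add_const _) ?_
          rw [zero_add]
          refine pow_ne_zero 2 (norm_ne_zero_iff.2 fun h0 => ?_)
          obtain ⟨q, hq, he⟩ := hroots v
            (prod_mono Ioc_subset_Icc_self Ioc_subset_Icc_self hvs) h0
          exact hne q hq (by rw [he, sub_self])
        · simp only [indicator_of_notMem hvs]
          exact tendsto_const_nhds
      · obtain ⟨m, hm, hlow⟩ := rootForm_lower (hsimple q hq)
        have hpos : 0 < rootForm τ q (v - x q) :=
          lt_of_lt_of_le (mul_pos hm (pow_pos (norm_pos_iff.2 (hne q hq)) 2)) (hlow _)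
        unfold rootCutoff gaussCutoff
        refine Tendsto.div ?_ (hid.add_const _) (by rw [zero_add]; exact hpos.ne')
        exact (Real.continuous_exp.tendsto _).comp ((hid.add_const _).neg)
    have := (hconv.sub_const (residual τ R a x 0 v)).abs
    rwa [sub_self, abs_zero] at this

/-- The period integral for the covariance is the transform of the residual plus one explicit
term for each root. -/
theorem planeCov_eq_residual_add (hsimple : ∀ q ∈ R, IsSimpleRoot τ q.1 q.2)
    (hx : ∀ q ∈ R, x q ∈ Ioo a (a + 2 * Real.pi) ×ˢ Ioo a (a + 2 * Real.pi)
      ∧ Complex.exp ((x q).1 * Complex.I) = q.1 ∧ Complex.exp ((x q).2 * Complex.I) = q.2)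
    {Φ : ℝ × ℝ → ℝ} (hΦ : Integrable Φ)
    (hbound : ∀ ε : ℝ, 0 ≤ ε → ∀ v, |residual τ R a x ε v| ≤ Φ v)
    {ε : ℝ} (hε : 0 < ε) (s t : ℤ) :
    planeCov τ ε s t = 1 / (2 * (Real.pi : ℂ)) ^ 2 *
        (∫ v, planeWave s t v * (residual τ R a x ε v : ℂ))
      + ∑ q ∈ R, rootTerm q s t (rootTail τ q ε s t : ℂ) := by
  have hres : Integrable (residual τ R a x ε) :=
    hΦ.mono' (measurable_residual τ R a x ε).aestronglyMeasurable
      (ae_of_all _ fun v => hbound ε hε.le v)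
  have hcutInt : ∀ q ∈ R, Integrable (fun v => rootCutoff τ q ε (v - x q)) := fun q hq =>
    (integrable_gaussCutoff (hsimple q hq).quadA_pos (hsimple q hq).quadC_pos
      (hsimple q hq).quadDet_pos hε).comp_sub_right (x q)
  have hterm : ∀ q ∈ R, ∫ v, planeWave s t v * (rootCutoff τ q ε (v - x q) : ℂ)
      = q.1 ^ s * q.2 ^ t * (rootTail τ q ε s t : ℂ) := by
    intro q hq
    have h1 := integral_planeWave_gaussCutoff (hsimple q hq).quadA_pos (hsimple q hq).quadC_pos
      (hsimple q hq).quadDet_pos hε s t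
    rw [rootTail, quadDet, rootDual, ← h1, ← integral_const_mul, ← (hx q hq).2.1, ← (hx q hq).2.2,
      ← planeWave_eq_zpow]
    have h2 := integral_sub_right_eq_self (μ := volume)
      (fun w => planeWave s t (x q) * (planeWave s t w * (rootCutoff τ q ε w : ℂ))) (x q)
    refine Eq.trans (integral_congr_ae (ae_of_all _ fun v => ?_)) h2
    simp only
    rw [← mul_assoc, ← planeWave_add, add_sub_cancel]
  have hsq : ∫ v in periodSquare a, planeDensity τ ε s t v
      = (∫ v, planeWave s t v * (residual τ R a x ε v : ℂ))
        + ∑ q ∈ R, ∫ v, planeWave s t v * (rootCutoff τ q ε (v - x q) : ℂ) := by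
    rw [← integral_indicator (measurableSet_periodSquare a), ← integral_finsetSum,
      ← integral_add]
    · refine integral_congr_ae (ae_of_all _ fun v => ?_)
      simp only [residual]
      rw [← Finset.mul_sum, ← mul_add]
      push_cast
      rw [sub_add_cancel]
      by_cases hv : v ∈ periodSquare a
      · rw [indicator_of_mem hv, indicator_of_mem hv, planeDensity]
        push_cast
        rw [mul_one_div]
      · rw [indicator_of_notMem hv, indicator_of_notMem hv]
        simp
    · exact integrable_planeWave_mul hres s t
    · exact integrable_finsetSum _ fun q hq => integrable_planeWave_mul (hcutInt q hq) s t
    · exact fun q hq => integrable_planeWave_mul (hcutInt q hq) s t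
  rw [planeCov_eq_setIntegral τ hε s t a]
  rw [show (∫ v in Ioc a (a + 2 * Real.pi) ×ˢ Ioc a (a + 2 * Real.pi), planeDensity τ ε s t v)
    = ∫ v in periodSquare a, planeDensity τ ε s t v from rfl, hsq, mul_add,
    Finset.sum_congr rfl hterm, Finset.mul_sum]
  congr 1
  refine Finset.sum_congr rfl fun q _ => ?_
  rw [rootTerm]
  ring

/-- The covariance is the sum of the root terms with `J` replaced by its part over `l > 1`, up to
an error which is bounded, and which is small when `ε` is small and `(s, t)` is large. -/
theorem exists_planeCov_approx (hR : ∀ q : ℂ × ℂ, q ∈ R ↔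
      ‖q.1‖ = 1 ∧ ‖q.2‖ = 1 ∧ charPoly τ q.1 q.2 = 0)
    (hsimple : ∀ q ∈ R, IsSimpleRoot τ q.1 q.2) :
    ∃ B : ℝ, ∀ η : ℝ, 0 < η → ∃ ε₁ : ℝ, 0 < ε₁ ∧ ∃ ρ : ℝ, ∀ ε : ℝ, 0 < ε → ε < ε₁ →
      ∀ s t : ℤ,
        ‖planeCov τ ε s t - ∑ q ∈ R, rootTerm q s t (rootTail τ q ε s t : ℂ)‖ ≤ B ∧
        (ρ < (s : ℝ) ^ 2 + (t : ℝ) ^ 2 →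
          ‖planeCov τ ε s t - ∑ q ∈ R, rootTerm q s t (rootTail τ q ε s t : ℂ)‖ ≤ η) := by
  obtain ⟨a, x, hx, hroots⟩ := exists_root_positions hR
  obtain ⟨Φ, hΦ, hbound⟩ := exists_residual_bound hsimple hx hroots
  have hlim := tendsto_integral_residual_sub hsimple hx hroots
  have hres : ∀ ε : ℝ, 0 ≤ ε → Integrable (residual τ R a x ε) := fun ε hε =>
    hΦ.mono' (measurable_residual τ R a x ε).aestronglyMeasurable
      (ae_of_all _ fun v => hbound ε hε v)
  have hconst : ‖1 / (2 * (Real.pi : ℂ)) ^ 2‖ ≤ 1 := by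
    have h1 : ‖1 / (2 * (Real.pi : ℂ)) ^ 2‖ = 1 / (2 * Real.pi) ^ 2 := by
      rw [norm_div, norm_pow, norm_mul, Complex.norm_real, Real.norm_eq_abs,
        abs_of_pos Real.pi_pos, norm_one, Complex.norm_ofNat]
    rw [h1]
    refine div_le_one_of_le₀ ?_ (by positivity)
    nlinarith [Real.pi_gt_three]
  refine ⟨∫ v, Φ v, fun η hη => ?_⟩
  obtain ⟨ρ, hρ⟩ := integral_planeWave_small (residual τ R a x 0) (half_pos hη)
  have hev := hlim.eventually (Iio_mem_nhds (half_pos hη))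
  obtain ⟨ε₁, hε₁, hsub⟩ := mem_nhdsGT_iff_exists_Ioo_subset.1 hev
  refine ⟨ε₁, hε₁, ρ, fun ε hε hlt s t => ?_⟩
  have hD : ‖planeCov τ ε s t - ∑ q ∈ R, rootTerm q s t (rootTail τ q ε s t : ℂ)‖
      ≤ ‖∫ v, planeWave s t v * (residual τ R a x ε v : ℂ)‖ := by
    rw [planeCov_eq_residual_add hsimple hx hΦ hbound hε s t, add_sub_cancel_right, norm_mul]
    exact mul_le_of_le_one_left (norm_nonneg _) hconst
  refine ⟨hD.trans ?_, fun hst => hD.trans ?_⟩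
  · refine norm_integral_le_of_norm_le hΦ (ae_of_all _ fun v => ?_)
    rw [norm_mul, norm_planeWave, one_mul, Complex.norm_real]
    exact hbound ε hε.le v
  · have hdiff : ∫ v, planeWave s t v * (residual τ R a x ε v : ℂ)
        = (∫ v, planeWave s t v * ((residual τ R a x ε v - residual τ R a x 0 v : ℝ) : ℂ))
          + ∫ v, planeWave s t v * (residual τ R a x 0 v : ℂ) := by
      rw [← integral_add]
      · refine integral_congr_ae (ae_of_all _ fun v => ?_)
        push_cast
        ring
      · exact integrable_planeWave_mul ((hres ε hε.le).sub (hres 0 le_rfl)) s t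
      · exact integrable_planeWave_mul (hres 0 le_rfl) s t
    rw [hdiff]
    refine (norm_add_le _ _).trans ?_
    have h1 : ‖∫ v, planeWave s t v *
        ((residual τ R a x ε v - residual τ R a x 0 v : ℝ) : ℂ)‖ ≤ η / 2 := by
      refine le_trans (norm_integral_le_of_norm_le
        (((hres ε hε.le).sub (hres 0 le_rfl)).abs) (ae_of_all _ fun v => ?_))
        (le_of_lt (hsub ⟨hε, hlt⟩))
      rw [norm_mul, norm_planeWave, one_mul, Complex.norm_real]
      rfl
    linarith [hρ s t hst]

end Residual

/-! ### Asymptotics of the covariance as `ε → 0` -/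

section RootValue

open Set MeasureTheory

variable {τ : Finset (ℤ × ℤ)} {q : ℂ × ℂ}

/-- The Bessel function which is the value of the Fourier integral at the root `q`. -/
def rootValue (τ : Finset (ℤ × ℤ)) (q : ℂ × ℂ) (ε : ℝ) (s t : ℤ) : ℝ :=
  2 * Real.pi / √(quadDet τ q) *
    besselK (√(ε * (quadC τ q * (s : ℝ) ^ 2 - quadB τ q * (s : ℝ) * (t : ℝ)
      + quadA τ q * (t : ℝ) ^ 2) / quadDet τ q))

theorem sq_add_sq_ge_one {s t : ℤ} (hst : (s, t) ≠ (0, 0)) : (1 : ℝ) ≤ (s : ℝ) ^ 2 + (t : ℝ) ^ 2 := by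
  have h : 0 < s ^ 2 + t ^ 2 := by
    by_contra hc
    have hs : s = 0 := by nlinarith [sq_nonneg s, sq_nonneg t]
    have ht : t = 0 := by nlinarith [sq_nonneg s, sq_nonneg t]
    exact hst (by rw [hs, ht])
  exact_mod_cast h

theorem IsSimpleRoot.rootDual_lower (h : IsSimpleRoot τ q.1 q.2) (s t : ℤ) :
    ((s : ℝ) ^ 2 + (t : ℝ) ^ 2) / (quadA τ q + quadC τ q) ≤ rootDual τ q s t := by
  have hA := h.quadA_pos
  have hC := h.quadC_pos
  have hD := h.quadDet_pos
  have h1 := quadForm_lower (a := quadC τ q) (b := -quadB τ q) (c := quadA τ q) hC hA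
    ((s : ℝ), (t : ℝ))
  have hD' : quadC τ q * quadA τ q - (-quadB τ q) ^ 2 / 4 = quadDet τ q := by
    unfold quadDet; ring
  rw [hD'] at h1
  unfold rootDual dualForm
  have hD2 : quadA τ q * quadC τ q - quadB τ q ^ 2 / 4 = quadDet τ q := rfl
  rw [hD2, le_div_iff₀ hD]
  unfold quadForm at h1
  calc _ = quadDet τ q / (quadC τ q + quadA τ q) * ((s : ℝ) ^ 2 + (t : ℝ) ^ 2) := by
        rw [add_comm (quadC τ q)]; ring
    _ ≤ _ := h1
    _ = _ := by ring

theorem IsSimpleRoot.rootDual_pos (h : IsSimpleRoot τ q.1 q.2) {s t : ℤ} (hst : (s, t) ≠ (0, 0)) :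
    0 < rootDual τ q s t := by
  have hA := h.quadA_pos
  have hC := h.quadC_pos
  have := sq_add_sq_ge_one hst
  exact lt_of_lt_of_le (by positivity) (h.rootDual_lower s t)

theorem IsSimpleRoot.exists_rootDual_upper (h : IsSimpleRoot τ q.1 q.2) :
    ∃ Λ : ℝ, 0 ≤ Λ ∧ ∀ s t : ℤ, rootDual τ q s t ≤ Λ * ((s : ℝ) ^ 2 + (t : ℝ) ^ 2) := by
  have hA := h.quadA_pos
  have hC := h.quadC_pos
  have hD := h.quadDet_pos
  refine ⟨(quadA τ q + |quadB τ q| + quadC τ q) / quadDet τ q, by positivity, fun s t => ?_⟩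
  unfold rootDual dualForm
  have hD2 : quadA τ q * quadC τ q - quadB τ q ^ 2 / 4 = quadDet τ q := rfl
  rw [hD2, div_mul_eq_mul_div]
  refine div_le_div_of_nonneg_right ?_ hD.le
  have h1 : -(quadB τ q * s * t) ≤ |quadB τ q| * ((s : ℝ) ^ 2 + (t : ℝ) ^ 2) := by
    calc -(quadB τ q * s * t) ≤ |quadB τ q * s * t| := neg_le_abs _
      _ = |quadB τ q| * (|(s : ℝ)| * |(t : ℝ)|) := by rw [abs_mul, abs_mul, mul_assoc]
      _ ≤ |quadB τ q| * ((s : ℝ) ^ 2 + (t : ℝ) ^ 2) := by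
          gcongr
          rw [← sq_abs (s : ℝ), ← sq_abs (t : ℝ)]
          nlinarith [sq_nonneg (|(s : ℝ)| - |(t : ℝ)|), sq_nonneg |(s : ℝ)|, sq_nonneg |(t : ℝ)|]
  nlinarith [mul_nonneg hA.le (sq_nonneg (s : ℝ)), mul_nonneg hC.le (sq_nonneg (t : ℝ))]

theorem rootValue_eq_integral (h : IsSimpleRoot τ q.1 q.2) {ε : ℝ} (hε : 0 < ε) {s t : ℤ}
    (hst : (s, t) ≠ (0, 0)) :
    rootValue τ q ε s t
      = Real.pi / √(quadDet τ q) * ∫ l in Ioi 0, besselKernel ε (rootDual τ q s t) l := by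
  rw [integral_besselKernel_eq_besselK hε (h.rootDual_pos hst), rootValue]
  have : ε * (quadC τ q * (s : ℝ) ^ 2 - quadB τ q * (s : ℝ) * (t : ℝ)
      + quadA τ q * (t : ℝ) ^ 2) / quadDet τ q = ε * rootDual τ q s t := by
    rw [mul_div_assoc]; rfl
  rw [this]
  ring

theorem hasImproperIntegral_rootIntegrand (h : IsSimpleRoot τ q.1 q.2) {ε : ℝ} (hε : 0 < ε)
    {s t : ℤ} (hst : (s, t) ≠ (0, 0)) :
    HasImproperIntegral (rootIntegrand τ q ε s t) (rootValue τ q ε s t : ℂ) := by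
  rw [rootValue_eq_integral h hε hst]
  have h1 := hasImproperIntegral_quadForm h.quadA_pos h.quadC_pos h.quadDet_pos hε hst
  convert h1 using 1
  · funext v
    rw [rootIntegrand, norm_sq_linear_eq_quadForm]
    rfl
  · rfl

theorem IsSimpleRoot.exists_rootValue_sub_rootTail_le (h : IsSimpleRoot τ q.1 q.2) :
    ∃ K : ℝ, 0 ≤ K ∧ ∀ ε : ℝ, 0 < ε → ∀ s t : ℤ, (s, t) ≠ (0, 0) →
      0 ≤ rootValue τ q ε s t - rootTail τ q ε s t ∧
      rootValue τ q ε s t - rootTail τ q ε s t ≤ K / ((s : ℝ) ^ 2 + (t : ℝ) ^ 2) := by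
  have hA := h.quadA_pos
  have hC := h.quadC_pos
  have hD := h.quadDet_pos
  refine ⟨Real.pi / √(quadDet τ q) * (4 * (quadA τ q + quadC τ q)), by positivity,
    fun ε hε s t hst => ?_⟩
  have hκ := h.rootDual_pos hst
  have hr := sq_add_sq_ge_one hst
  obtain ⟨h1, h2⟩ := integral_besselKernel_Ioc_mem hε.le hκ
  have h3 : rootValue τ q ε s t - rootTail τ q ε s t
      = Real.pi / √(quadDet τ q) * ∫ l in Ioc 0 1, besselKernel ε (rootDual τ q s t) l := by
    rw [rootValue_eq_integral h hε hst, integral_besselKernel_split hε hκ, rootTail]; ring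
  rw [h3]
  refine ⟨by positivity, ?_⟩
  rw [mul_div_assoc]
  refine mul_le_mul_of_nonneg_left (h2.trans ?_) (by positivity)
  have h4 := h.rootDual_lower s t
  have hS : 0 < (s : ℝ) ^ 2 + (t : ℝ) ^ 2 := by linarith
  rw [div_le_div_iff₀ hκ hS]
  rw [div_le_iff₀ (by positivity)] at h4
  linarith

theorem IsSimpleRoot.exists_le_rootValue (h : IsSimpleRoot τ q.1 q.2) (M : ℝ) :
    ∃ c : ℝ, 0 < c ∧ ∀ ε : ℝ, 0 < ε → ∀ s t : ℤ, (s, t) ≠ (0, 0) →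
      ε * ((s : ℝ) ^ 2 + (t : ℝ) ^ 2) ≤ M → c ≤ rootValue τ q ε s t := by
  have hD := h.quadDet_pos
  obtain ⟨Λ, hΛ, hup⟩ := h.exists_rootDual_upper
  refine ⟨Real.pi / √(quadDet τ q) * (Real.exp (-2 - Λ * M / 4) / 2), by positivity,
    fun ε hε s t hst hM => ?_⟩
  rw [rootValue_eq_integral h hε hst]
  refine mul_le_mul_of_nonneg_left ?_ (by positivity)
  refine exp_le_integral_besselKernel hε (h.rootDual_pos hst) ?_
  calc ε * rootDual τ q s t ≤ ε * (Λ * ((s : ℝ) ^ 2 + (t : ℝ) ^ 2)) := by gcongr; exact hup s t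
    _ = Λ * (ε * ((s : ℝ) ^ 2 + (t : ℝ) ^ 2)) := by ring
    _ ≤ Λ * M := by gcongr

theorem IsSimpleRoot.rootDual_nonneg (h : IsSimpleRoot τ q.1 q.2) (s t : ℤ) :
    0 ≤ rootDual τ q s t := by
  have hA := h.quadA_pos
  have hC := h.quadC_pos
  exact le_trans (by positivity) (h.rootDual_lower s t)

theorem IsSimpleRoot.abs_rootTail_sub_le (h : IsSimpleRoot τ q.1 q.2) {ε : ℝ} (hε : 0 < ε)
    (hε1 : ε ≤ 1) (s t : ℤ) :
    |rootTail τ q ε s t - Real.pi / √(quadDet τ q) * Real.log (1 / ε)|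
      ≤ Real.pi / √(quadDet τ q) * (1 + rootDual τ q s t / 4) := by
  have hpos : 0 ≤ Real.pi / √(quadDet τ q) := by positivity
  rw [rootTail, ← mul_sub, abs_mul, abs_of_nonneg hpos]
  exact mul_le_mul_of_nonneg_left
    (abs_integral_besselKernel_sub_log_le hε hε1 (h.rootDual_nonneg s t)) hpos

theorem norm_rootTerm (h1 : ‖q.1‖ = 1) (h2 : ‖q.2‖ = 1) (s t : ℤ) (J : ℂ) :
    ‖rootTerm q s t J‖ = ‖J‖ / (2 * Real.pi) ^ 2 := by
  rw [rootTerm, norm_mul, norm_div, norm_mul, norm_zpow, norm_zpow, h1, h2, one_zpow, one_zpow,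
    norm_pow, norm_mul, Complex.norm_real, Real.norm_eq_abs, abs_of_pos Real.pi_pos,
    Complex.norm_ofNat]
  ring

theorem rootTerm_sub (q : ℂ × ℂ) (s t : ℤ) (J J' : ℂ) :
    rootTerm q s t (J - J') = rootTerm q s t J - rootTerm q s t J' := by
  unfold rootTerm; ring

end RootValue

section Asymptotics

theorem tendsto_log_inv : Tendsto (fun ε : ℝ => Real.log (1 / ε)) (𝓝[>] 0) atTop := by
  simp only [one_div]
  exact Real.tendsto_log_atTop.comp tendsto_inv_nhdsGT_zero

/-- Two functions within bounded distance of the same multiple of a divergent one are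
asymptotically equal. -/
theorem tendsto_div_of_bounded_sub {𝕜 : Type*} [RCLike 𝕜] {ι : Type*} {l : Filter ι}
    {f g : ι → 𝕜} {L : ι → ℝ} {S : 𝕜} (hS : S ≠ 0) (hL : Tendsto L l atTop) {B : ℝ}
    (hf : ∀ᶠ i in l, ‖f i - (L i : 𝕜) * S‖ ≤ B) (hg : ∀ᶠ i in l, ‖g i - (L i : 𝕜) * S‖ ≤ B) :
    Tendsto (fun i => f i / g i) l (𝓝 1) := by
  have key : ∀ F : ι → 𝕜, (∀ᶠ i in l, ‖F i - (L i : 𝕜) * S‖ ≤ B) →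
      Tendsto (fun i => F i / (L i : 𝕜)) l (𝓝 S) := by
    intro F hF
    rw [tendsto_iff_norm_sub_tendsto_zero]
    refine squeeze_zero' (Eventually.of_forall fun _ => norm_nonneg _) ?_
      (hL.const_div_atTop B)
    filter_upwards [hF, hL.eventually_gt_atTop 0] with i hi hpos
    have hne : (L i : 𝕜) ≠ 0 := by exact_mod_cast hpos.ne'
    have : F i / (L i : 𝕜) - S = (F i - (L i : 𝕜) * S) / (L i : 𝕜) := by field_simp
    rw [this, norm_div, RCLike.norm_ofReal, abs_of_pos hpos]
    gcongr
  have h := (key f hf).div (key g hg) hS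
  rw [div_self hS] at h
  refine h.congr' ?_
  filter_upwards [hL.eventually_gt_atTop 0] with i hpos
  have hne : (L i : 𝕜) ≠ 0 := by exact_mod_cast hpos.ne'
  simp only [Pi.div_apply]
  rw [div_div_div_cancel_right₀ hne]

variable {τ : Finset (ℤ × ℤ)} {R : Finset (ℂ × ℂ)}

/-- The difference between the root terms and their parts over `l > 1` decays quadratically. -/
theorem exists_norm_sum_rootTerm_sub_le (hunit : ∀ q ∈ R, ‖q.1‖ = 1 ∧ ‖q.2‖ = 1)
    (hsimple : ∀ q ∈ R, IsSimpleRoot τ q.1 q.2) :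
    ∃ K : ℝ, 0 ≤ K ∧ ∀ ε : ℝ, 0 < ε → ∀ s t : ℤ, (s, t) ≠ (0, 0) →
      ‖∑ q ∈ R, rootTerm q s t (rootTail τ q ε s t : ℂ)
        - ∑ q ∈ R, rootTerm q s t (rootValue τ q ε s t : ℂ)‖
        ≤ K / ((s : ℝ) ^ 2 + (t : ℝ) ^ 2) := by
  choose! K hK hKle using fun q (hq : q ∈ R) => (hsimple q hq).exists_rootValue_sub_rootTail_le
  refine ⟨∑ q ∈ R, K q / (2 * Real.pi) ^ 2,
    Finset.sum_nonneg fun q hq => div_nonneg (hK q hq) (by positivity), fun ε hε s t hst => ?_⟩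
  rw [← Finset.sum_sub_distrib, Finset.sum_div]
  refine norm_sum_le_of_le _ fun q hq => ?_
  obtain ⟨h1, h2⟩ := hKle q hq ε hε s t hst
  rw [← rootTerm_sub, norm_rootTerm (hunit q hq).1 (hunit q hq).2, ← Complex.ofReal_sub,
    Complex.norm_real, Real.norm_eq_abs, abs_sub_comm, abs_of_nonneg h1, div_right_comm]
  gcongr

/-- Each root contributes its term up to a relative error `o(1)`. For large `(s, t)` the error is
small and a root term is bounded below; for bounded `(s, t)` the error is bounded and a root term
diverges. -/
theorem planeCov_sub_sum_rootTerm_le (hR : ∀ q : ℂ × ℂ, q ∈ R ↔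
      ‖q.1‖ = 1 ∧ ‖q.2‖ = 1 ∧ charPoly τ q.1 q.2 = 0) (hne : R.Nonempty)
    (hsimple : ∀ q ∈ R, IsSimpleRoot τ q.1 q.2) {M : ℝ} {η : ℝ} (hη : 0 < η) :
    ∃ ε₀ : ℝ, 0 < ε₀ ∧ ∀ ε : ℝ, 0 < ε → ε < ε₀ → ∀ s t : ℤ, (s, t) ≠ (0, 0) →
      ε * ((s : ℝ) ^ 2 + (t : ℝ) ^ 2) ≤ M →
      ‖planeCov τ ε s t - ∑ q ∈ R, rootTerm q s t (rootValue τ q ε s t : ℂ)‖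
        ≤ η * ∑ q ∈ R, ‖rootTerm q s t (rootValue τ q ε s t : ℂ)‖ := by
  have hunit : ∀ q ∈ R, ‖q.1‖ = 1 ∧ ‖q.2‖ = 1 := fun q hq => ⟨((hR q).1 hq).1, ((hR q).1 hq).2.1⟩
  obtain ⟨K, hK, hKle⟩ := exists_norm_sum_rootTerm_sub_le hunit hsimple
  obtain ⟨B, hB⟩ := exists_planeCov_approx hR hsimple
  obtain ⟨q₀, hq₀⟩ := hne
  have hs₀ := hsimple q₀ hq₀
  have hD₀ := hs₀.quadDet_pos
  obtain ⟨c, hc, hcle⟩ := hs₀.exists_le_rootValue M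
  obtain ⟨Λ, hΛ, hΛle⟩ := hs₀.exists_rootDual_upper
  obtain ⟨K₀, -, hK₀⟩ := hs₀.exists_rootValue_sub_rootTail_le
  have hpp : 0 < (2 * Real.pi) ^ 2 := by positivity
  -- one root suffices for a lower bound of the sum
  have hlow : ∀ (ε : ℝ) (s t : ℤ), rootValue τ q₀ ε s t / (2 * Real.pi) ^ 2
      ≤ ∑ q ∈ R, ‖rootTerm q s t (rootValue τ q ε s t : ℂ)‖ := by
    intro ε s t
    refine le_trans ?_ (Finset.single_le_sum
      (f := fun q => ‖rootTerm q s t (rootValue τ q ε s t : ℂ)‖)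
      (fun q _ => norm_nonneg _) hq₀)
    rw [norm_rootTerm (hunit q₀ hq₀).1 (hunit q₀ hq₀).2, Complex.norm_real]
    gcongr
    exact Real.le_norm_self _
  set θ : ℝ := η * (c / (2 * Real.pi) ^ 2) with hθ
  have hθ0 : 0 < θ := by positivity
  obtain ⟨ε₁, hε₁, ρ, hρ⟩ := hB (θ / 2) (half_pos hθ0)
  set ρ' : ℝ := max ρ (2 * K / θ) with hρ'
  set w : ℝ := Real.pi / √(quadDet τ q₀) with hw
  have hw0 : 0 < w := by positivity
  -- for `s² + t² ≤ ρ'` and `log (1/ε) ≥ Y` the term at `q₀` absorbs the bounded error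
  set Y : ℝ := (B + K) * (2 * Real.pi) ^ 2 / (η * w) + (1 + Λ * ρ' / 4) with hY
  refine ⟨min (min ε₁ 1) (Real.exp (-Y)), by positivity, fun ε hε hlt s t hst hM => ?_⟩
  have hlt1 : ε < ε₁ := hlt.trans_le ((min_le_left _ _).trans (min_le_left _ _))
  have hltone : ε < 1 := hlt.trans_le ((min_le_left _ _).trans (min_le_right _ _))
  have hltY : ε < Real.exp (-Y) := hlt.trans_le (min_le_right _ _)
  have hr := sq_add_sq_ge_one hst
  have hrpos : 0 < (s : ℝ) ^ 2 + (t : ℝ) ^ 2 := by linarith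
  have htri : ‖planeCov τ ε s t - ∑ q ∈ R, rootTerm q s t (rootValue τ q ε s t : ℂ)‖
      ≤ ‖planeCov τ ε s t - ∑ q ∈ R, rootTerm q s t (rootTail τ q ε s t : ℂ)‖
        + K / ((s : ℝ) ^ 2 + (t : ℝ) ^ 2) :=
    (norm_sub_le_norm_sub_add_norm_sub _ _ _).trans
      (add_le_add_right (hKle ε hε s t hst) _)
  obtain ⟨hb1, hb2⟩ := hρ ε hε hlt1 s t
  rcases lt_or_ge ρ' ((s : ℝ) ^ 2 + (t : ℝ) ^ 2) with hbig | hsmall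
  · have h1 := hb2 ((le_max_left _ _).trans_lt hbig)
    have h2 : K / ((s : ℝ) ^ 2 + (t : ℝ) ^ 2) ≤ θ / 2 := by
      have h3 : 2 * K / θ < (s : ℝ) ^ 2 + (t : ℝ) ^ 2 := (le_max_right _ _).trans_lt hbig
      rw [div_lt_iff₀ hθ0] at h3
      rw [div_le_iff₀ hrpos]
      linarith
    calc _ ≤ θ := by linarith
      _ ≤ η * (rootValue τ q₀ ε s t / (2 * Real.pi) ^ 2) := by
          rw [hθ]; gcongr; exact hcle ε hε s t hst hM
      _ ≤ _ := by gcongr; exact hlow ε s t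
  · have h2 : K / ((s : ℝ) ^ 2 + (t : ℝ) ^ 2) ≤ K := div_le_self hK hr
    have hlog : Y ≤ Real.log (1 / ε) := by
      rw [one_div, Real.log_inv]
      have := (Real.log_lt_log hε hltY).le
      rw [Real.log_exp] at this
      linarith
    have htail := hs₀.abs_rootTail_sub_le hε hltone.le s t
    have hκ : rootDual τ q₀ s t ≤ Λ * ρ' := (hΛle s t).trans (by gcongr)
    have h3 : w * (Y - (1 + Λ * ρ' / 4)) ≤ rootValue τ q₀ ε s t := by
      have h4 := (hK₀ ε hε s t hst).1
      have h5 := (abs_le.1 htail).1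
      have h6 : w * Y ≤ w * Real.log (1 / ε) := by gcongr
      have h7 : w * (1 + rootDual τ q₀ s t / 4) ≤ w * (1 + Λ * ρ' / 4) := by gcongr
      rw [← hw] at h5
      linarith
    calc _ ≤ B + K := by linarith
      _ = η * (w * (Y - (1 + Λ * ρ' / 4)) / (2 * Real.pi) ^ 2) := by
          rw [hY, add_sub_cancel_right]; field_simp
      _ ≤ η * (rootValue τ q₀ ε s t / (2 * Real.pi) ^ 2) := by gcongr
      _ ≤ _ := by gcongr; exact hlow ε s t

theorem exists_norm_sum_rootTail_sub_log_le (hunit : ∀ q ∈ R, ‖q.1‖ = 1 ∧ ‖q.2‖ = 1)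
    (hsimple : ∀ q ∈ R, IsSimpleRoot τ q.1 q.2) (s t : ℤ) :
    ∃ B : ℝ, ∀ ε : ℝ, 0 < ε → ε ≤ 1 →
      ‖∑ q ∈ R, rootTerm q s t (rootTail τ q ε s t : ℂ)
        - (Real.log (1 / ε) : ℂ) * (Real.pi / (2 * Real.pi) ^ 2 *
          ∑ q ∈ R, q.1 ^ s * q.2 ^ t / ((√(quadDet τ q) : ℝ) : ℂ))‖ ≤ B := by
  refine ⟨∑ q ∈ R, Real.pi / √(quadDet τ q) * (1 + rootDual τ q s t / 4) / (2 * Real.pi) ^ 2,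
    fun ε hε hε1 => ?_⟩
  have hrw : (Real.log (1 / ε) : ℂ) * (Real.pi / (2 * Real.pi) ^ 2 *
      ∑ q ∈ R, q.1 ^ s * q.2 ^ t / ((√(quadDet τ q) : ℝ) : ℂ))
      = ∑ q ∈ R, rootTerm q s t
        ((Real.pi / √(quadDet τ q) * Real.log (1 / ε) : ℝ) : ℂ) := by
    rw [Finset.mul_sum, Finset.mul_sum]
    refine Finset.sum_congr rfl fun q _ => ?_
    rw [rootTerm]; push_cast; ring
  rw [hrw, ← Finset.sum_sub_distrib]
  refine norm_sum_le_of_le _ fun q hq => ?_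
  rw [← rootTerm_sub, norm_rootTerm (hunit q hq).1 (hunit q hq).2, ← Complex.ofReal_sub,
    Complex.norm_real, Real.norm_eq_abs]
  gcongr
  exact (hsimple q hq).abs_rootTail_sub_le hε hε1 s t

/-- For fixed `(s, t)` the covariance is a multiple of `log (1/ε)` up to a bounded error. -/
theorem exists_norm_planeCov_sub_log_le (hR : ∀ q : ℂ × ℂ, q ∈ R ↔
      ‖q.1‖ = 1 ∧ ‖q.2‖ = 1 ∧ charPoly τ q.1 q.2 = 0)
    (hsimple : ∀ q ∈ R, IsSimpleRoot τ q.1 q.2) (s t : ℤ) :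
    ∃ B : ℝ, ∀ᶠ ε : ℝ in 𝓝[>] 0,
      ‖planeCov τ ε s t
        - (Real.log (1 / ε) : ℂ) * (Real.pi / (2 * Real.pi) ^ 2 *
          ∑ q ∈ R, q.1 ^ s * q.2 ^ t / ((√(quadDet τ q) : ℝ) : ℂ))‖ ≤ B := by
  have hunit : ∀ q ∈ R, ‖q.1‖ = 1 ∧ ‖q.2‖ = 1 := fun q hq => ⟨((hR q).1 hq).1, ((hR q).1 hq).2.1⟩
  obtain ⟨B, hB⟩ := exists_planeCov_approx hR hsimple
  obtain ⟨B', hB'⟩ := exists_norm_sum_rootTail_sub_log_le hunit hsimple s t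
  obtain ⟨ε₁, hε₁, ρ, hρ⟩ := hB 1 one_pos
  refine ⟨B + B', ?_⟩
  filter_upwards [Ioo_mem_nhdsGT (lt_min hε₁ one_pos)] with ε hε
  have h1 := (hρ ε hε.1 (hε.2.trans_le (min_le_left _ _)) s t).1
  have h2 := hB' ε hε.1 (hε.2.le.trans (min_le_right _ _))
  exact (norm_sub_le_norm_sub_add_norm_sub _ _ _).trans (add_le_add h1 h2)

theorem tendsto_planeCov_div_sum_rootTerm (hR : ∀ q : ℂ × ℂ, q ∈ R ↔
      ‖q.1‖ = 1 ∧ ‖q.2‖ = 1 ∧ charPoly τ q.1 q.2 = 0)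
    (hsimple : ∀ q ∈ R, IsSimpleRoot τ q.1 q.2) {s t : ℤ} (hst : (s, t) ≠ (0, 0))
    (hS : ∑ q ∈ R, q.1 ^ s * q.2 ^ t / ((√(quadDet τ q) : ℝ) : ℂ) ≠ 0) :
    Tendsto (fun ε : ℝ =>
      planeCov τ ε s t / ∑ q ∈ R, rootTerm q s t (rootValue τ q ε s t : ℂ)) (𝓝[>] 0) (𝓝 1) := by
  have hunit : ∀ q ∈ R, ‖q.1‖ = 1 ∧ ‖q.2‖ = 1 := fun q hq => ⟨((hR q).1 hq).1, ((hR q).1 hq).2.1⟩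
  obtain ⟨K, hK, hKle⟩ := exists_norm_sum_rootTerm_sub_le hunit hsimple
  obtain ⟨B₁, hB₁⟩ := exists_norm_planeCov_sub_log_le hR hsimple s t
  obtain ⟨B₂, hB₂⟩ := exists_norm_sum_rootTail_sub_log_le hunit hsimple s t
  have hpi : (Real.pi : ℂ) ≠ 0 := by exact_mod_cast Real.pi_ne_zero
  refine tendsto_div_of_bounded_sub (𝕜 := ℂ) (L := fun ε => Real.log (1 / ε))
    (B := max B₁ (K / ((s : ℝ) ^ 2 + (t : ℝ) ^ 2) + B₂))
    (mul_ne_zero (div_ne_zero hpi (pow_ne_zero 2 (mul_ne_zero two_ne_zero hpi))) hS)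
    tendsto_log_inv ?_ ?_
  · exact hB₁.mono fun ε h => h.trans (le_max_left _ _)
  · filter_upwards [Ioo_mem_nhdsGT one_pos] with ε hε
    refine le_trans ?_ (le_max_right _ _)
    refine (norm_sub_le_norm_sub_add_norm_sub _
      (∑ q ∈ R, rootTerm q s t (rootTail τ q ε s t : ℂ)) _).trans (add_le_add ?_ ?_)
    · rw [norm_sub_rev]; exact hKle ε hε.1 s t hst
    · exact hB₂ ε hε.1 hε.2.le

theorem tendsto_planeCov_zero_div_log (hR : ∀ q : ℂ × ℂ, q ∈ R ↔
      ‖q.1‖ = 1 ∧ ‖q.2‖ = 1 ∧ charPoly τ q.1 q.2 = 0) (hne : R.Nonempty)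
    (hsimple : ∀ q ∈ R, IsSimpleRoot τ q.1 q.2) :
    Tendsto (fun ε : ℝ => (planeCov τ ε 0 0).re /
        ∑ q ∈ R, 1 / (2 * Real.pi * √(4 * quadA τ q * quadC τ q - quadB τ q ^ 2))
          * Real.log (1 / ε)) (𝓝[>] 0) (𝓝 1) := by
  obtain ⟨B, hB⟩ := exists_norm_planeCov_sub_log_le hR hsimple 0 0
  set S : ℝ := ∑ q ∈ R, 1 / (2 * Real.pi * √(4 * quadA τ q * quadC τ q - quadB τ q ^ 2)) with hS
  have hsqrt : ∀ q, √(4 * quadA τ q * quadC τ q - quadB τ q ^ 2) = 2 * √(quadDet τ q) := by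
    intro q
    have : 4 * quadA τ q * quadC τ q - quadB τ q ^ 2 = 2 ^ 2 * quadDet τ q := by
      unfold quadDet; ring
    rw [this, Real.sqrt_mul (by norm_num), Real.sqrt_sq (by norm_num)]
  have hSpos : 0 < S := by
    refine Finset.sum_pos (fun q hq => ?_) hne
    have := (hsimple q hq).quadDet_pos
    rw [hsqrt]
    positivity
  have hSC : (Real.pi / (2 * Real.pi) ^ 2 *
      ∑ q ∈ R, q.1 ^ (0 : ℤ) * q.2 ^ (0 : ℤ) / ((√(quadDet τ q) : ℝ) : ℂ)) = (S : ℂ) := by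
    rw [hS, Complex.ofReal_sum, Finset.mul_sum]
    refine Finset.sum_congr rfl fun q hq => ?_
    have h1 : ((√(quadDet τ q) : ℝ) : ℂ) ≠ 0 := by
      exact_mod_cast (Real.sqrt_pos.2 (hsimple q hq).quadDet_pos).ne'
    have h2 : (Real.pi : ℂ) ≠ 0 := by exact_mod_cast Real.pi_ne_zero
    rw [hsqrt, zpow_zero, zpow_zero]
    push_cast
    field_simp
  refine tendsto_div_of_bounded_sub (𝕜 := ℝ) (L := fun ε => Real.log (1 / ε)) (B := max B 0)
    hSpos.ne' tendsto_log_inv ?_ ?_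
  · filter_upwards [hB] with ε hε
    refine le_trans ?_ (hε.trans (le_max_left _ _))
    rw [hSC]
    refine le_of_eq_of_le ?_ (Complex.abs_re_le_norm _)
    rw [Real.norm_eq_abs, ← Complex.ofReal_mul, Complex.sub_re, Complex.ofReal_re]
    rfl
  · refine Eventually.of_forall fun ε => ?_
    rw [← Finset.sum_mul, ← hS]
    refine le_of_eq_of_le ?_ (le_max_right _ _)
    rw [norm_eq_zero, sub_eq_zero, mul_comm]
    rfl

end Asymptotics

end MultinomialTiling

end

open MultinomialTiling
theorem theorem6p1 (τ : Finset (ℤ × ℤ)) (R : Finset (ℂ × ℂ))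
    (hR : ∀ q : ℂ × ℂ, q ∈ R ↔ ‖q.1‖ = 1 ∧ ‖q.2‖ = 1 ∧ charPoly τ q.1 q.2 = 0)
    (hne : R.Nonempty)
    (hsimple : ∀ q ∈ R, IsSimpleRoot τ q.1 q.2) :
    ∃ (C : ℝ → ℤ → ℤ → ℝ) (J : ℂ × ℂ → ℝ → ℤ → ℤ → ℂ),
      -- `C ε s t` is the covariance `Cov(X_{0,0}, X_{s,t}) / (K w₀)`
      (∀ ε : ℝ, 0 < ε → ∀ s t : ℤ, HasPlaneCov τ ε s t (C ε s t)) ∧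
      -- `J q ε s t` is the integral at the root `q`, and it is a Bessel-K function
      (∀ q ∈ R, 0 < quadDet τ q ∧
        ∀ ε : ℝ, 0 < ε → ∀ s t : ℤ, (s, t) ≠ (0, 0) →
          HasImproperIntegral (rootIntegrand τ q ε s t) (J q ε s t) ∧
          J q ε s t = ((2 * Real.pi / √(quadDet τ q) *
            besselK (√(ε * (quadC τ q * (s : ℝ) ^ 2 - quadB τ q * (s : ℝ) * (t : ℝ)
              + quadA τ q * (t : ℝ) ^ 2) / quadDet τ q)) : ℝ) : ℂ)) ∧
      -- each root contributes its term up to a relative error `o(1)` as `ε → 0`,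
      -- uniformly for `(s,t) = O(ε^{-1/2})`
      (∀ M : ℝ, 0 < M → ∀ η : ℝ, 0 < η → ∃ ε₀ : ℝ, 0 < ε₀ ∧
        ∀ ε : ℝ, 0 < ε → ε < ε₀ → ∀ s t : ℤ, (s, t) ≠ (0, 0) →
          ε * ((s : ℝ) ^ 2 + (t : ℝ) ^ 2) ≤ M →
          ‖(C ε s t : ℂ) - ∑ q ∈ R, rootTerm q s t (J q ε s t)‖
            ≤ η * ∑ q ∈ R, ‖rootTerm q s t (J q ε s t)‖) ∧
      -- hence a factor `1 + o(1)` for the whole sum when its leading coefficient is not zero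
      (∀ s t : ℤ, (s, t) ≠ (0, 0) →
        ∑ q ∈ R, q.1 ^ s * q.2 ^ t / ((√(quadDet τ q) : ℝ) : ℂ) ≠ 0 →
        Tendsto (fun ε : ℝ => (C ε s t : ℂ) / ∑ q ∈ R, rootTerm q s t (J q ε s t))
          (𝓝[>] 0) (𝓝 1)) ∧
      -- the variance, where the integrals diverge
      Tendsto (fun ε : ℝ => C ε 0 0 /
          ∑ q ∈ R, 1 / (2 * Real.pi * √(4 * quadA τ q * quadC τ q - quadB τ q ^ 2))
            * Real.log (1 / ε))
        (𝓝[>] 0) (𝓝 1) := by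
  obtain ⟨q₀, hq₀⟩ := hne
  have hq₀' := (hR q₀).1 hq₀
  -- a translate of a single cell has no root, so the tori of the model are nondegenerate
  have hτ : 2 ≤ τ.card := (hsimple q₀ hq₀).two_le_card
    (norm_ne_zero_iff.1 (by rw [hq₀'.1]; exact one_ne_zero))
    (norm_ne_zero_iff.1 (by rw [hq₀'.2.1]; exact one_ne_zero))
  refine ⟨fun ε s t => (planeCov τ ε s t).re, fun q ε s t => (rootValue τ q ε s t : ℂ),
    fun ε hε s t => hasPlaneCov hτ hε s t, fun q hq => ⟨(hsimple q hq).quadDet_pos,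
      fun ε hε s t hst => ⟨hasImproperIntegral_rootIntegrand (hsimple q hq) hε hst, rfl⟩⟩,
    fun M _ η hη => ?_, fun s t hst hS => ?_, tendsto_planeCov_zero_div_log hR ⟨q₀, hq₀⟩ hsimple⟩
  · obtain ⟨ε₀, hε₀, h⟩ := planeCov_sub_sum_rootTerm_le hR ⟨q₀, hq₀⟩ hsimple (M := M) hη
    refine ⟨ε₀, hε₀, fun ε hε hlt s t hst hM => ?_⟩
    simp only [ofReal_planeCov_re τ hε]
    exact h ε hε hlt s t hst hM
  · refine (tendsto_planeCov_div_sum_rootTerm hR hsimple hst hS).congr' ?_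
    filter_upwards [self_mem_nhdsWithin] with ε hε
    rw [ofReal_planeCov_re τ hε]
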